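/- Let $n\in\mathbb N$, $T>0$, and let $A,B:\mathbb R\to\mathcal L(\mathbb R^n)$ and $f:\mathbb R\to\mathbb R^n$ be continuous and $T$-periodic. Assume that there is $\mu_0>0$ with $\|B(t)x\|\ge\mu_0\|x\|$ for all $t\in\mathbb R$, $x\in\mathbb R^n$. Let $U(t,s)$ be the evolution family generated by $A(\cdot)$, that is $\partial_tU(t,s)=A(t)U(t,s)$, $U(s,s)=I$, and assume that its growth bound is negative: $$\omega_0(U)=\inf\{\omega\in\mathbb R:\ \exists M\ \ \|U(t,s)\|\le Me^{\omega(t-s)}\ \text{ for all } s\le t\}<0 .$$ For $t\in\mathbb R$ let $\nu_t$ be the Gaussian measure on $\mathbb R^n$ with mean $g(t,-\infty)=\int_{-\infty}^tU(t,r)f(r)\,dr$ and covariance operator $Q(t,-\infty)=\int_{-\infty}^tU(t,r)B(r)B^*(r)U^*(t,r)\,dr$, and let $\nu$ be the Borel measure on $\mathbb R^{1+n}$ with $\nu(I\times K)=\int_I\nu_t(K)\,dt$ for Borel sets $I\subset\mathbb R$, $K\subset\mathbb R^n$. Let $L^2_\#(\mathbb R^{1+n},\nu)$ be the space of Lebesgue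 measurable $u:\mathbb R^{1+n}\to\mathbb R$ with $u(t+T,x)=u(t,x)$ for a.e. $(t,x)$ and finite norm $\|u\|=\big(\frac1T\int_0^T\int_{\mathbb R^n}u(t,x)^2\,d\nu_t\,dt\big)^{1/2}$. Let $H^{1,2}_\#(\mathbb R^{1+n},\nu)$ be the space of all $u\in L^2_{\rm loc}(\mathbb R^{1+n})$ whose weak derivatives $\partial_tu$, $D_iu$, $D_iD_ju$ ($1\le i,j\le n$) exist and belong to $L^2_{\rm loc}(\mathbb R^{1+n})$ and such that $u$, $\partial_tu$, $D_iu$, $D_iD_ju$ all belong to $L^2_\#(\mathbb R^{1+n},\nu)$, with norm the sum of the $L^2_\#$-norms of these functions. Let $D(G_0^\#)$ be the real linear span of the real and imaginary parts of the functions $\Phi(t)e^{i\langle x,h(t)\rangle}$ with $T$-periodic $\Phi\in C^1(\mathbb R)$ and $h\in C^1(\mathbb R;\mathbb R^n)$, and let $G_\#$ be the closure in $L^2_\#(\mathbb R^{1+n},\nu)$ of the operator $$G_0^\#u(t,x)=\partial_tu(t,x)+\tfrac12\operatorname{Tr}\big(B(t)B^*(t)D_x^2u(t,x)\big)+\langle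 A(t)x+f(t),D_xu(t,x)\rangle,\qquad u\in D(G_0^\#).$$ Then $H^{1,2}_\#(\mathbb R^{1+n},\nu)$ is compactly embedded in $L^2_\#(\mathbb R^{1+n},\nu)$: the inclusion is continuous, and every bounded sequence in $H^{1,2}_\#(\mathbb R^{1+n},\nu)$ has a subsequence that converges in $L^2_\#(\mathbb R^{1+n},\nu)$. Likewise $D(G_\#)$, endowed with the graph norm $\|u\|+\|G_\#u\|$, is compactly embedded in $L^2_\#(\mathbb R^{1+n},\nu)$. -/

import Mathlib

open MeasureTheory ProbabilityTheory Filter Topology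
open scoped ENNReal NNReal ContDiff InnerProductSpace

namespace OU

/-- The state space `ℝⁿ` with its Euclidean norm. -/
abbrev E (n : ℕ) : Type := EuclideanSpace ℝ (Fin n)

noncomputable section

/-! ### The evolution family generated by `A` -/

/-- The iterated integrals of the Peano-Baker series of `U' = A U`, `U(s) = 1`:
`P₀ = 1`, `Pₖ₊₁(t) = ∫ₛᵗ A(r) Pₖ(r) dr`. -/
def peanoBaker {n : ℕ} (A : ℝ → E n →L[ℝ] E n) (s : ℝ) : ℕ → ℝ → E n →L[ℝ] E n
  | 0 => fun _ => 1
  | k + 1 => fun t => ∫ r in s..t, A r * peanoBaker A s k r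

/-- The evolution family `U(t, s)` generated by the continuous function `A`: the solution of
`∂ₜ U(t, s) = A(t) U(t, s)`, `U(s, s) = 1`, given by its Peano-Baker series. -/
def evolution {n : ℕ} (A : ℝ → E n →L[ℝ] E n) (t s : ℝ) : E n →L[ℝ] E n :=
  ∑' k, peanoBaker A s k t

lemma continuous_peanoBaker {n : ℕ} {A : ℝ → E n →L[ℝ] E n} (hA : Continuous A) (s : ℝ) (k : ℕ) :
    Continuous (peanoBaker A s k) := by
  induction k with
  | zero => exact continuous_const
  | succ k ih =>
    exact intervalIntegral.continuous_primitive
      (fun a b => (hA.mul ih).intervalIntegrable a b) s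

lemma hasDerivAt_peanoBaker {n : ℕ} {A : ℝ → E n →L[ℝ] E n} (hA : Continuous A) (s t : ℝ)
    (k : ℕ) : HasDerivAt (peanoBaker A s (k + 1)) (A t * peanoBaker A s k t) t :=
  have h := hA.mul (continuous_peanoBaker hA s k)
  intervalIntegral.integral_hasDerivAt_right (h.intervalIntegrable _ _)
    (h.stronglyMeasurableAtFilter _ _) h.continuousAt

lemma norm_peanoBaker_le {n : ℕ} {A : ℝ → E n →L[ℝ] E n} {s R M : ℝ} (hM : 0 ≤ M)
    (hA : ∀ r, |r - s| < R → ‖A r‖ ≤ M) (k : ℕ) (t : ℝ) (ht : |t - s| < R) :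
    ‖peanoBaker A s k t‖ ≤ (M * |t - s|) ^ k / k.factorial := by
  induction k generalizing t with
  | zero => simpa [peanoBaker, ContinuousLinearMap.one_def] using
      ContinuousLinearMap.norm_id_le (𝕜 := ℝ) (E := E n)
  | succ k ih =>
    have hle : ∀ r ∈ Set.uIoc s t, |r - s| ≤ |t - s| := fun r hr => by
      rcases Set.mem_uIoc.1 hr with h | h
      · rw [abs_of_pos (by linarith), abs_of_pos (by linarith)]; linarith
      · rw [abs_of_nonpos (by linarith), abs_of_nonpos (by linarith)]; linarith
    have hint : IntegrableOn (fun r => M ^ (k + 1) / k.factorial * |r - s| ^ k) (Set.uIoc s t) :=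
      (Continuous.integrableOn_uIcc (by fun_prop)).mono_set Set.uIoc_subset_uIcc
    have h1 : ‖peanoBaker A s (k + 1) t‖
        ≤ ∫ r in Set.uIoc s t, M ^ (k + 1) / k.factorial * |r - s| ^ k := by
      refine (intervalIntegral.norm_integral_le_integral_norm_uIoc).trans ?_
      refine integral_mono_of_nonneg (Eventually.of_forall fun _ => norm_nonneg _) hint ?_
      refine (ae_restrict_iff' measurableSet_uIoc).2 (Eventually.of_forall fun r hr => ?_)
      have hr' : |r - s| < R := (hle r hr).trans_lt ht
      calc ‖A r * peanoBaker A s k r‖ ≤ ‖A r‖ * ‖peanoBaker A s k r‖ := norm_mul_le _ _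
        _ ≤ M * ((M * |r - s|) ^ k / k.factorial) :=
            mul_le_mul (hA r hr') (ih r hr') (norm_nonneg _) hM
        _ = M ^ (k + 1) / k.factorial * |r - s| ^ k := by rw [mul_pow]; ring
    refine h1.trans (le_of_eq ?_)
    rw [integral_const_mul, integral_pow_abs_sub_uIoc, Nat.factorial_succ]
    push_cast
    rw [mul_pow]
    field_simp

/-- The value at `t = s` of the evolution family. -/
lemma evolution_self {n : ℕ} (A : ℝ → E n →L[ℝ] E n) (s : ℝ) : evolution A s s = 1 := by
  rw [evolution, tsum_eq_single 0]
  · rfl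
  · rintro (_ | k) hk
    · exact absurd rfl hk
    · simp [peanoBaker]

/-- The differential equation of the evolution family. -/
lemma hasDerivAt_evolution {n : ℕ} {A : ℝ → E n →L[ℝ] E n} (hA : Continuous A) (t s : ℝ) :
    HasDerivAt (fun τ => evolution A τ s) (A t * evolution A t s) t := by
  obtain ⟨R, hR⟩ : ∃ R : ℝ, R = |t - s| + 1 := ⟨_, rfl⟩
  obtain ⟨M, hM⟩ := (isCompact_Icc (a := s - R) (b := s + R)).exists_bound_of_continuousOn
    hA.continuousOn
  have hM' : ∀ r, |r - s| < R → ‖A r‖ ≤ M := fun r hr =>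
    hM r ⟨by linarith [(abs_lt.1 hr).1], by linarith [(abs_lt.1 hr).2]⟩
  have hR0 : 0 < R := by rw [hR]; positivity
  have hM0 : 0 ≤ M := (norm_nonneg _).trans (hM' s (by simpa using hR0))
  have hb : ∀ k y, |y - s| < R → ‖peanoBaker A s k y‖ ≤ (M * R) ^ k / k.factorial :=
    fun k y hy => (norm_peanoBaker_le hM0 hM' k y hy).trans (by gcongr)
  have hsum : ∀ y, |y - s| < R → Summable fun k => peanoBaker A s k y := fun y hy =>
    Summable.of_norm_bounded (Real.summable_pow_div_factorial (M * R)) fun k => hb k y hy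
  have hball : ∀ y, y ∈ Metric.ball s R ↔ |y - s| < R := fun y => by
    rw [Metric.mem_ball, Real.dist_eq]
  have ht : |t - s| < R := by linarith
  have hmem := (hball t).2 ht
  have hs1 : Summable fun k => peanoBaker A s (k + 1) t :=
    (summable_nat_add_iff (f := fun k => peanoBaker A s k t) 1).2 (hsum t ht)
  have key : HasDerivAt (fun τ => ∑' k, peanoBaker A s (k + 1) τ)
      (∑' k, A t * peanoBaker A s k t) t := by
    refine hasDerivAt_tsum_of_isPreconnected (t := Metric.ball s R) (y₀ := t)
      (g' := fun k y => A y * peanoBaker A s k y)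
      ((Real.summable_pow_div_factorial (M * R)).mul_left M) Metric.isOpen_ball
      (convex_ball s R).isPreconnected (fun k y _ => hasDerivAt_peanoBaker hA s y k) ?_
      hmem hs1 hmem
    intro k y hy
    exact (norm_mul_le _ _).trans (mul_le_mul (hM' y ((hball y).1 hy)) (hb k y ((hball y).1 hy))
      (norm_nonneg _) hM0)
  rw [(hsum t ht).tsum_mul_left (A t)] at key
  refine (key.const_add 1).congr_of_eventuallyEq ?_
  filter_upwards [Metric.isOpen_ball.mem_nhds hmem] with y hy
  rw [evolution, (hsum y ((hball y).1 hy)).tsum_eq_zero_add]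
  rfl

/-- The growth bound `ω₀(U)`: the infimum (in the extended reals) of all `a` such that
`‖U(t, s)‖ ≤ M e^{a (t - s)}` for all `s ≤ t`, for some `M`. -/
def growthBound {n : ℕ} (A : ℝ → E n →L[ℝ] E n) : EReal :=
  sInf {w : EReal | ∃ a : ℝ, w = (a : EReal) ∧
    ∃ M : ℝ, ∀ s t : ℝ, s ≤ t → ‖evolution A t s‖ ≤ M * Real.exp (a * (t - s))}

/-! ### The Gaussian measures `ν_t` and the measure `ν` -/

/-- `g(t, -∞) = ∫_{-∞}^t U(t, r) f(r) dr`. -/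
def meanVec {n : ℕ} (A : ℝ → E n →L[ℝ] E n) (f : ℝ → E n) (t : ℝ) : E n :=
  ∫ r in Set.Iic t, evolution A t r (f r)

/-- `Q(t, -∞) = ∫_{-∞}^t U(t, r) B(r) B*(r) U*(t, r) dr`. -/
def covOp {n : ℕ} (A B : ℝ → E n →L[ℝ] E n) (t : ℝ) : E n →L[ℝ] E n :=
  ∫ r in Set.Iic t, evolution A t r * B r * (ContinuousLinearMap.adjoint (B r)) *
    (ContinuousLinearMap.adjoint (evolution A t r))

/-- `ν_t`, the Gaussian measure on `ℝⁿ` with mean `g(t, -∞)` and covariance operator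
`Q(t, -∞)`. -/
def nuAt {n : ℕ} (A B : ℝ → E n →L[ℝ] E n) (f : ℝ → E n) (t : ℝ) : Measure (E n) :=
  multivariateGaussian (meanVec A f t)
    ((Matrix.toEuclideanCLM (n := Fin n) (𝕜 := ℝ)).symm (covOp A B t))

/-- The measure `ν` on `ℝ × ℝⁿ` with `ν(I × K) = ∫_I ν_t(K) dt`, that is
`ν = ∫ (δ_t ⊗ ν_t) dt`. -/
def nu {n : ℕ} (A B : ℝ → E n →L[ℝ] E n) (f : ℝ → E n) : Measure (ℝ × E n) :=
  (volume : Measure ℝ).bind fun t => (nuAt A B f t).map (Prod.mk t)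

/-! ### The space `L²_#`, for a measure `ν` on `ℝ × ℝⁿ` and a period `T` -/

/-- The probability measure `T⁻¹ ν` on `(0, T) × ℝⁿ`. -/
def periodMeasure {n : ℕ} (T : ℝ) (ν : Measure (ℝ × E n)) : Measure (ℝ × E n) :=
  (ENNReal.ofReal T)⁻¹ • ν.restrict (Set.Ioo 0 T ×ˢ Set.univ)

/-- `u ∈ L²_#(ℝ^{1+n}, ν)`: `u` is Lebesgue measurable, `T`-periodic in time a.e., and square
integrable with respect to `ν` on `(0, T) × ℝⁿ`. -/
def MemL2Sharp {n : ℕ} (T : ℝ) (ν : Measure (ℝ × E n)) (u : ℝ × E n → ℝ) : Prop :=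
  AEStronglyMeasurable u volume ∧
    (∀ᵐ z : ℝ × E n, u (z.1 + T, z.2) = u z) ∧ MemLp u 2 (periodMeasure T ν)

/-- The norm `(T⁻¹ ∫₀ᵀ ∫ u² dν_t dt)^{1/2}` of `L²_#`. -/
def l2Norm {n : ℕ} (T : ℝ) (ν : Measure (ℝ × E n)) (u : ℝ × E n → ℝ) : ℝ≥0∞ :=
  eLpNorm u 2 (periodMeasure T ν)

/-- A space of functions `D` with norm `N` is compactly embedded in `L²_#`: it is contained in
`L²_#` with continuous inclusion, and every `N`-bounded sequence in `D` has a subsequence that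
converges in `L²_#`. -/
def CompactlyEmbedded {n : ℕ} (T : ℝ) (ν : Measure (ℝ × E n)) (D : Set (ℝ × E n → ℝ))
    (N : (ℝ × E n → ℝ) → ℝ≥0∞) : Prop :=
  (∀ u ∈ D, MemL2Sharp T ν u) ∧
  (∃ K : ℝ≥0, ∀ u ∈ D, l2Norm T ν u ≤ K * N u) ∧
  ∀ u : ℕ → ℝ × E n → ℝ, (∀ k, u k ∈ D) → (∃ C : ℝ≥0, ∀ k, N (u k) ≤ C) →
    ∃ φ : ℕ → ℕ, StrictMono φ ∧ ∃ v : ℝ × E n → ℝ, MemL2Sharp T ν v ∧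
      Tendsto (fun k => l2Norm T ν (u (φ k) - v)) atTop (𝓝 0)

/-! ### Weak derivatives and the space `H^{1,2}_#` -/

/-- `v ∈ L²_loc(ℝ^{1+n})`, with respect to Lebesgue measure. -/
def MemL2Loc {n : ℕ} (v : ℝ × E n → ℝ) : Prop :=
  ∀ K : Set (ℝ × E n), IsCompact K → MemLp v 2 (volume.restrict K)

/-- `v` is a weak (distributional) derivative of `u` on `ℝ^{1+n}` in the direction `e`. -/
def HasWeakDeriv {n : ℕ} (u v : ℝ × E n → ℝ) (e : ℝ × E n) : Prop :=
  LocallyIntegrable u volume ∧ LocallyIntegrable v volume ∧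
    ∀ φ : ℝ × E n → ℝ, ContDiff ℝ ∞ φ → HasCompactSupport φ →
      ∫ z, u z * fderiv ℝ φ z e = -∫ z, v z * φ z

open Classical in
/-- The weak derivative in the direction `e`, unique up to null sets when it exists. -/
def weakDeriv {n : ℕ} (e : ℝ × E n) (u : ℝ × E n → ℝ) : ℝ × E n → ℝ :=
  if h : ∃ v, HasWeakDeriv u v e then h.choose else 0

/-- The time direction. -/
def timeDir (n : ℕ) : ℝ × E n := (1, 0)

/-- The `i`-th space direction. -/
def spaceDir {n : ℕ} (i : Fin n) : ℝ × E n := (0, EuclideanSpace.single i 1)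

/-- The weak derivative `∂ₜ u`. -/
abbrev wdt {n : ℕ} (u : ℝ × E n → ℝ) : ℝ × E n → ℝ := weakDeriv (timeDir n) u

/-- The weak derivative `D_i u` in space. -/
abbrev wdx {n : ℕ} (i : Fin n) (u : ℝ × E n → ℝ) : ℝ × E n → ℝ := weakDeriv (spaceDir i) u

/-- `u ∈ H^{1,2}_loc(ℝ^{1+n})`: the function and its weak derivatives `∂ₜ u`, `D_i u`, `D_i D_j u`
exist and belong to `L²_loc`. -/
def MemH12Loc {n : ℕ} (u : ℝ × E n → ℝ) : Prop :=
  MemL2Loc u ∧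
  ((∃ v, HasWeakDeriv u v (timeDir n)) ∧ MemL2Loc (wdt u)) ∧
  (∀ i, (∃ v, HasWeakDeriv u v (spaceDir i)) ∧ MemL2Loc (wdx i u)) ∧
  ∀ i j, (∃ v, HasWeakDeriv (wdx j u) v (spaceDir i)) ∧ MemL2Loc (wdx i (wdx j u))

/-- `u ∈ H^{1,2}_#(ℝ^{1+n}, ν)`: `u ∈ H^{1,2}_loc`, and `u`, `∂ₜ u`, `D_i u`, `D_i D_j u` belong
to `L²_#`. -/
def MemH12Sharp {n : ℕ} (T : ℝ) (ν : Measure (ℝ × E n)) (u : ℝ × E n → ℝ) : Prop :=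
  MemH12Loc u ∧ MemL2Sharp T ν u ∧ MemL2Sharp T ν (wdt u) ∧
    (∀ i, MemL2Sharp T ν (wdx i u)) ∧ ∀ i j, MemL2Sharp T ν (wdx i (wdx j u))

/-- The norm of `H^{1,2}_#`. -/
def h12Norm {n : ℕ} (T : ℝ) (ν : Measure (ℝ × E n)) (u : ℝ × E n → ℝ) : ℝ≥0∞ :=
  l2Norm T ν u + l2Norm T ν (wdt u) + ∑ i, l2Norm T ν (wdx i u) +
    ∑ i, ∑ j, l2Norm T ν (wdx i (wdx j u))

/-! ### The operator `G_#` -/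

/-- The Kolmogorov operator
`𝒢u(t, x) = ∂ₜu + ½ Tr(B(t) B*(t) D²ₓu) + ⟨A(t) x + f(t), Dₓu⟩` on classical functions. -/
def kolmogorov {n : ℕ} (A B : ℝ → E n →L[ℝ] E n) (f : ℝ → E n) (u : ℝ × E n → ℝ)
    (z : ℝ × E n) : ℝ :=
  deriv (fun s => u (s, z.2)) z.1 +
    (1 / 2 : ℝ) * LinearMap.trace ℝ (E n)
      (B z.1 * ContinuousLinearMap.adjoint (B z.1) *
        fderiv ℝ (gradient fun x => u (z.1, x)) z.2 : E n →L[ℝ] E n).toLinearMap +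
    ⟪A z.1 z.2 + f z.1, gradient (fun x => u (z.1, x)) z.2⟫_ℝ

/-- `D(G_0^#)`: the real linear span of the real and imaginary parts of the functions
`Φ(t) e^{i⟨x, h(t)⟩}` with `T`-periodic `Φ ∈ C¹(ℝ)` and `h ∈ C¹(ℝ; ℝⁿ)`. -/
def coreSharp (n : ℕ) (T : ℝ) : Submodule ℝ (ℝ × E n → ℝ) :=
  Submodule.span ℝ {u | ∃ (Φ : ℝ → ℝ) (h : ℝ → E n), ContDiff ℝ 1 Φ ∧ Function.Periodic Φ T ∧
    ContDiff ℝ 1 h ∧ Function.Periodic h T ∧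
    ((u = fun z => Φ z.1 * Real.cos ⟪z.2, h z.1⟫_ℝ) ∨
      (u = fun z => Φ z.1 * Real.sin ⟪z.2, h z.1⟫_ℝ))}

/-- `(u, w)` belongs to the graph of `G_#`, the closure in `L²_# × L²_#` of the graph of `𝒢`
on `D(G_0^#)`. -/
def InGraphGSharp {n : ℕ} (A B : ℝ → E n →L[ℝ] E n) (f : ℝ → E n) (T : ℝ)
    (u w : ℝ × E n → ℝ) : Prop :=
  MemL2Sharp T (nu A B f) u ∧ MemL2Sharp T (nu A B f) w ∧
    ∃ v : ℕ → ℝ × E n → ℝ, (∀ k, v k ∈ coreSharp n T) ∧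
      Tendsto (fun k => l2Norm T (nu A B f) (v k - u)) atTop (𝓝 0) ∧
      Tendsto (fun k => l2Norm T (nu A B f) (kolmogorov A B f (v k) - w)) atTop (𝓝 0)

/-- The domain `D(G_#)`. -/
def domGSharp {n : ℕ} (A B : ℝ → E n →L[ℝ] E n) (f : ℝ → E n) (T : ℝ) : Set (ℝ × E n → ℝ) :=
  {u | ∃ w, InGraphGSharp A B f T u w}

open Classical in
/-- The function `G_# u` for `u ∈ D(G_#)`; it is unique up to null sets because `G_0^#` is
closable. -/
def gSharp {n : ℕ} (A B : ℝ → E n →L[ℝ] E n) (f : ℝ → E n) (T : ℝ) (u : ℝ × E n → ℝ) :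
    ℝ × E n → ℝ :=
  if h : ∃ w, InGraphGSharp A B f T u w then h.choose else 0

/-- The graph norm `‖u‖ + ‖G_# u‖` of `D(G_#)`. -/
def graphNorm {n : ℕ} (A B : ℝ → E n →L[ℝ] E n) (f : ℝ → E n) (T : ℝ) (u : ℝ × E n → ℝ) :
    ℝ≥0∞ :=
  l2Norm T (nu A B f) u + l2Norm T (nu A B f) (gSharp A B f T u)

end

end OU

/-!
Both embeddings follow from one compactness criterion, `OU.Setting.exists_subseq_tendsto`. Let
`w k` be functions of class `C¹`, bounded in `L²(ν)` together with their spatial gradients, such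
that the functions `t ↦ ∫ w k (t, x) ψ(x) dx` are Hölder continuous with exponent `1/2`, uniformly
in `k` and in `ψ` ranging over smooth functions with bounded support, values and gradients
(`TimeEquicontinuous`). Then a subsequence converges in `L²_#`. To see this, pass to a weakly
convergent subsequence and split the `L²(ν)` norm of a difference `w i - w j` into three parts
(`Setting.exists_lintegral_sq_le`).

* The part on `|x| > R` is `O(1/R)`, because `∫ |x|² w² dν ≤ C ∫ (w² + |Dₓw|²) dν`
  (`Setting.exists_tail_le`). For the standard Gaussian measure this is an integration by parts, and
  `ν_t` is its image under the affine map `y ↦ g(t) + Q(t)^{1/2} y`, which is continuous and periodic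
  in `t` and invertible because `B` is.
* On `|x| ≤ R`, where `ν` and Lebesgue measure are comparable, the error of a mollification in the
  space variable at scale `δ` is at most `C δ ‖Dₓ(w i - w j)‖`.
* The space mollification of `w k` at `(t, x)` is `∫ w k (t, y) ρ(x - y) dy`. Its averages over
  intervals of times converge by weak convergence, and equicontinuity in time turns this into
  convergence at every point (`cauchySeq_of_holder`). Dominated convergence finishes the argument.

For `H^{1,2}_#`, mollification and a cutoff in space approximate the given functions by `C¹` functions
with bounded first derivatives (`Setting.exists_approx_h12`), and equicontinuity in time is the
Cauchy–Schwarz inequality applied to the time derivative (`Setting.timeEquicontinuous`). The second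
derivatives play no role.

For `D(G_#)`, the approximating functions are taken from the core `D(G_0^#)`. Here neither a bound on
the spatial gradient nor one on the time derivative is given, and both come from the equation.

* The equations `g' = A g + f` and `Q' = A Q + Q A* + B B*` give
  `d/dt ∫ u(t, ·) dν_t = ∫ 𝒢u(t, ·) dν_t` for `u` in the core, hence `∫ 𝒢u dν = 0` over a period. The
  core is an algebra, and `𝒢(u²) = 2 u 𝒢u + |B* Dₓu|²`. Integrating this identity yields
  `‖Dₓu‖ ≤ K (‖u‖ + ‖𝒢u‖)` (`Setting.exists_eLpNorm_dx_le`).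
* In `∫ ∂ₜu(t, x) ψ(x) dx` substitute `∂ₜu = 𝒢u - ½ Tr(B B* Dₓ²u) - ⟨A x + f, Dₓu⟩` and integrate the
  second order term by parts once. What remains is bounded by `𝒢u` and `Dₓu`, and this gives
  equicontinuity in time (`Setting.timeEquicontinuous_core`).
-/

namespace OU

noncomputable section

/-! ### The evolution family, the means and the covariances -/

section Operators

variable {F : Type*} [NormedAddCommGroup F] [InnerProductSpace ℝ F] [CompleteSpace F]
  {α : Type*} [MeasurableSpace α] {μ : Measure α}

lemma integral_conj_adjoint (V : F →L[ℝ] F) {W C : α → F →L[ℝ] F}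
    (h : Integrable (fun r => W r * C r * ContinuousLinearMap.adjoint (C r) *
      ContinuousLinearMap.adjoint (W r)) μ) :
    ∫ r, V * W r * C r * ContinuousLinearMap.adjoint (C r) *
      ContinuousLinearMap.adjoint (V * W r) ∂μ =
    V * (∫ r, W r * C r * ContinuousLinearMap.adjoint (C r) *
      ContinuousLinearMap.adjoint (W r) ∂μ) * ContinuousLinearMap.adjoint V := by
  rw [← integral_const_mul_of_integrable h, ← integral_mul_const_of_integrable (h.const_mul V)]
  congr 1; ext1 r
  have : ContinuousLinearMap.adjoint (V * W r)
      = ContinuousLinearMap.adjoint (W r) * ContinuousLinearMap.adjoint V :=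
    ContinuousLinearMap.adjoint_comp _ _
  rw [this]
  simp only [mul_assoc]

omit [CompleteSpace F] in
lemma integrable_inner_apply {L : α → F →L[ℝ] F} (h : Integrable L μ) (x y : F) :
    Integrable (fun r => ⟪x, L r y⟫_ℝ) μ :=
  (h.apply_continuousLinearMap y).const_inner x

lemma inner_integral_apply {L : α → F →L[ℝ] F} (h : Integrable L μ) (x y : F) :
    ⟪x, (∫ r, L r ∂μ) y⟫_ℝ = ∫ r, ⟪x, L r y⟫_ℝ ∂μ := by
  rw [ContinuousLinearMap.integral_apply h]
  exact (integral_inner (h.apply_continuousLinearMap y) x).symm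

lemma adjoint_mul_adjoint_eq_one {V W : F →L[ℝ] F} (h : V * W = 1) :
    ContinuousLinearMap.adjoint W * ContinuousLinearMap.adjoint V = 1 := by
  have : ContinuousLinearMap.adjoint (V * W)
      = ContinuousLinearMap.adjoint W * ContinuousLinearMap.adjoint V :=
    ContinuousLinearMap.adjoint_comp _ _
  rw [← this, h]
  exact ContinuousLinearMap.adjoint_id

/-- Derivative of `V P V*` when `V' = A V` and `P' = W C C* W*` with `V W = 1`. -/
lemma hasDerivAt_conj_adjoint {V P : ℝ → F →L[ℝ] F} {A W C : F →L[ℝ] F} {t : ℝ}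
    (hV : HasDerivAt V (A * V t) t)
    (hP : HasDerivAt P (W * C * ContinuousLinearMap.adjoint C * ContinuousLinearMap.adjoint W) t)
    (hVW : V t * W = 1) :
    HasDerivAt (fun t => V t * P t * ContinuousLinearMap.adjoint (V t))
      (A * (V t * P t * ContinuousLinearMap.adjoint (V t)) +
        V t * P t * ContinuousLinearMap.adjoint (V t) * ContinuousLinearMap.adjoint A +
        C * ContinuousLinearMap.adjoint C) t := by
  have h4 : HasDerivAt (fun t => ContinuousLinearMap.adjoint (V t))
      (ContinuousLinearMap.adjoint (A * V t)) t :=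
    ((ContinuousLinearMap.adjoint (𝕜 := ℝ) (E := F)
      (F := F)).toContinuousLinearEquiv.toContinuousLinearMap).hasFDerivAt.comp_hasDerivAt t hV
  refine ((hV.mul hP).mul h4).congr_deriv ?_
  have e3 : ContinuousLinearMap.adjoint (A * V t)
      = ContinuousLinearMap.adjoint (V t) * ContinuousLinearMap.adjoint A :=
    ContinuousLinearMap.adjoint_comp _ _
  have e4 : V t * (W * C * ContinuousLinearMap.adjoint C * ContinuousLinearMap.adjoint W) *
      ContinuousLinearMap.adjoint (V t) = C * ContinuousLinearMap.adjoint C := by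
    calc _ = (V t * W) * C * ContinuousLinearMap.adjoint C *
        (ContinuousLinearMap.adjoint W * ContinuousLinearMap.adjoint (V t)) := by
          simp only [mul_assoc]
      _ = _ := by rw [hVW, adjoint_mul_adjoint_eq_one hVW, one_mul, mul_one]
  rw [add_mul, e4, e3]
  simp only [Pi.mul_apply, mul_assoc]
  abel

end Operators

section Evolution

variable {n : ℕ} {A B : ℝ → E n →L[ℝ] E n} {f : ℝ → E n} {T : ℝ}

lemma exists_norm_le_of_periodic {X : Type*} [NormedAddCommGroup X] {F : ℝ → X} {T : ℝ}
    (hT : 0 < T) (hF : Continuous F) (hFT : Function.Periodic F T) :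
    ∃ C, 0 < C ∧ ∀ t, ‖F t‖ ≤ C := by
  obtain ⟨C, hC⟩ := (hFT.isBounded_of_continuous hT.ne' hF).exists_norm_le
  exact ⟨max C 1, by positivity, fun t => (hC _ ⟨t, rfl⟩).trans (le_max_left _ _)⟩

/-- Uniqueness for the linear equation `X' = A X` with bounded `A`. -/
lemma eq_of_hasDerivAt_mul {K : ℝ} (hK : ∀ t, ‖A t‖ ≤ K) {X Y : ℝ → E n →L[ℝ] E n} {s : ℝ}
    (hX : ∀ t, HasDerivAt X (A t * X t) t) (hY : ∀ t, HasDerivAt Y (A t * Y t) t)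
    (h : X s = Y s) : X = Y := by
  have hK0 : 0 ≤ K := (norm_nonneg _).trans (hK 0)
  refine ODE_solution_unique_univ (v := fun t Z => A t * Z) (s := fun _ => Set.univ)
    (K := K.toNNReal) (fun t => ?_) (fun t => ⟨hX t, trivial⟩) (fun t => ⟨hY t, trivial⟩) h
  refine LipschitzWith.lipschitzOnWith (LipschitzWith.of_dist_le_mul fun Z Z' => ?_)
  rw [dist_eq_norm, dist_eq_norm, ← mul_sub, Real.coe_toNNReal _ hK0]
  exact (norm_mul_le _ _).trans (by gcongr; exact hK t)

/-- The cocycle property `U(t, s) U(s, r) = U(t, r)`, for all `t, s, r` and not only for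
`r ≤ s ≤ t`. As a consequence `U(t, s)` is invertible, and integrals of `U(t, r)` over `r ≤ t` can
be pulled back to time `0`. -/
lemma evolution_mul (hT : 0 < T) (hA : Continuous A) (hAT : Function.Periodic A T) (t s r : ℝ) :
    evolution A t s * evolution A s r = evolution A t r := by
  obtain ⟨K, -, hK⟩ := exists_norm_le_of_periodic hT hA hAT
  refine congrFun (eq_of_hasDerivAt_mul (s := s)
    (X := fun t => evolution A t s * evolution A s r) (Y := fun t => evolution A t r) hK
    (fun t => ?_) (fun t => hasDerivAt_evolution hA t r) (by simp [evolution_self])) t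
  rw [← mul_assoc]
  exact (hasDerivAt_evolution hA t s).mul_const _

lemma evolution_add_period (hT : 0 < T) (hA : Continuous A) (hAT : Function.Periodic A T)
    (t s : ℝ) : evolution A (t + T) (s + T) = evolution A t s := by
  obtain ⟨K, -, hK⟩ := exists_norm_le_of_periodic hT hA hAT
  refine congrFun (eq_of_hasDerivAt_mul (s := s)
    (X := fun t => evolution A (t + T) (s + T)) (Y := fun t => evolution A t s) hK
    (fun t => ?_) (fun t => hasDerivAt_evolution hA t s) (by simp [evolution_self])) t
  have := (hasDerivAt_evolution hA (t + T) (s + T)).comp_add_const t T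
  rwa [hAT t] at this

lemma isUnit_evolution (hT : 0 < T) (hA : Continuous A) (hAT : Function.Periodic A T) (t s : ℝ) :
    IsUnit (evolution A t s) :=
  ⟨⟨evolution A t s, evolution A s t,
    by rw [evolution_mul hT hA hAT, evolution_self],
    by rw [evolution_mul hT hA hAT, evolution_self]⟩, rfl⟩

lemma continuous_evolution_left (hA : Continuous A) (s : ℝ) :
    Continuous fun t => evolution A t s :=
  continuous_iff_continuousAt.2 fun t => (hasDerivAt_evolution hA t s).continuousAt

lemma continuous_evolution_right (hT : 0 < T) (hA : Continuous A) (hAT : Function.Periodic A T) :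
    Continuous fun r => evolution A 0 r := by
  -- the differential equation gives continuity in the first variable only; `U(0, r) = U(r, 0)⁻¹`
  have h : (fun r => evolution A 0 r) = fun r => Ring.inverse (evolution A r 0) := by
    ext1 r
    refine (Ring.inverse_unit (⟨evolution A r 0, evolution A 0 r,
      by rw [evolution_mul hT hA hAT, evolution_self],
      by rw [evolution_mul hT hA hAT, evolution_self]⟩ : (E n →L[ℝ] E n)ˣ)).symm
  rw [h]
  refine continuous_iff_continuousAt.2 fun r => ?_
  obtain ⟨u, hu⟩ := isUnit_evolution hT hA hAT r 0
  refine ContinuousAt.comp (g := Ring.inverse) ?_ (continuous_evolution_left hA 0).continuousAt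
  rw [← hu]
  exact NormedRing.inverse_continuousAt u

/-- The negative growth bound gives exponential decay of `U(0, r)` as `r → -∞`. -/
lemma exists_evolution_le (hU : growthBound A < 0) :
    ∃ M b : ℝ, 0 < M ∧ 0 < b ∧ ∀ r ≤ 0, ‖evolution A 0 r‖ ≤ M * Real.exp (b * r) := by
  obtain ⟨w, ⟨a, rfl, M, hM⟩, ha⟩ := sInf_lt_iff.1 hU
  have ha0 : a < 0 := by exact_mod_cast ha
  refine ⟨max M 1, -a, by positivity, by linarith, fun r hr => (hM r 0 hr).trans ?_⟩
  have : a * (0 - r) = -a * r := by ring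
  rw [this]
  gcongr
  exact le_max_left _ _

lemma integrableOn_Iic_of_exp_bound {X : Type*} [NormedAddCommGroup X] {F : ℝ → X}
    (hF : Continuous F) {C b : ℝ} (hb : 0 < b) (h : ∀ r ≤ 0, ‖F r‖ ≤ C * Real.exp (b * r))
    (t : ℝ) : IntegrableOn F (Set.Iic t) := by
  have h0 : IntegrableOn F (Set.Iic 0) := by
    refine Integrable.mono' ((integrableOn_exp_mul_Iic hb 0).const_mul C)
      hF.aestronglyMeasurable ?_
    exact (ae_restrict_iff' measurableSet_Iic).2 (Eventually.of_forall fun r hr => h r hr)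
  refine (h0.union (hF.integrableOn_uIcc (a := 0) (b := t))).mono_set fun x hx => ?_
  rcases le_total x 0 with hx0 | hx0
  · exact Or.inl hx0
  · exact Or.inr (Set.mem_uIcc.2 (Or.inl ⟨hx0, hx⟩))

lemma hasDerivAt_integral_Iic {X : Type*} [NormedAddCommGroup X] [NormedSpace ℝ X]
    [CompleteSpace X] {F : ℝ → X} (hF : Continuous F) (hi : ∀ t, IntegrableOn F (Set.Iic t))
    (t : ℝ) : HasDerivAt (fun t => ∫ r in Set.Iic t, F r) (F t) t := by
  have h1 : (fun t => ∫ r in Set.Iic t, F r)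
      = fun t => (∫ r in Set.Iic 0, F r) + ∫ r in (0 : ℝ)..t, F r := by
    ext1 t
    rw [← intervalIntegral.integral_Iic_sub_Iic (hi 0) (hi t)]
    abel
  rw [h1]
  exact (intervalIntegral.integral_hasDerivAt_right (hF.intervalIntegrable _ _)
    (hF.stronglyMeasurableAtFilter _ _) hF.continuousAt).const_add _

/-- `∫_{-∞}^t U(0, r) f(r) dr`, so that `g(t, -∞) = U(t, 0) ∫_{-∞}^t U(0, r) f(r) dr`. -/
def meanAux (A : ℝ → E n →L[ℝ] E n) (f : ℝ → E n) (t : ℝ) : E n :=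
  ∫ r in Set.Iic t, evolution A 0 r (f r)

/-- The integrand `U(0, r) B(r) B*(r) U*(0, r)` of the covariance, pulled back to time `0`. -/
def covDensity (A B : ℝ → E n →L[ℝ] E n) (r : ℝ) : E n →L[ℝ] E n :=
  evolution A 0 r * B r * (ContinuousLinearMap.adjoint (B r)) *
    (ContinuousLinearMap.adjoint (evolution A 0 r))

/-- `∫_{-∞}^t U(0, r) B(r) B*(r) U*(0, r) dr`. -/
def covAux (A B : ℝ → E n →L[ℝ] E n) (t : ℝ) : E n →L[ℝ] E n :=
  ∫ r in Set.Iic t, covDensity A B r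

/-- The standing assumptions: continuous `T`-periodic coefficients, uniformly invertible `B`, and
negative growth bound. -/
structure Setting (A B : ℝ → E n →L[ℝ] E n) (f : ℝ → E n) (T : ℝ) : Prop where
  pos : 0 < T
  contA : Continuous A
  contB : Continuous B
  contf : Continuous f
  perA : Function.Periodic A T
  perB : Function.Periodic B T
  perf : Function.Periodic f T
  lower : ∃ μ₀ : ℝ, 0 < μ₀ ∧ ∀ (t : ℝ) (x : E n), μ₀ * ‖x‖ ≤ ‖B t x‖
  growth : growthBound A < 0

lemma Setting.continuous_meanIntegrand (H : Setting A B f T) :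
    Continuous fun r => evolution A 0 r (f r) :=
  (continuous_evolution_right H.pos H.contA H.perA).clm_apply H.contf

lemma Setting.integrableOn_meanIntegrand (H : Setting A B f T) (t : ℝ) :
    IntegrableOn (fun r => evolution A 0 r (f r)) (Set.Iic t) := by
  obtain ⟨M, b, hM, hb, h⟩ := exists_evolution_le H.growth
  obtain ⟨C, hC, hf⟩ := exists_norm_le_of_periodic H.pos H.contf H.perf
  refine integrableOn_Iic_of_exp_bound H.continuous_meanIntegrand (C := M * C) hb
    (fun r hr => ?_) t
  calc ‖evolution A 0 r (f r)‖ ≤ ‖evolution A 0 r‖ * ‖f r‖ := ContinuousLinearMap.le_opNorm _ _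
    _ ≤ (M * Real.exp (b * r)) * C := by gcongr; exacts [h r hr, hf r]
    _ = _ := by ring

lemma Setting.meanVec_eq (H : Setting A B f T) (t : ℝ) :
    meanVec A f t = evolution A t 0 (meanAux A f t) := by
  rw [meanVec, meanAux, ← ContinuousLinearMap.integral_comp_comm _ (H.integrableOn_meanIntegrand t)]
  congr 1; ext1 r
  rw [← evolution_mul H.pos H.contA H.perA t 0 r]; rfl

/-- The mean solves `g' = A g + f`. -/
lemma Setting.hasDerivAt_meanVec (H : Setting A B f T) (t : ℝ) :
    HasDerivAt (meanVec A f) (A t (meanVec A f t) + f t) t := by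
  have h1 : meanVec A f = fun t => evolution A t 0 (meanAux A f t) := funext H.meanVec_eq
  have h2 := hasDerivAt_integral_Iic H.continuous_meanIntegrand H.integrableOn_meanIntegrand t
  have h3 := (hasDerivAt_evolution H.contA t 0).clm_apply h2
  rw [h1]
  refine h3.congr_deriv ?_
  have : evolution A t 0 (evolution A 0 t (f t)) = (evolution A t 0 * evolution A 0 t) (f t) := rfl
  rw [this, evolution_mul H.pos H.contA H.perA, evolution_self]
  rfl

lemma Setting.continuous_covDensity (H : Setting A B f T) : Continuous (covDensity A B) := by
  have h := continuous_evolution_right H.pos H.contA H.perA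
  have hB := H.contB
  unfold covDensity
  fun_prop

lemma Setting.integrableOn_covDensity (H : Setting A B f T) (t : ℝ) :
    IntegrableOn (covDensity A B) (Set.Iic t) := by
  obtain ⟨M, b, hM, hb, h⟩ := exists_evolution_le H.growth
  obtain ⟨C, hC, hB⟩ := exists_norm_le_of_periodic H.pos H.contB H.perB
  refine integrableOn_Iic_of_exp_bound H.continuous_covDensity (C := M * C * C * M)
    (b := 2 * b) (by positivity) (fun r hr => ?_) t
  have h1 : ‖evolution A 0 r * B r * (ContinuousLinearMap.adjoint (B r)) *
      (ContinuousLinearMap.adjoint (evolution A 0 r))‖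
      ≤ ‖evolution A 0 r‖ * ‖B r‖ * ‖B r‖ * ‖evolution A 0 r‖ := by
    refine (norm_mul_le _ _).trans ?_
    rw [LinearIsometryEquiv.norm_map]
    gcongr
    refine (norm_mul_le _ _).trans ?_
    rw [LinearIsometryEquiv.norm_map]
    gcongr
    exact norm_mul_le _ _
  refine h1.trans ?_
  have h2 : Real.exp (2 * b * r) = Real.exp (b * r) * Real.exp (b * r) := by
    rw [← Real.exp_add]; ring_nf
  calc _ ≤ (M * Real.exp (b * r)) * C * C * (M * Real.exp (b * r)) := by
        gcongr; exacts [h r hr, hB r, hB r, h r hr]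
    _ = _ := by rw [h2]; ring

/-- The covariance as `Q(t) = U(t, 0) P(t) U(t, 0)*` with `P = covAux A B`, in which the
variable `t` has left the integrand. -/
lemma Setting.covOp_eq (H : Setting A B f T) (t : ℝ) : covOp A B t =
    evolution A t 0 * covAux A B t * (ContinuousLinearMap.adjoint (evolution A t 0)) := by
  rw [covAux]
  refine Eq.trans ?_ (integral_conj_adjoint (evolution A t 0) (H.integrableOn_covDensity t))
  rw [covOp]
  congr 1; ext1 r
  rw [evolution_mul H.pos H.contA H.perA t 0 r]

/-- The covariance solves the Lyapunov equation `Q' = A Q + Q A* + B B*`. -/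
lemma Setting.hasDerivAt_covOp (H : Setting A B f T) (t : ℝ) :
    HasDerivAt (covOp A B) (A t * covOp A B t + covOp A B t * ContinuousLinearMap.adjoint (A t)
      + B t * ContinuousLinearMap.adjoint (B t)) t := by
  have h2 := hasDerivAt_integral_Iic H.continuous_covDensity H.integrableOn_covDensity t
  have e1 : evolution A t 0 * evolution A 0 t = 1 := by
    rw [evolution_mul H.pos H.contA H.perA, evolution_self]
  have h := hasDerivAt_conj_adjoint (hasDerivAt_evolution H.contA t 0) h2 e1
  rw [funext H.covOp_eq]
  exact h

lemma Setting.continuous_meanVec (H : Setting A B f T) : Continuous (meanVec A f) :=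
  continuous_iff_continuousAt.2 fun t => (H.hasDerivAt_meanVec t).continuousAt

lemma Setting.continuous_covOp (H : Setting A B f T) : Continuous (covOp A B) :=
  continuous_iff_continuousAt.2 fun t => (H.hasDerivAt_covOp t).continuousAt

lemma setIntegral_Iic_add {X : Type*} [NormedAddCommGroup X] [NormedSpace ℝ X] (F : ℝ → X)
    (t T : ℝ) : ∫ r in Set.Iic (t + T), F r = ∫ r in Set.Iic t, F (r + T) := by
  have h := (measurePreserving_add_right (volume : Measure ℝ) T).setIntegral_preimage_emb
    (MeasurableEquiv.addRight T).measurableEmbedding F (Set.Iic (t + T))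
  rw [← h]
  congr 2
  ext x; simp

lemma Setting.periodic_meanVec (H : Setting A B f T) :
    Function.Periodic (meanVec A f) T := fun t => by
  rw [meanVec, setIntegral_Iic_add]
  simp only [evolution_add_period H.pos H.contA H.perA, H.perf _]
  rfl

lemma Setting.periodic_covOp (H : Setting A B f T) :
    Function.Periodic (covOp A B) T := fun t => by
  rw [covOp, setIntegral_Iic_add]
  simp only [evolution_add_period H.pos H.contA H.perA, H.perB _]
  rfl

/-- The lower bound on `B` passes to `B*`. -/
lemma Setting.lower_adjoint (H : Setting A B f T) : ∃ μ₀ : ℝ, 0 < μ₀ ∧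
    ∀ (t : ℝ) (x : E n), μ₀ * ‖x‖ ≤ ‖ContinuousLinearMap.adjoint (B t) x‖ := by
  obtain ⟨μ₀, h0, h⟩ := H.lower
  refine ⟨μ₀, h0, fun t y => ?_⟩
  have hinj : Function.Injective (B t).toLinearMap := by
    rw [← LinearMap.ker_eq_bot, LinearMap.ker_eq_bot']
    intro x hx
    have := h t x
    have hx' : B t x = 0 := hx
    rw [hx', norm_zero] at this
    exact norm_le_zero_iff.1 (by nlinarith [norm_nonneg x])
  -- write `y = B(t) z`; then `|y|² = ⟨B(t)* y, z⟩` and `|z| ≤ |y| / μ₀`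
  obtain ⟨z, hz⟩ := LinearMap.surjective_of_injective hinj y
  have hz' : B t z = y := hz
  have h1 : ‖y‖ * ‖y‖ = ⟪ContinuousLinearMap.adjoint (B t) y, z⟫_ℝ := by
    rw [ContinuousLinearMap.adjoint_inner_left, hz', real_inner_self_eq_norm_mul_norm]
  have h2 := real_inner_le_norm (ContinuousLinearMap.adjoint (B t) y) z
  have h3 := h t z
  rw [hz'] at h3
  rcases (norm_nonneg y).eq_or_lt with hy | hy
  · rw [← hy]; simp
  · refine le_of_mul_le_mul_right ?_ hy
    calc μ₀ * ‖y‖ * ‖y‖ = μ₀ * (‖y‖ * ‖y‖) := by ring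
      _ ≤ μ₀ * (‖ContinuousLinearMap.adjoint (B t) y‖ * ‖z‖) := by rw [h1]; gcongr
      _ = ‖ContinuousLinearMap.adjoint (B t) y‖ * (μ₀ * ‖z‖) := by ring
      _ ≤ _ := by gcongr

lemma Setting.inner_covAux (H : Setting A B f T) (t : ℝ) (x y : E n) :
    ⟪x, covAux A B t y⟫_ℝ = ∫ r in Set.Iic t, ⟪x, covDensity A B r y⟫_ℝ :=
  inner_integral_apply (H.integrableOn_covDensity t) x y

lemma inner_covDensity (r : ℝ) (x y : E n) : ⟪x, covDensity A B r y⟫_ℝ =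
    ⟪ContinuousLinearMap.adjoint (B r) (ContinuousLinearMap.adjoint (evolution A 0 r) x),
      ContinuousLinearMap.adjoint (B r) (ContinuousLinearMap.adjoint (evolution A 0 r) y)⟫_ℝ := by
  rw [ContinuousLinearMap.adjoint_inner_left, ContinuousLinearMap.adjoint_inner_left]
  rfl

lemma Setting.injective_adjoint_evolution (H : Setting A B f T) (t s : ℝ) {x : E n}
    (hx : ContinuousLinearMap.adjoint (evolution A t s) x = 0) : x = 0 := by
  have e : ContinuousLinearMap.adjoint (evolution A s t) *
      ContinuousLinearMap.adjoint (evolution A t s) = 1 :=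
    adjoint_mul_adjoint_eq_one (by rw [evolution_mul H.pos H.contA H.perA, evolution_self])
  have := congrArg (fun L => L x) e
  simp only [mul_apply_eq_comp, hx, map_zero] at this
  exact this.symm

lemma Setting.inner_covAux_pos (H : Setting A B f T) (t : ℝ) {x : E n} (hx : x ≠ 0) :
    0 < ⟪x, covAux A B t x⟫_ℝ := by
  rw [H.inner_covAux]
  have hpos : ∀ r, 0 < ⟪x, covDensity A B r x⟫_ℝ := fun r => by
    rw [inner_covDensity, real_inner_self_eq_norm_mul_norm]
    obtain ⟨μ₀, h0, h⟩ := H.lower_adjoint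
    have h1 : ContinuousLinearMap.adjoint (evolution A 0 r) x ≠ 0 :=
      fun h => hx (H.injective_adjoint_evolution 0 r h)
    have h2 := h r (ContinuousLinearMap.adjoint (evolution A 0 r) x)
    have h3 : 0 < ‖ContinuousLinearMap.adjoint (evolution A 0 r) x‖ := norm_pos_iff.2 h1
    have : 0 < ‖ContinuousLinearMap.adjoint (B r)
      (ContinuousLinearMap.adjoint (evolution A 0 r) x)‖ := lt_of_lt_of_le (by positivity) h2
    positivity
  have hint : IntegrableOn (fun r => ⟪x, covDensity A B r x⟫_ℝ) (Set.Iic t) :=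
    integrable_inner_apply (H.integrableOn_covDensity t) x x
  refine (setIntegral_pos_iff_support_of_nonneg_ae
    (Eventually.of_forall fun r => (hpos r).le) hint).2 ?_
  have : (Function.support fun r => ⟪x, covDensity A B r x⟫_ℝ) = Set.univ :=
    Set.eq_univ_of_forall fun r => (hpos r).ne'
  rw [this, Set.univ_inter]
  simp

lemma Setting.inner_covOp_comm (H : Setting A B f T) (t : ℝ) (x y : E n) :
    ⟪x, covOp A B t y⟫_ℝ = ⟪covOp A B t x, y⟫_ℝ := by
  have h : ∀ x y : E n, ⟪x, covAux A B t y⟫_ℝ = ⟪covAux A B t x, y⟫_ℝ := fun x y => by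
    rw [real_inner_comm y, H.inner_covAux, H.inner_covAux]
    simp only [inner_covDensity]
    congr 1; ext1 r; exact real_inner_comm _ _
  rw [H.covOp_eq]
  simp only [mul_apply_eq_comp]
  rw [← ContinuousLinearMap.adjoint_inner_left, h, ContinuousLinearMap.adjoint_inner_right]

/-- `Q(t, -∞)` is positive definite: the integrand `|B(r)* U(t, r)* x|²` of `⟨x, Q(t, -∞) x⟩` is
positive for every `r`. -/
lemma Setting.inner_covOp_pos (H : Setting A B f T) (t : ℝ) {x : E n} (hx : x ≠ 0) :
    0 < ⟪x, covOp A B t x⟫_ℝ := by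
  rw [H.covOp_eq]
  simp only [mul_apply_eq_comp]
  rw [← ContinuousLinearMap.adjoint_inner_left]
  exact H.inner_covAux_pos t fun h => hx (H.injective_adjoint_evolution t 0 h)

end Evolution

/-! ### Comparison of Gaussian measures with Lebesgue measure -/

section GaussianDensity

variable {F : Type*} [NormedAddCommGroup F] [InnerProductSpace ℝ F] [FiniteDimensional ℝ F]
  [MeasurableSpace F] [BorelSpace F]

/-- The normalizing constant `(2π)^{-n/2}` of the standard Gaussian density. -/
def gaussConst (F : Type*) [NormedAddCommGroup F] [InnerProductSpace ℝ F] : ℝ :=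
  ((Real.pi / (1 / 2 : ℝ)) ^ ((Module.finrank ℝ F : ℝ) / 2))⁻¹

/-- The standard Gaussian density `(2π)^{-n/2} e^{-|y|²/2}`. -/
def gaussDensity (y : F) : ℝ := gaussConst F * Real.exp (-(1 / 2) * ‖y‖ ^ 2)

omit [FiniteDimensional ℝ F] [MeasurableSpace F] [BorelSpace F] in
lemma gaussConst_pos : 0 < gaussConst F := by unfold gaussConst; positivity

omit [FiniteDimensional ℝ F] [MeasurableSpace F] [BorelSpace F] in
lemma gaussDensity_pos (y : F) : 0 < gaussDensity y := mul_pos gaussConst_pos (Real.exp_pos _)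

omit [FiniteDimensional ℝ F] [MeasurableSpace F] [BorelSpace F] in
lemma continuous_gaussDensity : Continuous (gaussDensity : F → ℝ) := by
  unfold gaussDensity; fun_prop

lemma integral_gaussDensity : ∫ y : F, gaussDensity y = 1 := by
  unfold gaussDensity
  rw [integral_const_mul, GaussianFourier.integral_rexp_neg_mul_sq_norm (by norm_num), gaussConst]
  exact inv_mul_cancel₀ (by positivity)

/-- The density of the standard Gaussian measure, identified through characteristic functions. -/
lemma stdGaussian_eq_withDensity : stdGaussian F =
    (volume : Measure F).withDensity fun y => ENNReal.ofReal (gaussDensity y) := by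
  have hint : Integrable (gaussDensity : F → ℝ) :=
    integrable_of_integral_eq_one integral_gaussDensity
  have : IsFiniteMeasure ((volume : Measure F).withDensity fun y => ENNReal.ofReal (gaussDensity y))
    := isFiniteMeasure_withDensity_ofReal hint.2
  refine Measure.ext_of_charFun ?_
  ext1 w
  rw [charFun_stdGaussian, charFun_apply, integral_withDensity_eq_integral_toReal_smul
    (continuous_gaussDensity.measurable.ennreal_ofReal) (by simp)]
  have h := GaussianFourier.integral_cexp_neg_mul_sq_norm_add (V := F) (b := (1 / 2 : ℂ))
    (by norm_num) Complex.I w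
  have e : ∀ y : F, (ENNReal.ofReal (gaussDensity y)).toReal • Complex.exp (⟪y, w⟫_ℝ * Complex.I)
      = (gaussConst F : ℂ) * Complex.exp (-(1 / 2 : ℂ) * ‖y‖ ^ 2 + Complex.I * ⟪w, y⟫_ℝ) := by
    intro y
    rw [ENNReal.toReal_ofReal (gaussDensity_pos y).le, gaussDensity, Complex.real_smul,
      Complex.exp_add, real_inner_comm]
    push_cast
    rw [mul_comm Complex.I]
    ring
  simp_rw [e]
  rw [integral_const_mul, h, gaussConst]
  have e2 : ((Real.pi : ℂ) / (1 / 2 : ℂ)) ^ ((Module.finrank ℝ F : ℂ) / 2)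
      = (((Real.pi / (1 / 2 : ℝ)) ^ ((Module.finrank ℝ F : ℝ) / 2) : ℝ) : ℂ) := by
    rw [Complex.ofReal_cpow (by positivity)]
    push_cast
    rfl
  rw [e2, ← mul_assoc, ← Complex.ofReal_mul, inv_mul_cancel₀ (by positivity), Complex.ofReal_one,
    one_mul, Complex.I_sq]
  congr 1
  ring

lemma stdGaussian_le : stdGaussian F ≤ ENNReal.ofReal (gaussConst F) • (volume : Measure F) := by
  rw [stdGaussian_eq_withDensity, ← withDensity_const]
  refine withDensity_mono (Eventually.of_forall fun y => ENNReal.ofReal_le_ofReal ?_)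
  rw [gaussDensity]
  refine mul_le_of_le_one_right gaussConst_pos.le (Real.exp_le_one_iff.2 ?_)
  nlinarith [sq_nonneg ‖y‖]

/-- On a ball the Gaussian density is bounded below by its value on the boundary sphere. -/
lemma restrict_closedBall_le_stdGaussian (r : ℝ) :
    (volume : Measure F).restrict (Metric.closedBall 0 r) ≤
      ENNReal.ofReal (gaussConst F * Real.exp (-(1 / 2) * r ^ 2))⁻¹ • stdGaussian F := by
  have hp : 0 < gaussConst F * Real.exp (-(1 / 2) * r ^ 2) := mul_pos gaussConst_pos (Real.exp_pos _)
  rw [stdGaussian_eq_withDensity, ← withDensity_smul _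
    (continuous_gaussDensity.measurable.ennreal_ofReal),
    ← withDensity_indicator_one Metric.isClosed_closedBall.measurableSet]
  refine withDensity_mono (Eventually.of_forall fun y => ?_)
  by_cases hy : y ∈ Metric.closedBall (0 : F) r
  · rw [Set.indicator_of_mem hy, Pi.one_apply, Pi.smul_apply, smul_eq_mul,
      ← ENNReal.ofReal_mul (by positivity), ENNReal.one_le_ofReal, inv_mul_eq_div, one_le_div hp,
      gaussDensity]
    rw [mem_closedBall_zero_iff] at hy
    have := gaussConst_pos (F := F)
    gcongr ?_ * ?_
    refine Real.exp_le_exp.2 ?_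
    nlinarith [norm_nonneg y]
  · simp [Set.indicator_of_notMem hy]

/-- The image of Lebesgue measure under the affine map `y ↦ m + L y`. -/
lemma map_affine_volume (m : F) {L : F →L[ℝ] F} (hL : L.det ≠ 0) :
    (volume : Measure F).map (fun y => m + L y) = ENNReal.ofReal |L.det⁻¹| • volume := by
  have h1 : (fun y => m + L y) = (fun x => m + x) ∘ (L : F →ₗ[ℝ] F) := rfl
  rw [h1, ← Measure.map_map (measurable_const_add m)
    (show Measurable (L : F →ₗ[ℝ] F) from L.continuous.measurable),
    Measure.map_linearMap_addHaar_eq_smul_addHaar _ hL, Measure.map_smul, map_add_left_eq_self]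

lemma map_affine_stdGaussian_le (m : F) {L : F →L[ℝ] F} (hL : L.det ≠ 0) :
    (stdGaussian F).map (fun y => m + L y) ≤
      ENNReal.ofReal (gaussConst F * |L.det⁻¹|) • volume := by
  have hm : Measurable fun y => m + L y := by fun_prop
  refine (Measure.map_mono stdGaussian_le hm).trans (le_of_eq ?_)
  rw [Measure.map_smul, map_affine_volume m hL, smul_smul, ENNReal.ofReal_mul gaussConst_pos.le]

/-- Lower bound for a nondegenerate Gaussian measure on a ball: `r` bounds the preimage of the
ball of radius `R` under the affine map. -/
lemma restrict_le_map_affine_stdGaussian (m : F) {L : F →L[ℝ] F} (hL : L.det ≠ 0) {R r : ℝ}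
    (hr : ∀ y, ‖m + L y‖ ≤ R → ‖y‖ ≤ r) :
    (volume : Measure F).restrict (Metric.closedBall 0 R) ≤
      ENNReal.ofReal (|L.det| * (gaussConst F * Real.exp (-(1 / 2) * r ^ 2))⁻¹) •
        (stdGaussian F).map (fun y => m + L y) := by
  have hm : Measurable fun y => m + L y := by fun_prop
  have hv : (volume : Measure F)
      = ENNReal.ofReal |L.det| • (volume : Measure F).map (fun y => m + L y) := by
    rw [map_affine_volume m hL, smul_smul, ← ENNReal.ofReal_mul (abs_nonneg _), ← abs_mul,
      mul_inv_cancel₀ hL]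
    simp
  refine Measure.le_iff.2 fun s hs => ?_
  rw [Measure.restrict_apply hs, hv, Measure.smul_apply, Measure.smul_apply,
    Measure.map_apply hm (hs.inter Metric.isClosed_closedBall.measurableSet),
    Measure.map_apply hm hs, ENNReal.ofReal_mul (abs_nonneg _), smul_eq_mul, smul_eq_mul, mul_assoc]
  gcongr
  have h1 := restrict_closedBall_le_stdGaussian (F := F) r ((fun y => m + L y) ⁻¹' s)
  rw [Measure.smul_apply, smul_eq_mul, Measure.restrict_apply (hm hs)] at h1
  refine (measure_mono fun y hy => ?_).trans h1
  refine ⟨hy.1, ?_⟩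
  rw [mem_closedBall_zero_iff]
  exact hr y (mem_closedBall_zero_iff.1 hy.2)

end GaussianDensity

section Frame

variable {n : ℕ} {A B : ℝ → E n →L[ℝ] E n} {f : ℝ → E n} {T : ℝ}

open scoped MatrixOrder in
/-- The square root `Q(t, -∞)^{1/2}` of the covariance operator. -/
def sqrtCov (A B : ℝ → E n →L[ℝ] E n) (t : ℝ) : E n →L[ℝ] E n :=
  Matrix.toEuclideanCLM (n := Fin n) (𝕜 := ℝ)
    (CFC.sqrt ((Matrix.toEuclideanCLM (n := Fin n) (𝕜 := ℝ)).symm (covOp A B t)))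

/-- `ν_t` is the image of the standard Gaussian measure under `y ↦ g(t) + Q(t)^{1/2} y`. In this
form estimates for `ν_t` that are uniform in `t` reduce to the standard Gaussian measure. -/
lemma nuAt_eq_map (t : ℝ) : nuAt A B f t =
    (stdGaussian (E n)).map fun y => meanVec A f t + sqrtCov A B t y := rfl

instance (t : ℝ) : IsProbabilityMeasure (nuAt A B f t) :=
  inferInstanceAs (IsProbabilityMeasure (multivariateGaussian _ _))

/-- The matrix of the covariance operator. -/
abbrev covMatrix (A B : ℝ → E n →L[ℝ] E n) (t : ℝ) : Matrix (Fin n) (Fin n) ℝ :=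
  (Matrix.toEuclideanCLM (n := Fin n) (𝕜 := ℝ)).symm (covOp A B t)

lemma dotProduct_covMatrix (t : ℝ) (x y : E n) :
    x.ofLp ⬝ᵥ (covMatrix A B t).mulVec y.ofLp = ⟪x, covOp A B t y⟫_ℝ := by
  rw [← Matrix.inner_toEuclideanCLM, StarAlgEquiv.apply_symm_apply]

lemma Setting.posSemidef_covMatrix (H : Setting A B f T) (t : ℝ) :
    (covMatrix A B t).PosSemidef := by
  have hsa : IsSelfAdjoint (covOp A B t) := by
    rw [ContinuousLinearMap.isSelfAdjoint_iff_isSymmetric]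
    intro x y
    exact (H.inner_covOp_comm t x y).symm
  refine Matrix.PosSemidef.of_dotProduct_mulVec_nonneg ?_ fun x => ?_
  · have h : star (covMatrix A B t) = covMatrix A B t := by
      refine (Matrix.toEuclideanCLM (n := Fin n) (𝕜 := ℝ)).injective ?_
      have h1 := (Matrix.toEuclideanCLM (n := Fin n) (𝕜 := ℝ)).map_star' (covMatrix A B t)
      have h2 : Matrix.toEuclideanCLM (n := Fin n) (𝕜 := ℝ) (covMatrix A B t) = covOp A B t :=
        StarAlgEquiv.apply_symm_apply _ _
      exact h1.trans ((congrArg star h2).trans (hsa.star_eq.trans h2.symm))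
    exact h
  · have h := dotProduct_covMatrix (A := A) (B := B) t (WithLp.toLp 2 x) (WithLp.toLp 2 x)
    simp only [star_trivial]
    rw [h]
    rcases eq_or_ne (WithLp.toLp 2 x : E n) 0 with h0 | h0
    · rw [h0]; simp
    · exact (H.inner_covOp_pos t h0).le

open scoped MatrixOrder in
lemma Setting.sqrtCov_mul_self (H : Setting A B f T) (t : ℝ) :
    sqrtCov A B t * sqrtCov A B t = covOp A B t := by
  rw [sqrtCov, ← map_mul, CFC.sqrt_mul_sqrt_self _ (H.posSemidef_covMatrix t).nonneg,
    StarAlgEquiv.apply_symm_apply]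

lemma Setting.det_sqrtCov_ne_zero (H : Setting A B f T) (t : ℝ) : (sqrtCov A B t).det ≠ 0 := by
  intro h
  have h1 : LinearMap.det (sqrtCov A B t : E n →ₗ[ℝ] E n) = 0 := h
  obtain ⟨x, hx, hx0⟩ := LinearMap.bot_lt_ker_of_det_eq_zero h1 |> fun h =>
    (Submodule.ne_bot_iff _).1 h.ne'
  have h2 : sqrtCov A B t x = 0 := hx
  have h3 := H.inner_covOp_pos t hx0
  rw [← H.sqrtCov_mul_self, mul_apply_eq_comp, h2, map_zero, inner_zero_right] at h3
  exact lt_irrefl _ h3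

open scoped MatrixOrder in
lemma Setting.continuous_sqrtCov (H : Setting A B f T) : Continuous (sqrtCov A B) := by
  have h0 : ContinuousOn CFC.sqrt {a : Matrix (Fin n) (Fin n) ℝ | 0 ≤ a} := by
    open scoped Matrix.Norms.L2Operator in
    exact CFC.continuousOn_sqrt
  have h1 : Continuous fun M : Matrix (Fin n) (Fin n) ℝ =>
      Matrix.toEuclideanCLM (n := Fin n) (𝕜 := ℝ) M :=
    LinearMap.continuous_of_finiteDimensional
      (Matrix.toEuclideanCLM (n := Fin n) (𝕜 := ℝ)).toAlgEquiv.toLinearMap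
  have h2 : Continuous fun L : E n →L[ℝ] E n =>
      (Matrix.toEuclideanCLM (n := Fin n) (𝕜 := ℝ)).symm L :=
    LinearMap.continuous_of_finiteDimensional
      (Matrix.toEuclideanCLM (n := Fin n) (𝕜 := ℝ)).symm.toAlgEquiv.toLinearMap
  exact h1.comp (h0.comp_continuous (h2.comp H.continuous_covOp)
    fun t => (H.posSemidef_covMatrix t).nonneg)

/-- Uniform bounds on a period for the affine maps `y ↦ g(t) + Q(t)^{1/2} y`. -/
lemma Setting.exists_frame_bounds (H : Setting A B f T) : ∃ K : ℝ, 0 < K ∧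
    ∀ t ∈ Set.Icc 0 T, ‖meanVec A f t‖ ≤ K ∧ ‖sqrtCov A B t‖ ≤ K ∧
      (∀ y, ‖y‖ ≤ K * ‖sqrtCov A B t y‖) ∧ |(sqrtCov A B t).det| ≤ K ∧
      |(sqrtCov A B t).det⁻¹| ≤ K := by
  have hS := H.continuous_sqrtCov
  have hdet : Continuous fun t => (sqrtCov A B t).det := ContinuousLinearMap.continuous_det.comp hS
  have hunit : ∀ t, IsUnit (sqrtCov A B t) := fun t =>
    ⟨(ContinuousLinearMap.toContinuousLinearEquivOfDetNeZero _ (H.det_sqrtCov_ne_zero t)).toUnit,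
      by ext; rfl⟩
  have hinv : Continuous fun t => Ring.inverse (sqrtCov A B t) := by
    refine continuous_iff_continuousAt.2 fun r => ?_
    obtain ⟨u, hu⟩ := hunit r
    refine ContinuousAt.comp (g := Ring.inverse) ?_ hS.continuousAt
    rw [← hu]
    exact NormedRing.inverse_continuousAt u
  have hc : IsCompact (Set.Icc 0 T) := isCompact_Icc
  obtain ⟨K1, h1⟩ := hc.exists_bound_of_continuousOn H.continuous_meanVec.continuousOn
  obtain ⟨K2, h2⟩ := hc.exists_bound_of_continuousOn hS.continuousOn
  obtain ⟨K3, h3⟩ := hc.exists_bound_of_continuousOn hinv.continuousOn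
  obtain ⟨K4, h4⟩ := hc.exists_bound_of_continuousOn hdet.continuousOn
  obtain ⟨K5, h5⟩ := hc.exists_bound_of_continuousOn
    (hdet.inv₀ fun t => H.det_sqrtCov_ne_zero t).continuousOn
  refine ⟨max 1 (max K1 (max K2 (max K3 (max K4 K5)))), by positivity, fun t ht => ⟨?_, ?_, ?_, ?_,
    ?_⟩⟩
  · exact (h1 t ht).trans (by simp)
  · exact (h2 t ht).trans (by simp)
  · intro y
    have e : y = Ring.inverse (sqrtCov A B t) (sqrtCov A B t y) := by
      rw [← mul_apply_eq_comp, Ring.inverse_mul_cancel _ (hunit t)]; rfl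
    calc ‖y‖ = ‖Ring.inverse (sqrtCov A B t) (sqrtCov A B t y)‖ := by rw [← e]
      _ ≤ ‖Ring.inverse (sqrtCov A B t)‖ * ‖sqrtCov A B t y‖ := ContinuousLinearMap.le_opNorm _ _
      _ ≤ _ := by gcongr; exact (h3 t ht).trans (by simp)
  · exact (h4 t ht).trans (by simp)
  · exact (h5 t ht).trans (by simp)

/-- The measurability that makes the integral of measures defining `ν` meaningful. -/
lemma Setting.measurable_nuAt_map (H : Setting A B f T) :
    Measurable fun t => (nuAt A B f t).map (Prod.mk t) := by
  have hS := H.continuous_sqrtCov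
  have hg := H.continuous_meanVec
  refine Measure.measurable_of_measurable_coe _ fun s hs => ?_
  have hm : Measurable fun z : ℝ × E n => (z.1, meanVec A f z.1 + sqrtCov A B z.1 z.2) :=
    Continuous.measurable (by fun_prop)
  have h := measurable_measure_prodMk_left (ν := stdGaussian (E n)) (hm hs)
  refine (congrArg Measurable (funext fun t => ?_)).mp h
  rw [nuAt_eq_map, Measure.map_map measurable_prodMk_left (Continuous.measurable (by fun_prop)),
    Measure.map_apply (Continuous.measurable (by fun_prop)) hs]
  rfl

lemma Setting.lintegral_nu (H : Setting A B f T) {F : ℝ × E n → ℝ≥0∞} (hF : Measurable F) :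
    ∫⁻ z, F z ∂(nu A B f) = ∫⁻ t, ∫⁻ x, F (t, x) ∂(nuAt A B f t) := by
  rw [nu, Measure.lintegral_bind H.measurable_nuAt_map.aemeasurable hF.aemeasurable]
  congr 1; ext1 t
  rw [lintegral_map hF measurable_prodMk_left]

/-- Integration with respect to `T⁻¹ ν` on `(0, T) × ℝⁿ`. -/
lemma Setting.lintegral_periodMeasure (H : Setting A B f T) {F : ℝ × E n → ℝ≥0∞}
    (hF : Measurable F) : ∫⁻ z, F z ∂(periodMeasure T (nu A B f)) =
      (ENNReal.ofReal T)⁻¹ * ∫⁻ t in Set.Ioo 0 T, ∫⁻ x, F (t, x) ∂(nuAt A B f t) := by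
  have hs : MeasurableSet (Set.Ioo 0 T ×ˢ (Set.univ : Set (E n))) :=
    measurableSet_Ioo.prod MeasurableSet.univ
  rw [periodMeasure, lintegral_smul_measure, smul_eq_mul, ← lintegral_indicator hs,
    H.lintegral_nu (hF.indicator hs), ← lintegral_indicator measurableSet_Ioo]
  congr 2; ext1 t
  by_cases ht : t ∈ Set.Ioo 0 T
  · simp only [Set.indicator_of_mem ht]
    congr 1; ext1 x
    rw [Set.indicator_of_mem (by exact ⟨ht, trivial⟩)]
  · rw [Set.indicator_of_notMem ht]
    have : ∀ x : E n, (Set.Ioo 0 T ×ˢ (Set.univ : Set (E n))).indicator F (t, x) = 0 :=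
      fun x => Set.indicator_of_notMem (fun h => ht h.1) _
    simp [this]

lemma Setting.isProbabilityMeasure_periodMeasure (H : Setting A B f T) :
    IsProbabilityMeasure (periodMeasure T (nu A B f)) := by
  constructor
  have h := H.lintegral_periodMeasure (F := fun _ => 1) measurable_const
  simp only [lintegral_one, measure_univ, Measure.restrict_apply, MeasurableSet.univ,
    Set.univ_inter, Real.volume_Ioo, sub_zero] at h
  rw [h, ENNReal.inv_mul_cancel (by simpa using H.pos) (by simp)]

/-- `ν` is bounded by Lebesgue measure, since the densities of `ν_t` are uniformly bounded. -/
lemma Setting.exists_periodMeasure_le (H : Setting A B f T) : ∃ C : ℝ≥0,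
    periodMeasure T (nu A B f) ≤
      (C : ℝ≥0∞) • (volume : Measure (ℝ × E n)).restrict (Set.Ioo 0 T ×ˢ Set.univ) := by
  obtain ⟨K, hK, hb⟩ := H.exists_frame_bounds
  have hG := gaussConst_pos (F := E n)
  refine ⟨(T.toNNReal)⁻¹ * (gaussConst (E n) * K).toNNReal, Measure.le_iff.2 fun s hs => ?_⟩
  have hs' : MeasurableSet (Set.Ioo 0 T ×ˢ (Set.univ : Set (E n))) :=
    measurableSet_Ioo.prod MeasurableSet.univ
  have h1 := H.lintegral_periodMeasure (F := s.indicator 1) (measurable_one.indicator hs)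
  rw [lintegral_indicator_one hs] at h1
  rw [h1, Measure.smul_apply, Measure.volume_eq_prod, ← Measure.prod_restrict,
    Measure.restrict_univ, Measure.prod_apply hs, smul_eq_mul, ENNReal.coe_mul, mul_assoc,
    ENNReal.coe_inv (by simpa using H.pos)]
  refine mul_le_mul' le_rfl ?_
  rw [← lintegral_const_mul' _ _ ENNReal.coe_ne_top]
  refine setLIntegral_mono' measurableSet_Ioo fun t ht => ?_
  obtain ⟨-, -, -, -, h5⟩ := hb t (Set.Ioo_subset_Icc_self ht)
  have e : ∀ x : E n, s.indicator (1 : ℝ × E n → ℝ≥0∞) (t, x) = (Prod.mk t ⁻¹' s).indicator 1 x :=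
    fun x => rfl
  simp_rw [e]
  rw [lintegral_indicator_one (measurable_prodMk_left hs), nuAt_eq_map]
  refine (map_affine_stdGaussian_le (meanVec A f t) (H.det_sqrtCov_ne_zero t) _).trans ?_
  rw [Measure.smul_apply, smul_eq_mul]
  refine mul_le_mul' ?_ le_rfl
  exact ENNReal.ofReal_le_ofReal (by gcongr)

/-- On bounded sets Lebesgue measure is bounded by `ν`. -/
lemma Setting.exists_volume_le (H : Setting A B f T) (R : ℝ) : ∃ C : ℝ≥0,
    (volume : Measure (ℝ × E n)).restrict (Set.Ioo 0 T ×ˢ Metric.closedBall 0 R) ≤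
      (C : ℝ≥0∞) • periodMeasure T (nu A B f) := by
  obtain ⟨K, hK, hb⟩ := H.exists_frame_bounds
  have hG := gaussConst_pos (F := E n)
  -- the preimage of the ball of radius `R` under `y ↦ g(t) + Q(t)^{1/2} y` lies in the ball of
  -- radius `K (R + K)`
  obtain ⟨D, hD⟩ : ∃ D : ℝ,
    D = K * (gaussConst (E n) * Real.exp (-(1 / 2) * (K * (R + K)) ^ 2))⁻¹ := ⟨_, rfl⟩
  refine ⟨D.toNNReal * T.toNNReal, Measure.le_iff.2 fun s hs => ?_⟩
  have h1 := H.lintegral_periodMeasure (F := s.indicator 1) (measurable_one.indicator hs)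
  rw [lintegral_indicator_one hs] at h1
  rw [Measure.smul_apply, h1, Measure.volume_eq_prod, ← Measure.prod_restrict,
    Measure.prod_apply hs, smul_eq_mul, ENNReal.coe_mul, mul_assoc]
  have e0 : (T.toNNReal : ℝ≥0∞) * ((ENNReal.ofReal T)⁻¹ *
      ∫⁻ t in Set.Ioo 0 T, ∫⁻ x, s.indicator 1 (t, x) ∂(nuAt A B f t)) =
      ∫⁻ t in Set.Ioo 0 T, ∫⁻ x, s.indicator 1 (t, x) ∂(nuAt A B f t) := by
    rw [← mul_assoc, ENNReal.ofReal, ENNReal.mul_inv_cancel (by simpa using H.pos) (by simp),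
      one_mul]
  rw [e0, ← lintegral_const_mul' _ _ ENNReal.coe_ne_top]
  refine setLIntegral_mono' measurableSet_Ioo fun t ht => ?_
  obtain ⟨h1, -, h3, h4, -⟩ := hb t (Set.Ioo_subset_Icc_self ht)
  have e : ∀ x : E n, s.indicator (1 : ℝ × E n → ℝ≥0∞) (t, x) = (Prod.mk t ⁻¹' s).indicator 1 x :=
    fun x => rfl
  simp_rw [e]
  rw [lintegral_indicator_one (measurable_prodMk_left hs), nuAt_eq_map]
  refine (restrict_le_map_affine_stdGaussian (meanVec A f t) (H.det_sqrtCov_ne_zero t)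
    (R := R) (r := K * (R + K)) (fun y hy => (h3 y).trans ?_) _).trans ?_
  · gcongr
    calc ‖sqrtCov A B t y‖ = ‖(meanVec A f t + sqrtCov A B t y) - meanVec A f t‖ := by
          rw [add_sub_cancel_left]
      _ ≤ R + K := (norm_sub_le _ _).trans (add_le_add hy h1)
  · rw [Measure.smul_apply, smul_eq_mul]
    refine mul_le_mul' ?_ le_rfl
    rw [hD]
    exact ENNReal.ofReal_le_ofReal (by gcongr)

end Frame

/-! ### Cutoff functions and Gaussian tails -/

lemma eLpNorm_two_sq {α X : Type*} [MeasurableSpace α] [NormedAddCommGroup X] (μ : Measure α)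
    (g : α → X) : eLpNorm g 2 μ ^ 2 = ∫⁻ a, ‖g a‖ₑ ^ 2 ∂μ := by
  rw [eLpNorm_eq_lintegral_rpow_enorm_toReal (by norm_num) (by norm_num)]
  rw [← ENNReal.rpow_natCast, ← ENNReal.rpow_mul]
  simp

lemma enorm_sq_eq_ofReal {X : Type*} [NormedAddCommGroup X] (x : X) :
    ‖x‖ₑ ^ 2 = ENNReal.ofReal (‖x‖ ^ 2) := by
  rw [ENNReal.ofReal_pow (norm_nonneg _), ofReal_norm]

section Tail

variable {F : Type*} [NormedAddCommGroup F] [InnerProductSpace ℝ F] [FiniteDimensional ℝ F]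

/-- Smooth cutoff functions `χ k`, equal to `1` on the ball of radius `k + 1`, with compact support
and uniformly bounded derivatives. -/
lemma exists_cutoff (F : Type*) [NormedAddCommGroup F] [InnerProductSpace ℝ F]
    [FiniteDimensional ℝ F] : ∃ (χ : ℕ → F → ℝ) (C : ℝ≥0), ∀ k,
    ContDiff ℝ ∞ (χ k) ∧ HasCompactSupport (χ k) ∧ (∀ y, |χ k y| ≤ 1) ∧
    (∀ y, ‖y‖ ≤ k + 1 → χ k y = 1) ∧ ∀ y, ‖fderiv ℝ (χ k) y‖ ≤ C := by
  let b : ContDiffBump (0 : F) := ⟨1, 2, one_pos, one_lt_two⟩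
  obtain ⟨C, hC⟩ := (b.hasCompactSupport.fderiv ℝ).exists_bound_of_continuous
    ((b.contDiff (n := 1)).continuous_fderiv one_ne_zero)
  have hC0 : 0 ≤ C := (norm_nonneg _).trans (hC 0)
  refine ⟨fun k y => b (((k : ℝ) + 1)⁻¹ • y), ⟨C, hC0⟩, fun k => ?_⟩
  have hk : (0 : ℝ) < (k : ℝ) + 1 := by positivity
  have hk' : ((k : ℝ) + 1)⁻¹ ≠ 0 := by positivity
  refine ⟨b.contDiff.comp (contDiff_const_smul _), ?_, fun y => ?_, fun y hy => ?_, fun y => ?_⟩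
  · exact b.hasCompactSupport.comp_homeomorph (Homeomorph.smulOfNeZero _ hk')
  · rw [abs_of_nonneg b.nonneg]; exact b.le_one
  · refine b.one_of_mem_closedBall ?_
    rw [mem_closedBall_zero_iff, norm_smul, norm_inv, Real.norm_of_nonneg hk.le]
    change _ ≤ (1 : ℝ)
    rw [inv_mul_eq_div, div_le_one hk]
    exact hy
  · have h := fderiv_comp_smul (f := (b : F → ℝ)) (x := y) ((k : ℝ) + 1)⁻¹
    rw [h, norm_smul, norm_inv, Real.norm_of_nonneg hk.le]
    calc _ ≤ 1 * C := by
          gcongr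
          · exact inv_le_one_of_one_le₀ (by linarith [Nat.cast_nonneg (α := ℝ) k])
          · exact hC _
      _ = C := one_mul C

omit [FiniteDimensional ℝ F] in
lemma hasFDerivAt_gaussDensity (y : F) :
    HasFDerivAt (gaussDensity : F → ℝ) (-(gaussDensity y) • innerSL ℝ y) y := by
  have h1 := (hasStrictFDerivAt_norm_sq y).hasFDerivAt
  have h2 := ((h1.const_mul (-(1 / 2) : ℝ)).exp).const_mul (gaussConst F)
  refine h2.congr_fderiv ?_
  ext z
  simp [gaussDensity]
  ring

variable [MeasurableSpace F] [BorelSpace F]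

/-- One direction of the weighted estimate for the standard Gaussian measure: integrate
`⟨y, e⟩² w² γ = -⟨y, e⟩ w² ∂ₑγ` by parts and absorb the mixed term. -/
lemma integral_inner_sq_mul_le {w : F → ℝ} (hw : ContDiff ℝ 1 w) (hs : HasCompactSupport w) (e : F) :
    ∫ y, ⟪y, e⟫_ℝ ^ 2 * w y ^ 2 * gaussDensity y ≤
      2 * ‖e‖ ^ 2 * (∫ y, w y ^ 2 * gaussDensity y) +
        4 * ∫ y, (fderiv ℝ w y e) ^ 2 * gaussDensity y := by
  have hp := continuous_gaussDensity (F := F)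
  have hwc := hw.continuous
  have hw' : Continuous fun y => fderiv ℝ w y e :=
    (hw.continuous_fderiv one_ne_zero).clm_apply continuous_const
  have hs' : HasCompactSupport fun y => fderiv ℝ w y e :=
    (hs.fderiv ℝ).comp_left (g := fun L : F →L[ℝ] ℝ => L e) rfl
  have hcs : ∀ {g : F → ℝ}, Continuous g → (∀ y, w y = 0 → fderiv ℝ w y e = 0 → g y = 0) →
      Integrable g := fun {g} hg h0 => by
    refine hg.integrable_of_hasCompactSupport ?_
    refine HasCompactSupport.of_support_subset_isCompact (K := tsupport w) hs ?_
    intro y hy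
    by_contra hyw
    refine hy (h0 y (image_eq_zero_of_notMem_tsupport hyw) ?_)
    have : fderiv ℝ w y = 0 := by
      by_contra h
      exact hyw (support_fderiv_subset ℝ h)
    rw [this]; rfl
  have i1 : Integrable fun y => ⟪y, e⟫_ℝ ^ 2 * w y ^ 2 * gaussDensity y :=
    hcs (by fun_prop) fun y h1 _ => by simp [h1]
  have i2 : Integrable fun y => w y ^ 2 * gaussDensity y :=
    hcs (by fun_prop) fun y h1 _ => by simp [h1]
  have i3 : Integrable fun y => (fderiv ℝ w y e) ^ 2 * gaussDensity y :=
    hcs (by fun_prop) fun y _ h1 => by simp [h1]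
  have i4 : Integrable fun y => 2 * ⟪y, e⟫_ℝ * w y * fderiv ℝ w y e * gaussDensity y :=
    hcs (by fun_prop) fun y _ h1 => by simp [h1]
  have hd : ∀ y, HasFDerivAt (fun y => ⟪y, e⟫_ℝ * w y ^ 2)
      (⟪y, e⟫_ℝ • ((2 * w y) • fderiv ℝ w y) + w y ^ 2 • innerSL ℝ e) y := fun y => by
    have h1 : HasFDerivAt (fun y : F => ⟪y, e⟫_ℝ) (innerSL ℝ e) y := by
      exact (innerSL ℝ e).hasFDerivAt.congr_of_eventuallyEq
        (Eventually.of_forall fun z => real_inner_comm _ _)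
    have h2 := ((hw.differentiable one_ne_zero y).hasFDerivAt).pow 2
    refine (h1.mul h2).congr_fderiv ?_
    ext z
    simp
  have key := integral_mul_fderiv_eq_neg_fderiv_mul_of_integrable (μ := (volume : Measure F))
    (f := fun y => ⟪y, e⟫_ℝ * w y ^ 2) (g := gaussDensity) (v := e) ?_ ?_ ?_
    (fun y _ => (hd y).differentiableAt) (fun y _ => (hasFDerivAt_gaussDensity y).differentiableAt)
  · simp only [fun y => (hd y).fderiv, fun y : F => (hasFDerivAt_gaussDensity y).fderiv] at key
    have e1 : ∫ y, ⟪y, e⟫_ℝ ^ 2 * w y ^ 2 * gaussDensity y =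
        ∫ y, (‖e‖ ^ 2 * (w y ^ 2 * gaussDensity y) +
          2 * ⟪y, e⟫_ℝ * w y * fderiv ℝ w y e * gaussDensity y) := by
      rw [← neg_inj]
      convert key using 1
      · rw [← integral_neg]
        congr 1; ext1 y
        simp
        ring
      · congr 2; ext1 y
        simp
        ring
    have e2 : ∫ y, (‖e‖ ^ 2 * (w y ^ 2 * gaussDensity y) +
          2 * ⟪y, e⟫_ℝ * w y * fderiv ℝ w y e * gaussDensity y) ≤
        ∫ y, (‖e‖ ^ 2 * (w y ^ 2 * gaussDensity y) +
          ((1 / 2) * (⟪y, e⟫_ℝ ^ 2 * w y ^ 2 * gaussDensity y) +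
            2 * ((fderiv ℝ w y e) ^ 2 * gaussDensity y))) := by
      refine integral_mono ((i2.const_mul _).add i4)
        ((i2.const_mul _).add ((i1.const_mul _).add (i3.const_mul _))) fun y => ?_
      have h0 := (gaussDensity_pos y).le
      -- half of `⟨y, e⟩² w²` is absorbed in the left-hand side
      have h1 : 2 * ⟪y, e⟫_ℝ * w y * fderiv ℝ w y e ≤
          (1 / 2) * (⟪y, e⟫_ℝ ^ 2 * w y ^ 2) + 2 * (fderiv ℝ w y e) ^ 2 := by
        nlinarith [sq_nonneg (⟪y, e⟫_ℝ * w y - 2 * fderiv ℝ w y e)]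
      have h2 := mul_le_mul_of_nonneg_right h1 h0
      simp only
      linarith
    have i5 : Integrable fun y => (1 / 2) * (⟪y, e⟫_ℝ ^ 2 * w y ^ 2 * gaussDensity y) +
        2 * ((fderiv ℝ w y e) ^ 2 * gaussDensity y) := (i1.const_mul _).add (i3.const_mul _)
    rw [integral_add (i2.const_mul _) i5, integral_add (i1.const_mul _) (i3.const_mul _),
      integral_const_mul, integral_const_mul, integral_const_mul] at e2
    linarith
  · simp only [fun y => (hd y).fderiv]
    refine hcs ?_ fun y h1 _ => by simp [h1]
    simp only [add_apply, smul_apply, innerSL_apply_apply]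
    fun_prop
  · simp only [fun y : F => (hasFDerivAt_gaussDensity y).fderiv]
    refine hcs ?_ fun y h1 _ => by simp [h1]
    simp only [smul_apply, innerSL_apply_apply]
    fun_prop
  · exact hcs (by fun_prop) fun y h1 _ => by simp [h1]

lemma lintegral_stdGaussian_of_hasCompactSupport {g : F → ℝ} (hg : Continuous g)
    (hs : HasCompactSupport g) (h0 : ∀ y, 0 ≤ g y) :
    ∫⁻ y, ENNReal.ofReal (g y) ∂(stdGaussian F) = ENNReal.ofReal (∫ y, g y * gaussDensity y) := by
  have hp := continuous_gaussDensity (F := F)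
  rw [stdGaussian_eq_withDensity, lintegral_withDensity_eq_lintegral_mul _
    (hp.measurable.ennreal_ofReal) hg.measurable.ennreal_ofReal,
    ofReal_integral_eq_lintegral_ofReal]
  · congr 1; ext1 y
    rw [Pi.mul_apply, ← ENNReal.ofReal_mul (gaussDensity_pos y).le, mul_comm]
  · exact (hg.mul hp).integrable_of_hasCompactSupport hs.mul_right
  · exact Eventually.of_forall fun y => mul_nonneg (h0 y) (gaussDensity_pos y).le

/-- The weighted estimate for compactly supported functions: sum `integral_inner_sq_mul_le` over
an orthonormal basis. -/
lemma lintegral_norm_mul_le_of_hasCompactSupport {w : F → ℝ} (hw : ContDiff ℝ 1 w)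
    (hs : HasCompactSupport w) :
    ∫⁻ y, (‖y‖ₑ * ‖w y‖ₑ) ^ 2 ∂(stdGaussian F) ≤ 4 * (Module.finrank ℝ F : ℝ≥0∞) *
      (∫⁻ y, ‖w y‖ₑ ^ 2 ∂(stdGaussian F) + ∫⁻ y, ‖fderiv ℝ w y‖ₑ ^ 2 ∂(stdGaussian F)) := by
  have hwc := hw.continuous
  let b := stdOrthonormalBasis ℝ F
  have hdir : ∀ i, ∫⁻ y, ENNReal.ofReal (⟪y, b i⟫_ℝ ^ 2 * w y ^ 2) ∂(stdGaussian F) ≤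
      4 * (∫⁻ y, ‖w y‖ₑ ^ 2 ∂(stdGaussian F) + ∫⁻ y, ‖fderiv ℝ w y‖ₑ ^ 2 ∂(stdGaussian F)) := by
    intro i
    have hw' : Continuous fun y => fderiv ℝ w y (b i) :=
      (hw.continuous_fderiv one_ne_zero).clm_apply continuous_const
    have hs2 : HasCompactSupport fun y => w y ^ 2 :=
      hs.comp_left (g := fun s : ℝ => s ^ 2) (by simp)
    have hs3 : HasCompactSupport fun y => (fderiv ℝ w y (b i)) ^ 2 :=
      (hs.fderiv ℝ).comp_left (g := fun L : F →L[ℝ] ℝ => (L (b i)) ^ 2) (by simp)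
    have hs4 : HasCompactSupport fun y => ⟪y, b i⟫_ℝ ^ 2 * w y ^ 2 :=
      HasCompactSupport.mul_left (f := fun y => ⟪y, b i⟫_ℝ ^ 2) hs2
    have hc4 : Continuous fun y => ⟪y, b i⟫_ℝ ^ 2 * w y ^ 2 := by fun_prop
    rw [lintegral_stdGaussian_of_hasCompactSupport hc4 hs4 (fun y => by positivity)]
    have h1 : ∫⁻ y, ENNReal.ofReal ((fderiv ℝ w y (b i)) ^ 2) ∂(stdGaussian F) ≤
        ∫⁻ y, ‖fderiv ℝ w y‖ₑ ^ 2 ∂(stdGaussian F) := by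
      refine lintegral_mono fun y => ?_
      rw [enorm_sq_eq_ofReal]
      refine ENNReal.ofReal_le_ofReal ?_
      rw [← sq_abs, ← Real.norm_eq_abs]
      gcongr
      refine ((fderiv ℝ w y).le_opNorm _).trans ?_
      rw [b.norm_eq_one, mul_one]
    have h2 : ∫⁻ y, ‖w y‖ₑ ^ 2 ∂(stdGaussian F)
        = ∫⁻ y, ENNReal.ofReal (w y ^ 2) ∂(stdGaussian F) := by
      congr 1; ext1 y
      rw [enorm_sq_eq_ofReal, Real.norm_eq_abs, sq_abs]
    refine le_trans ?_ (mul_le_mul_right (add_le_add_right h1 _) _)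
    rw [h2, lintegral_stdGaussian_of_hasCompactSupport (by fun_prop) hs2 (fun y => by positivity),
      lintegral_stdGaussian_of_hasCompactSupport (by fun_prop) hs3 (fun y => by positivity)]
    have hn1 : 0 ≤ ∫ y, w y ^ 2 * gaussDensity y :=
      integral_nonneg fun y => mul_nonneg (by positivity) (gaussDensity_pos y).le
    have hn2 : 0 ≤ ∫ y, (fderiv ℝ w y (b i)) ^ 2 * gaussDensity y :=
      integral_nonneg fun y => mul_nonneg (by positivity) (gaussDensity_pos y).le
    rw [← ENNReal.ofReal_add hn1 hn2, show (4 : ℝ≥0∞) = ENNReal.ofReal 4 by norm_num,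
      ← ENNReal.ofReal_mul (by norm_num)]
    refine ENNReal.ofReal_le_ofReal ?_
    have h := integral_inner_sq_mul_le hw hs (b i)
    rw [b.norm_eq_one] at h
    linarith
  have hsum : ∀ y, (‖y‖ₑ * ‖w y‖ₑ) ^ 2 = ∑ i, ENNReal.ofReal (⟪y, b i⟫_ℝ ^ 2 * w y ^ 2) := by
    intro y
    rw [← ENNReal.ofReal_sum_of_nonneg (fun i _ => by positivity), ← Finset.sum_mul,
      b.sum_sq_inner_left, mul_pow, enorm_sq_eq_ofReal, enorm_sq_eq_ofReal,
      ← ENNReal.ofReal_mul (by positivity), Real.norm_eq_abs, sq_abs]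
  simp_rw [hsum]
  rw [lintegral_finsetSum _ fun i _ => Measurable.ennreal_ofReal
    (Continuous.measurable (by fun_prop))]
  refine (Finset.sum_le_sum fun i _ => hdir i).trans (le_of_eq ?_)
  rw [Finset.sum_const, Finset.card_univ, Fintype.card_fin, nsmul_eq_mul]
  ring

/-- The weighted estimate `∫ |y|² v² dγ ≤ C ∫ (v² + |Dv|²) dγ` for the standard Gaussian measure,
which controls the tails of functions with square integrable gradient. -/
lemma exists_lintegral_norm_mul_le (F : Type*) [NormedAddCommGroup F] [InnerProductSpace ℝ F]
    [FiniteDimensional ℝ F] [MeasurableSpace F] [BorelSpace F] :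
    ∃ C : ℝ≥0, ∀ v : F → ℝ, ContDiff ℝ 1 v →
      ∫⁻ y, (‖y‖ₑ * ‖v y‖ₑ) ^ 2 ∂(stdGaussian F) ≤ C * (∫⁻ y, ‖v y‖ₑ ^ 2 ∂(stdGaussian F) +
        ∫⁻ y, ‖fderiv ℝ v y‖ₑ ^ 2 ∂(stdGaussian F)) := by
  obtain ⟨χ, C, hχ⟩ := exists_cutoff F
  refine ⟨4 * (Module.finrank ℝ F : ℝ≥0) * (3 + 2 * C ^ 2), fun v hv => ?_⟩
  have hvc := hv.continuous
  have hv' := hv.continuous_fderiv one_ne_zero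
  -- the bound for `χ k * v` does not depend on `k`; the balls exhaust the space
  have hk : ∀ k : ℕ, ∫⁻ y in Metric.closedBall 0 (k : ℝ), (‖y‖ₑ * ‖v y‖ₑ) ^ 2 ∂(stdGaussian F) ≤
      ((4 * (Module.finrank ℝ F : ℝ≥0) * (3 + 2 * C ^ 2) : ℝ≥0) : ℝ≥0∞) *
      (∫⁻ y, ‖v y‖ₑ ^ 2 ∂(stdGaussian F) + ∫⁻ y, ‖fderiv ℝ v y‖ₑ ^ 2 ∂(stdGaussian F)) := by
    intro k
    obtain ⟨h1, h2, h3, h4, h5⟩ := hχ k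
    have hw : ContDiff ℝ 1 fun y => χ k y * v y := (h1.of_le (by simp)).mul hv
    have hb1 : ∀ y, ‖χ k y * v y‖ₑ ^ 2 ≤ ‖v y‖ₑ ^ 2 := fun y => by
      gcongr
      rw [enorm_mul]
      refine mul_le_of_le_one_left zero_le ?_
      rw [← ofReal_norm, Real.norm_eq_abs]
      exact ENNReal.ofReal_le_one.2 (h3 y)
    have hb2 : ∀ y, ‖fderiv ℝ (fun y => χ k y * v y) y‖ₑ ^ 2 ≤
        2 * ‖fderiv ℝ v y‖ₑ ^ 2 + 2 * (C : ℝ≥0∞) ^ 2 * ‖v y‖ₑ ^ 2 := fun y => by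
      have hd := (((h1.differentiable (by simp)) y).hasFDerivAt.mul
        ((hv.differentiable one_ne_zero) y).hasFDerivAt).fderiv
      change fderiv ℝ (fun y => χ k y * v y) y = _ at hd
      rw [hd]
      have e : (2 : ℝ≥0∞) = ENNReal.ofReal 2 := by norm_num
      rw [enorm_sq_eq_ofReal, enorm_sq_eq_ofReal, enorm_sq_eq_ofReal, e, ← ENNReal.ofReal_coe_nnreal,
        ← ENNReal.ofReal_pow (show (0 : ℝ) ≤ C from C.2), ← ENNReal.ofReal_mul zero_le_two,
        ← ENNReal.ofReal_mul zero_le_two, ← ENNReal.ofReal_mul (by positivity),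
        ← ENNReal.ofReal_add (by positivity) (by positivity)]
      refine ENNReal.ofReal_le_ofReal ?_
      have hn : ‖χ k y • fderiv ℝ v y + v y • fderiv ℝ (χ k) y‖ ≤ ‖fderiv ℝ v y‖ + ‖v y‖ * C := by
        refine (norm_add_le _ _).trans ?_
        rw [norm_smul, norm_smul, Real.norm_eq_abs (χ k y)]
        gcongr
        · exact mul_le_of_le_one_left (norm_nonneg _) (h3 y)
        · exact h5 y
      calc _ ≤ (‖fderiv ℝ v y‖ + ‖v y‖ * C) ^ 2 := by gcongr
        _ ≤ _ := by nlinarith [sq_nonneg (‖fderiv ℝ v y‖ - ‖v y‖ * C)]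
    calc ∫⁻ y in Metric.closedBall 0 (k : ℝ), (‖y‖ₑ * ‖v y‖ₑ) ^ 2 ∂(stdGaussian F)
        = ∫⁻ y in Metric.closedBall 0 (k : ℝ), (‖y‖ₑ * ‖χ k y * v y‖ₑ) ^ 2 ∂(stdGaussian F) := by
          refine setLIntegral_congr_fun Metric.isClosed_closedBall.measurableSet fun y hy => ?_
          rw [mem_closedBall_zero_iff] at hy
          simp only [h4 y (by linarith), one_mul]
      _ ≤ ∫⁻ y, (‖y‖ₑ * ‖χ k y * v y‖ₑ) ^ 2 ∂(stdGaussian F) := setLIntegral_le_lintegral _ _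
      _ ≤ _ := lintegral_norm_mul_le_of_hasCompactSupport hw (h2.mul_right)
      _ ≤ 4 * (Module.finrank ℝ F : ℝ≥0∞) * (∫⁻ y, ‖v y‖ₑ ^ 2 ∂(stdGaussian F) +
          ∫⁻ y, (2 * ‖fderiv ℝ v y‖ₑ ^ 2 + 2 * (C : ℝ≥0∞) ^ 2 * ‖v y‖ₑ ^ 2) ∂(stdGaussian F)) := by
          exact mul_le_mul_right (add_le_add (lintegral_mono hb1) (lintegral_mono hb2)) _
      _ ≤ _ := by
          rw [lintegral_add_left (by fun_prop), lintegral_const_mul _ (by fun_prop),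
            lintegral_const_mul _ (by fun_prop)]
          generalize ∫⁻ y, ‖v y‖ₑ ^ 2 ∂(stdGaussian F) = a
          generalize ∫⁻ y, ‖fderiv ℝ v y‖ₑ ^ 2 ∂(stdGaussian F) = d
          push_cast
          rw [mul_assoc (4 * (Module.finrank ℝ F : ℝ≥0∞))]
          gcongr
          calc a + (2 * d + 2 * (C : ℝ≥0∞) ^ 2 * a) ≤
              (a + (2 * d + 2 * (C : ℝ≥0∞) ^ 2 * a)) + (2 * a + d + 2 * (C : ℝ≥0∞) ^ 2 * d) :=
                le_self_add
            _ = _ := by ring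
  have hU : (⋃ k : ℕ, Metric.closedBall (0 : F) (k : ℝ)) = Set.univ := by
    refine Set.eq_univ_of_forall fun y => Set.mem_iUnion.2 ?_
    obtain ⟨k, hk⟩ := exists_nat_ge ‖y‖
    exact ⟨k, mem_closedBall_zero_iff.2 hk⟩
  rw [← setLIntegral_univ, ← hU, setLIntegral_iUnion_of_directed _
    (directed_of_isDirected_le fun i j hij => Metric.closedBall_subset_closedBall
      (by exact_mod_cast hij))]
  exact iSup_le hk

end Tail

/-! ### Mollification in `L²` -/

/-- Jensen's inequality for the square, on a probability space. -/
lemma lintegral_enorm_sq_le {α X : Type*} [MeasurableSpace α] [NormedAddCommGroup X]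
    {π : Measure α} [IsProbabilityMeasure π] {f : α → X} (hf : AEStronglyMeasurable f π) :
    (∫⁻ a, ‖f a‖ₑ ∂π) ^ 2 ≤ ∫⁻ a, ‖f a‖ₑ ^ 2 ∂π := by
  rw [← eLpNorm_two_sq, ← eLpNorm_one_eq_lintegral_enorm]
  gcongr
  exact eLpNorm_le_eLpNorm_of_exponent_le one_le_two hf

section Mollify

variable {G : Type*} [NormedAddCommGroup G] [NormedSpace ℝ G] [FiniteDimensional ℝ G]
  [MeasurableSpace G] [BorelSpace G]

/-- `ρ` is a smooth probability density supported in the ball of radius `δ`. -/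
structure IsMollifier (μ : Measure G) (ρ : G → ℝ) (δ : ℝ) : Prop where
  smooth : ContDiff ℝ ∞ ρ
  nonneg : ∀ y, 0 ≤ ρ y
  integral_eq_one : ∫ y, ρ y ∂μ = 1
  eq_zero : ∀ y, δ < ‖y‖ → ρ y = 0

variable {μ : Measure G} [μ.IsAddHaarMeasure] {ρ : G → ℝ} {δ : ℝ} {v : G → ℝ}

lemma exists_isMollifier (μ : Measure G) [μ.IsAddHaarMeasure] (hδ : 0 < δ) :
    ∃ ρ : G → ℝ, IsMollifier μ ρ δ := by
  let b : ContDiffBump (0 : G) := ⟨δ / 2, δ, by positivity, by linarith⟩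
  refine ⟨b.normed μ, b.contDiff_normed, b.nonneg_normed, b.integral_normed, fun y hy => ?_⟩
  have h : y ∉ Function.support (b.normed μ) := by
    rw [b.support_normed_eq, mem_ball_zero_iff]
    exact not_lt.2 hy.le
  exact Function.notMem_support.1 h

omit [BorelSpace G] [μ.IsAddHaarMeasure] in
lemma IsMollifier.hasCompactSupport (h : IsMollifier μ ρ δ) : HasCompactSupport ρ :=
  HasCompactSupport.of_support_subset_isCompact (isCompact_closedBall (0 : G) δ) fun y hy => by
    rw [mem_closedBall_zero_iff]
    by_contra h'
    exact hy (h.eq_zero y (not_le.1 h'))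

/-- The mollification `(ρ * v)(x) = ∫ ρ(y) v(x - y) dy`. -/
def mollify (μ : Measure G) (ρ v : G → ℝ) (x : G) : ℝ := ∫ y, ρ y * v (x - y) ∂μ

lemma IsMollifier.integrable_mul (h : IsMollifier μ ρ δ) (hv : LocallyIntegrable v μ) (x : G) :
    Integrable (fun y => ρ y * v (x - y)) μ :=
  h.hasCompactSupport.convolutionExists_left (ContinuousLinearMap.mul ℝ ℝ) h.smooth.continuous hv x

lemma IsMollifier.isProbabilityMeasure (h : IsMollifier μ ρ δ) :
    IsProbabilityMeasure (μ.withDensity fun y => ENNReal.ofReal (ρ y)) := by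
  constructor
  rw [withDensity_apply _ MeasurableSet.univ, setLIntegral_univ,
    ← ofReal_integral_eq_lintegral_ofReal (h.smooth.continuous.integrable_of_hasCompactSupport
      h.hasCompactSupport) (Eventually.of_forall h.nonneg), h.integral_eq_one, ENNReal.ofReal_one]

/-- The error `v - ρ * v` at `x` is the average of `v(x) - v(x - y)` over the probability measure
`ρ(y) dy`. -/
lemma IsMollifier.enorm_sub_mollify_sq_le (h : IsMollifier μ ρ δ) (hv : LocallyIntegrable v μ)
    (hm : Measurable v) (x : G) : ‖v x - mollify μ ρ v x‖ₑ ^ 2 ≤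
      ∫⁻ y, ‖v x - v (x - y)‖ₑ ^ 2 ∂(μ.withDensity fun y => ENNReal.ofReal (ρ y)) := by
  have := h.isProbabilityMeasure
  have hρ : Measurable fun y => ENNReal.ofReal (ρ y) :=
    h.smooth.continuous.measurable.ennreal_ofReal
  have hρi : Integrable ρ μ := h.smooth.continuous.integrable_of_hasCompactSupport
    h.hasCompactSupport
  have e1 : v x - mollify μ ρ v x = ∫ y, ρ y * (v x - v (x - y)) ∂μ := by
    simp_rw [mul_sub]
    rw [integral_sub (hρi.mul_const _) (h.integrable_mul hv x), integral_mul_const,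
      h.integral_eq_one, one_mul, mollify]
  have hmx : Measurable fun y => v x - v (x - y) := by fun_prop
  refine le_trans ?_ (lintegral_enorm_sq_le hmx.aestronglyMeasurable)
  rw [e1]
  gcongr
  refine (enorm_integral_le_lintegral_enorm _).trans (le_of_eq ?_)
  rw [lintegral_withDensity_eq_lintegral_mul _ hρ hmx.enorm]
  congr 1; ext1 y
  rw [Pi.mul_apply, enorm_mul, Real.enorm_of_nonneg (h.nonneg y)]

/-- The `L²` mollification error is bounded by the `L²` modulus of continuity. -/
lemma IsMollifier.lintegral_sub_mollify_le (h : IsMollifier μ ρ δ) (hv : LocallyIntegrable v μ)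
    (hm : Measurable v) {K : Set G} {b : ℝ≥0∞}
    (hb : ∀ y, ‖y‖ ≤ δ → ∫⁻ x in K, ‖v x - v (x - y)‖ₑ ^ 2 ∂μ ≤ b) :
    ∫⁻ x in K, ‖v x - mollify μ ρ v x‖ₑ ^ 2 ∂μ ≤ b := by
  have := h.isProbabilityMeasure
  have hρ : Measurable fun y => ENNReal.ofReal (ρ y) :=
    h.smooth.continuous.measurable.ennreal_ofReal
  calc ∫⁻ x in K, ‖v x - mollify μ ρ v x‖ₑ ^ 2 ∂μ ≤ ∫⁻ x in K, ∫⁻ y, ‖v x - v (x - y)‖ₑ ^ 2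
        ∂(μ.withDensity fun y => ENNReal.ofReal (ρ y)) ∂μ :=
        lintegral_mono fun x => h.enorm_sub_mollify_sq_le hv hm x
    _ = ∫⁻ y, ∫⁻ x in K, ‖v x - v (x - y)‖ₑ ^ 2 ∂μ
        ∂(μ.withDensity fun y => ENNReal.ofReal (ρ y)) := by
        refine lintegral_lintegral_swap (Measurable.aemeasurable ?_)
        fun_prop
    _ ≤ ∫⁻ _, b ∂(μ.withDensity fun y => ENNReal.ofReal (ρ y)) := by
        rw [lintegral_withDensity_eq_lintegral_mul_non_measurable _ hρ (by simp),
          lintegral_withDensity_eq_lintegral_mul _ hρ measurable_const]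
        refine lintegral_mono fun y => ?_
        rcases le_or_gt ‖y‖ δ with hy | hy
        · exact mul_le_mul_right (hb y hy) _
        · simp [h.eq_zero y hy]
    _ = b := by simp

/-- The `L²` modulus of continuity of a `C¹` function on a ball. -/
lemma lintegral_sub_translate_le (hv : ContDiff ℝ 1 v) (R : ℝ) (y : G) :
    ∫⁻ x in Metric.closedBall 0 R, ‖v x - v (x - y)‖ₑ ^ 2 ∂μ ≤
      ‖y‖ₑ ^ 2 * ∫⁻ x in Metric.closedBall 0 (R + ‖y‖), ‖fderiv ℝ v x‖ₑ ^ 2 ∂μ := by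
  have hD := hv.continuous_fderiv one_ne_zero
  have hπ : IsProbabilityMeasure ((volume : Measure ℝ).restrict (Set.Ioc 0 1)) := ⟨by simp⟩
  have hpt : ∀ x, ‖v x - v (x - y)‖ₑ ^ 2 ≤
      ‖y‖ₑ ^ 2 * ∫⁻ s in Set.Ioc (0 : ℝ) 1, ‖fderiv ℝ v (x - s • y)‖ₑ ^ 2 := by
    intro x
    have hd : ∀ s : ℝ, HasDerivAt (fun s : ℝ => v (x - s • y)) (-(fderiv ℝ v (x - s • y) y)) s := by
      intro s
      have h1 : HasDerivAt (fun s : ℝ => x - s • y) (-y) s := by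
        simpa using ((hasDerivAt_id s).smul_const y).const_sub x
      have h2 := ((hv.differentiable one_ne_zero) (x - s • y)).hasFDerivAt.comp_hasDerivAt s h1
      refine h2.congr_deriv ?_
      simp
    have hc : Continuous fun s : ℝ => -(fderiv ℝ v (x - s • y) y) := by fun_prop
    have h3 := intervalIntegral.integral_eq_sub_of_hasDerivAt (fun s _ => hd s)
      (hc.intervalIntegrable 0 1)
    have h4 : v x - v (x - y) = ∫ s in Set.Ioc (0 : ℝ) 1, fderiv ℝ v (x - s • y) y := by
      rw [← intervalIntegral.integral_of_le zero_le_one, ← neg_inj, ← intervalIntegral.integral_neg,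
        h3]
      simp
    have h5 : AEStronglyMeasurable (fun s : ℝ => fderiv ℝ v (x - s • y) y)
        ((volume : Measure ℝ).restrict (Set.Ioc 0 1)) :=
      Continuous.aestronglyMeasurable (by fun_prop)
    calc ‖v x - v (x - y)‖ₑ ^ 2
        ≤ (∫⁻ s in Set.Ioc (0 : ℝ) 1, ‖fderiv ℝ v (x - s • y) y‖ₑ) ^ 2 := by
          rw [h4]
          gcongr
          exact enorm_integral_le_lintegral_enorm _
      _ ≤ ∫⁻ s in Set.Ioc (0 : ℝ) 1, ‖fderiv ℝ v (x - s • y) y‖ₑ ^ 2 := lintegral_enorm_sq_le h5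
      _ ≤ ∫⁻ s in Set.Ioc (0 : ℝ) 1, ‖y‖ₑ ^ 2 * ‖fderiv ℝ v (x - s • y)‖ₑ ^ 2 := by
          refine lintegral_mono fun s => ?_
          rw [mul_comm, ← mul_pow]
          gcongr
          exact ContinuousLinearMap.le_opENorm _ _
      _ = _ := lintegral_const_mul' _ _ (by simp)
  calc ∫⁻ x in Metric.closedBall 0 R, ‖v x - v (x - y)‖ₑ ^ 2 ∂μ
      ≤ ∫⁻ x in Metric.closedBall 0 R,
        (‖y‖ₑ ^ 2 * ∫⁻ s in Set.Ioc (0 : ℝ) 1, ‖fderiv ℝ v (x - s • y)‖ₑ ^ 2) ∂μ :=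
        lintegral_mono hpt
    _ = ‖y‖ₑ ^ 2 * ∫⁻ x in Metric.closedBall 0 R,
        (∫⁻ s in Set.Ioc (0 : ℝ) 1, ‖fderiv ℝ v (x - s • y)‖ₑ ^ 2) ∂μ :=
        lintegral_const_mul' _ _ (by simp)
    _ = ‖y‖ₑ ^ 2 * ∫⁻ s in Set.Ioc (0 : ℝ) 1,
        ∫⁻ x in Metric.closedBall 0 R, ‖fderiv ℝ v (x - s • y)‖ₑ ^ 2 ∂μ := by
        have hc : Continuous fun p : G × ℝ => ‖fderiv ℝ v (p.1 - p.2 • y)‖ₑ ^ 2 :=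
          (ENNReal.continuous_pow 2).comp (continuous_enorm.comp (by fun_prop))
        rw [lintegral_lintegral_swap hc.measurable.aemeasurable]
    _ ≤ ‖y‖ₑ ^ 2 * ∫⁻ _ in Set.Ioc (0 : ℝ) 1,
        ∫⁻ x in Metric.closedBall 0 (R + ‖y‖), ‖fderiv ℝ v x‖ₑ ^ 2 ∂μ := by
        refine mul_le_mul_right (setLIntegral_mono' measurableSet_Ioc fun s hs => ?_) _
        rw [← lintegral_indicator Metric.isClosed_closedBall.measurableSet,
          ← lintegral_indicator Metric.isClosed_closedBall.measurableSet,
          ← lintegral_sub_right_eq_self (μ := μ) ((Metric.closedBall 0 (R + ‖y‖)).indicator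
            fun x => ‖fderiv ℝ v x‖ₑ ^ 2) (s • y)]
        refine lintegral_mono fun x => ?_
        by_cases hx : x ∈ Metric.closedBall (0 : G) R
        · have hx' : x - s • y ∈ Metric.closedBall (0 : G) (R + ‖y‖) := by
            rw [mem_closedBall_zero_iff] at hx ⊢
            refine (norm_sub_le _ _).trans (add_le_add hx ?_)
            rw [norm_smul, Real.norm_of_nonneg hs.1.le]
            exact mul_le_of_le_one_left (norm_nonneg _) hs.2
          rw [Set.indicator_of_mem hx, Set.indicator_of_mem hx']
        · rw [Set.indicator_of_notMem hx]
          exact zero_le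
    _ = _ := by simp

/-- Continuity of translations in `L²_loc`. The bound `δ ≤ 1` keeps `x - y` in the ball of radius
`R + 1`, so that `v` may be replaced by its restriction to that ball, which is in `L²`. -/
lemma exists_lintegral_sub_translate_le (hm : Measurable v)
    (hv : ∀ R : ℝ, MemLp v 2 (μ.restrict (Metric.closedBall 0 R))) (R : ℝ) {ε : ℝ≥0∞} (hε : 0 < ε) :
    ∃ δ : ℝ, 0 < δ ∧ δ ≤ 1 ∧ ∀ y : G, ‖y‖ ≤ δ →
      ∫⁻ x in Metric.closedBall 0 R, ‖v x - v (x - y)‖ₑ ^ 2 ∂μ ≤ ε := by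
  obtain ⟨w, hw⟩ : ∃ w, w = (Metric.closedBall (0 : G) (R + 1)).indicator v := ⟨_, rfl⟩
  have hwm : Measurable w := hw ▸ hm.indicator Metric.isClosed_closedBall.measurableSet
  have hwL : MemLp w 2 μ := by
    rw [hw, memLp_indicator_iff_restrict Metric.isClosed_closedBall.measurableSet]
    exact hv _
  let g : G → C(G, G) := fun y => ⟨fun x => x - y, by fun_prop⟩
  have hg : Continuous g :=
    ContinuousMap.continuous_of_continuous_uncurry _
      (show Continuous fun p : G × G => p.2 - p.1 by fun_prop)
  have hgm : ∀ y, MeasurePreserving (g y) μ μ := fun y => measurePreserving_sub_right μ y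
  have hcont := (continuous_const (y := hwL.toLp w)).compMeasurePreservingLp hg hgm (by simp)
  obtain ⟨ε', hε', hεε⟩ : ∃ ε' : ℝ≥0∞, 0 < ε' ∧ ε' ^ 2 ≤ ε := by
    refine ⟨min 1 ε, lt_min one_pos hε, ?_⟩
    calc (min 1 ε) ^ 2 = min 1 ε * min 1 ε := sq _
      _ ≤ 1 * ε := mul_le_mul' (min_le_left _ _) (min_le_right _ _)
      _ = ε := one_mul ε
  obtain ⟨δ, hδ, hball⟩ := Metric.eventually_nhds_iff_ball.1
    (EMetric.tendsto_nhds.1 (hcont.tendsto 0) ε' hε')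
  refine ⟨min (δ / 2) 1, by positivity, min_le_right _ _, fun y hy => ?_⟩
  have hy1 : ‖y‖ ≤ 1 := hy.trans (min_le_right _ _)
  have hyb : y ∈ Metric.ball (0 : G) δ := by
    rw [mem_ball_zero_iff]
    have := hy.trans (min_le_left _ _)
    linarith
  have h1 := hball y hyb
  rw [Lp.edist_def] at h1
  have h2 : ∀ y, (Lp.compMeasurePreserving (g y) (hgm y) (hwL.toLp w) : G → ℝ) =ᵐ[μ]
      fun x => w (x - y) := fun y =>
    (Lp.coeFn_compMeasurePreserving _ (hgm y)).trans
      ((hgm y).quasiMeasurePreserving.ae_eq_comp hwL.coeFn_toLp)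
  have h3 := (h2 y).sub (h2 0)
  rw [eLpNorm_congr_ae h3] at h1
  refine le_trans ?_ ((pow_le_pow_left' h1.le 2).trans hεε)
  rw [eLpNorm_two_sq]
  refine le_trans ?_ (setLIntegral_le_lintegral (Metric.closedBall 0 R) _)
  refine setLIntegral_mono' Metric.isClosed_closedBall.measurableSet fun x hx => ?_
  rw [mem_closedBall_zero_iff] at hx
  have e1 : w (x - y) = v (x - y) := by
    rw [hw]
    refine Set.indicator_of_mem ?_ _
    rw [mem_closedBall_zero_iff]
    exact (norm_sub_le _ _).trans (add_le_add hx hy1)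
  have e2 : w x = v x := by
    rw [hw]
    refine Set.indicator_of_mem ?_ _
    rw [mem_closedBall_zero_iff]
    linarith
  have e3 : ‖v x - v (x - y)‖ₑ = ‖w (x - y) - w (x - 0)‖ₑ := by
    rw [sub_zero, e1, e2, ← enorm_neg, neg_sub]
  rw [e3]
  rfl

end Mollify

/-! ### Weak compactness and pointwise convergence -/

/-- The restriction map `L²(μ) → L²(μ')` for measures `μ' ≤ C μ`. -/
def lpOfLe {α : Type*} [MeasurableSpace α] {μ μ' : Measure α} {C : ℝ≥0}
    (h : μ' ≤ (C : ℝ≥0∞) • μ) : Lp ℝ 2 μ →L[ℝ] Lp ℝ 2 μ' :=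
  have hac : μ' ≪ μ := Measure.absolutelyContinuous_of_le_smul h
  LinearMap.mkContinuous
    { toFun := fun g => ((Lp.memLp g).of_measure_le_smul ENNReal.coe_ne_top h).toLp g
      map_add' := fun g g' => by
        rw [← MemLp.toLp_add]
        exact MemLp.toLp_congr _ _ (hac.ae_le (Lp.coeFn_add g g'))
      map_smul' := fun c g => by
        rw [RingHom.id_apply, ← MemLp.toLp_const_smul]
        exact MemLp.toLp_congr _ _ (hac.ae_le (Lp.coeFn_smul c g)) }
    ((C : ℝ≥0∞) ^ (1 / 2 : ℝ)).toReal fun g => by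
      have hC : (C : ℝ≥0∞) ^ (1 / 2 : ℝ) ≠ ⊤ := by
        exact ENNReal.rpow_ne_top_of_nonneg (by norm_num) ENNReal.coe_ne_top
      have h1 : eLpNorm g 2 μ' ≤ (C : ℝ≥0∞) ^ (1 / 2 : ℝ) * eLpNorm g 2 μ := by
        refine (eLpNorm_mono_measure _ h).trans (le_of_eq ?_)
        rw [eLpNorm_smul_measure_of_ne_top (by norm_num)]
        simp
      change ‖((Lp.memLp g).of_measure_le_smul ENNReal.coe_ne_top h).toLp g‖ ≤ _
      rw [Lp.norm_toLp, Lp.norm_def, ← ENNReal.toReal_mul]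
      exact ENNReal.toReal_mono (ENNReal.mul_ne_top hC (Lp.eLpNorm_ne_top g)) h1

lemma coeFn_lpOfLe {α : Type*} [MeasurableSpace α] {μ μ' : Measure α} {C : ℝ≥0}
    (h : μ' ≤ (C : ℝ≥0∞) • μ) (g : Lp ℝ 2 μ) : lpOfLe h g =ᵐ[μ'] g :=
  MemLp.coeFn_toLp ((Lp.memLp g).of_measure_le_smul ENNReal.coe_ne_top h)

/-- Weak sequential compactness: a bounded sequence in `L²(μ)` has a subsequence along which all
integrals against square integrable functions converge, also with respect to measures `μ' ≤ C μ`
(the restriction to `L²(μ')` being continuous). -/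
lemma exists_subseq_tendsto_integral {α : Type*} [MeasurableSpace α]
    [MeasurableSpace.CountablyGenerated α] {μ : Measure α} [IsFiniteMeasure μ]
    {u : ℕ → α → ℝ} (hu : ∀ k, MemLp (u k) 2 μ) {M : ℝ≥0} (hM : ∀ k, eLpNorm (u k) 2 μ ≤ M) :
    ∃ φ : ℕ → ℕ, StrictMono φ ∧ ∀ (μ' : Measure α) (C : ℝ≥0), μ' ≤ (C : ℝ≥0∞) • μ →
      ∀ ψ : α → ℝ, MemLp ψ 2 μ' →
        ∃ l : ℝ, Tendsto (fun k => ∫ a, u (φ k) a * ψ a ∂μ') atTop (𝓝 l) := by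
  have : Fact ((2 : ℝ≥0∞) ≠ ⊤) := ⟨by simp⟩
  have : SecondCountableTopology (Lp ℝ 2 μ) := Lp.SecondCountableTopology
  let x : ℕ → WeakDual ℝ (Lp ℝ 2 μ) := fun k =>
    StrongDual.toWeakDual (InnerProductSpace.toDual ℝ (Lp ℝ 2 μ) ((hu k).toLp (u k)))
  have hx : ∀ k, x k ∈ (WeakDual.toStrongDual ⁻¹' Metric.closedBall
      (0 : StrongDual ℝ (Lp ℝ 2 μ)) M : Set (WeakDual ℝ (Lp ℝ 2 μ))) := fun k => by
    change InnerProductSpace.toDual ℝ (Lp ℝ 2 μ) ((hu k).toLp (u k)) ∈ Metric.closedBall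
      (0 : StrongDual ℝ (Lp ℝ 2 μ)) M
    rw [mem_closedBall_zero_iff, LinearIsometryEquiv.norm_map, Lp.norm_toLp]
    exact ENNReal.toReal_le_coe_of_le_coe (hM k)
  obtain ⟨L, -, φ, hφ, hL⟩ := WeakDual.isSeqCompact_closedBall ℝ (Lp ℝ 2 μ) 0 M hx
  refine ⟨φ, hφ, fun μ' C h ψ hψ => ?_⟩
  have hac : μ' ≪ μ := Measure.absolutelyContinuous_of_le_smul h
  obtain ⟨w, hw⟩ : ∃ w : Lp ℝ 2 μ, ∀ g : Lp ℝ 2 μ,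
      ⟪w, g⟫_ℝ = ⟪hψ.toLp ψ, lpOfLe h g⟫_ℝ := by
    refine ⟨(InnerProductSpace.toDual ℝ (Lp ℝ 2 μ)).symm
      ((innerSL ℝ (hψ.toLp ψ)).comp (lpOfLe h)), fun g => ?_⟩
    rw [InnerProductSpace.toDual_symm_apply]
    rfl
  refine ⟨L w, ?_⟩
  have h1 : Tendsto (fun k => x (φ k) w) atTop (𝓝 (L w)) :=
    (WeakDual.eval_continuous w).tendsto L |>.comp hL
  refine h1.congr fun k => ?_
  have h2 : x (φ k) w = ⟪(hu (φ k)).toLp (u (φ k)), w⟫_ℝ := rfl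
  rw [h2, real_inner_comm, hw, L2.inner_def]
  refine integral_congr_ae ?_
  have h3 : lpOfLe h ((hu (φ k)).toLp (u (φ k))) =ᵐ[μ'] u (φ k) :=
    (coeFn_lpOfLe h _).trans (hac.ae_le (MemLp.coeFn_toLp (hu (φ k))))
  filter_upwards [h3, MemLp.coeFn_toLp hψ] with a h4 h5
  rw [h4, h5]
  rfl

section Holder

variable {T C : ℝ}

/-- A Hölder continuous function is close to its averages. -/
lemma abs_sub_average_le {c : ℝ → ℝ} (hC : 0 ≤ C)
    (hc : ∀ s ∈ Set.Icc 0 T, ∀ t ∈ Set.Icc 0 T, |c t - c s| ≤ C * √|t - s|)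
    {a b t d : ℝ} (ha : 0 ≤ a) (hab : a < b) (hb : b ≤ T) (ht : t ∈ Set.Icc 0 T)
    (hd : ∀ s ∈ Set.Icc a b, |t - s| ≤ d) :
    |c t - (b - a)⁻¹ * ∫ s in a..b, c s| ≤ C * √d := by
  have hba : 0 < b - a := sub_pos.2 hab
  have hcont : ContinuousOn c (Set.Icc 0 T) := by
    intro s hs
    rw [ContinuousWithinAt, tendsto_iff_dist_tendsto_zero]
    have h0 : Tendsto (fun t => C * √|t - s|) (𝓝[Set.Icc 0 T] s) (𝓝 0) := by
      have : Continuous fun t => C * √|t - s| := by fun_prop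
      have h := this.tendsto s
      simp only [sub_self, abs_zero, Real.sqrt_zero, mul_zero] at h
      exact h.mono_left nhdsWithin_le_nhds
    refine squeeze_zero' (Eventually.of_forall fun _ => dist_nonneg) ?_ h0
    filter_upwards [self_mem_nhdsWithin] with t ht
    rw [Real.dist_eq]
    exact hc s hs t ht
  have hsub : Set.uIcc a b ⊆ Set.Icc 0 T := by
    rw [Set.uIcc_of_le hab.le]
    exact Set.Icc_subset_Icc ha hb
  have hint : IntervalIntegrable c volume a b := (hcont.mono hsub).intervalIntegrable
  have e : c t - (b - a)⁻¹ * ∫ s in a..b, c s = (b - a)⁻¹ * ∫ s in a..b, (c t - c s) := by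
    rw [intervalIntegral.integral_sub (by simp) hint, intervalIntegral.integral_const, smul_eq_mul]
    field_simp
  have h1 : ‖∫ s in a..b, (c t - c s)‖ ≤ C * √d * |b - a| := by
    refine intervalIntegral.norm_integral_le_of_norm_le_const fun s hs => ?_
    rw [Set.uIoc_of_le hab.le] at hs
    have hs' : s ∈ Set.Icc a b := Set.Ioc_subset_Icc_self hs
    refine (hc s ⟨ha.trans hs'.1, hs'.2.trans hb⟩ t ht).trans ?_
    gcongr
    exact hd s hs'
  rw [e, abs_mul, abs_of_pos (inv_pos.2 hba)]
  rw [Real.norm_eq_abs, abs_of_pos hba] at h1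
  calc (b - a)⁻¹ * |∫ s in a..b, (c t - c s)| ≤ (b - a)⁻¹ * (C * √d * (b - a)) := by gcongr
    _ = C * √d := by field_simp

/-- Equi-Hölder continuity and convergence of all averages give pointwise convergence. -/
lemma cauchySeq_of_holder {c : ℕ → ℝ → ℝ} (hC : 0 ≤ C)
    (hc : ∀ k, ∀ s ∈ Set.Icc 0 T, ∀ t ∈ Set.Icc 0 T, |c k t - c k s| ≤ C * √|t - s|)
    (hw : ∀ a b, 0 ≤ a → a < b → b ≤ T → ∃ l, Tendsto (fun k => ∫ s in a..b, c k s) atTop (𝓝 l))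
    {t : ℝ} (ht : t ∈ Set.Ico 0 T) : CauchySeq fun k => c k t := by
  rw [Metric.cauchySeq_iff]
  intro ε hε
  have h0 : Tendsto (fun η : ℝ => C * √η) (𝓝[>] 0) (𝓝 0) := by
    have : Continuous fun η : ℝ => C * √η := by fun_prop
    have h := this.tendsto 0
    simp only [Real.sqrt_zero, mul_zero] at h
    exact h.mono_left nhdsWithin_le_nhds
  -- compare `c k t` with its average over `[t, t + η]`; this is why `t < T` is required
  have hT : ∀ᶠ η in 𝓝[>] (0 : ℝ), η < T - t :=
    nhdsWithin_le_nhds (gt_mem_nhds (sub_pos.2 ht.2))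
  obtain ⟨η, ⟨h1, h2⟩, h3⟩ := ((h0.eventually_lt_const (show 0 < ε / 3 by positivity)).and
    hT).and self_mem_nhdsWithin |>.exists
  have h3' : 0 < η := h3
  obtain ⟨l, hl⟩ := hw t (t + η) ht.1 (by linarith) (by linarith)
  have hl' := (hl.const_mul (t + η - t)⁻¹).cauchySeq
  obtain ⟨N, hN⟩ := Metric.cauchySeq_iff.1 hl' (ε / 3) (by positivity)
  refine ⟨N, fun i hi j hj => ?_⟩
  have hav : ∀ k, |c k t - (t + η - t)⁻¹ * ∫ s in t..(t + η), c k s| < ε / 3 := fun k =>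
    (abs_sub_average_le hC (hc k) ht.1 (by linarith) (by linarith) ⟨ht.1, ht.2.le⟩
      (fun s hs => abs_le.2 ⟨by linarith [hs.2], by linarith [hs.1]⟩)).trans_lt h1
  have h5 := hN i hi j hj
  rw [Real.dist_eq, abs_lt] at h5
  have h6 := abs_lt.1 (hav i)
  have h7 := abs_lt.1 (hav j)
  rw [Real.dist_eq, abs_lt]
  constructor <;> linarith [h5.1, h5.2, h6.1, h6.2, h7.1, h7.2]

end Holder

/-! ### A compactness criterion in `L²_#` -/

section Criterion

variable {n : ℕ} {A B : ℝ → E n →L[ℝ] E n} {f : ℝ → E n} {T : ℝ}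

lemma ennreal_add_sq_le (a b : ℝ≥0∞) : (a + b) ^ 2 ≤ 2 * (a ^ 2 + b ^ 2) := by
  have h := ENNReal.rpow_add_le_mul_rpow_add_rpow a b (p := 2) one_le_two
  norm_num at h
  exact h

/-- The spatial derivative `Dₓu`: the derivative of `u(t, ·)` at `x`, where `z = (t, x)`. It is a
functional rather than a vector; `norm_gradient` compares it with the gradient. -/
def dx (u : ℝ × E n → ℝ) (z : ℝ × E n) : E n →L[ℝ] ℝ := fderiv ℝ (fun x => u (z.1, x)) z.2

lemma dx_eq {u : ℝ × E n → ℝ} (hu : ContDiff ℝ 1 u) (z : ℝ × E n) :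
    dx u z = (fderiv ℝ u z).comp (ContinuousLinearMap.inr ℝ ℝ (E n)) := by
  have h1 : HasFDerivAt (fun x : E n => (z.1, x)) (ContinuousLinearMap.inr ℝ ℝ (E n)) z.2 :=
    hasFDerivAt_prodMk_right z.1 z.2
  have h2 : HasFDerivAt u (fderiv ℝ u z) (z.1, z.2) :=
    ((hu.differentiable one_ne_zero) z).hasFDerivAt
  exact (h2.comp z.2 h1).fderiv

lemma continuous_dx {u : ℝ × E n → ℝ} (hu : ContDiff ℝ 1 u) : Continuous (dx u) := by
  rw [funext (dx_eq hu)]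
  exact (hu.continuous_fderiv one_ne_zero).clm_comp continuous_const

lemma contDiff_slice {k : WithTop ℕ∞} {u : ℝ × E n → ℝ} (hu : ContDiff ℝ k u) (t : ℝ) :
    ContDiff ℝ k fun x => u (t, x) :=
  hu.comp (contDiff_prodMk_right t)

lemma continuous_enorm_sq {X Y : Type*} [TopologicalSpace X] [NormedAddCommGroup Y] {g : X → Y}
    (hg : Continuous g) : Continuous fun x => ‖g x‖ₑ ^ 2 :=
  (ENNReal.continuous_pow 2).comp (continuous_enorm.comp hg)

/-- Functions with bounded `L²(ν)` norm of `u` and of the spatial gradient have uniformly small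
tails: the function `|x| u` is square integrable. -/
lemma Setting.exists_tail_le (H : Setting A B f T) : ∃ C : ℝ≥0, ∀ u : ℝ × E n → ℝ,
    ContDiff ℝ 1 u → ∫⁻ z, (‖z.2‖ₑ * ‖u z‖ₑ) ^ 2 ∂(periodMeasure T (nu A B f)) ≤
      C * (∫⁻ z, ‖u z‖ₑ ^ 2 ∂(periodMeasure T (nu A B f)) +
        ∫⁻ z, ‖dx u z‖ₑ ^ 2 ∂(periodMeasure T (nu A B f))) := by
  obtain ⟨K, hK, hb⟩ := H.exists_frame_bounds
  obtain ⟨C₀, hC₀⟩ := exists_lintegral_norm_mul_le (E n)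
  lift K to ℝ≥0 using hK.le
  refine ⟨2 * K ^ 2 * (1 + C₀ + C₀ * K ^ 2), fun u hu => ?_⟩
  have huc := hu.continuous
  have hdc := continuous_dx hu
  have hm1 : Measurable fun z : ℝ × E n => ‖u z‖ₑ ^ 2 := (continuous_enorm_sq huc).measurable
  have hm2 : Measurable fun z : ℝ × E n => ‖dx u z‖ₑ ^ 2 := (continuous_enorm_sq hdc).measurable
  rw [← lintegral_add_left hm1, H.lintegral_periodMeasure (by fun_prop),
    H.lintegral_periodMeasure (F := fun z => ‖u z‖ₑ ^ 2 + ‖dx u z‖ₑ ^ 2) (hm1.add hm2),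
    mul_left_comm]
  refine mul_le_mul_right ?_ _
  rw [← lintegral_const_mul' _ _ ENNReal.coe_ne_top]
  refine setLIntegral_mono' measurableSet_Ioo fun t ht => ?_
  obtain ⟨h1, h2, -⟩ := hb t (Set.Ioo_subset_Icc_self ht)
  have ha : Measurable fun y => meanVec A f t + sqrtCov A B t y := by fun_prop
  have hm1' : Measurable fun x : E n => ‖u (t, x)‖ₑ ^ 2 := hm1.comp measurable_prodMk_left
  have hm2' : Measurable fun x : E n => ‖dx u (t, x)‖ₑ ^ 2 := hm2.comp measurable_prodMk_left
  rw [lintegral_add_left hm1', nuAt_eq_map, lintegral_map (by fun_prop) ha,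
    lintegral_map hm1' ha, lintegral_map hm2' ha]
  have hv : ContDiff ℝ 1 fun y => u (t, meanVec A f t + sqrtCov A B t y) :=
    (contDiff_slice hu t).comp (contDiff_const.add (sqrtCov A B t).contDiff)
  have h0 := hC₀ _ hv
  have hfd : ∀ y, ‖fderiv ℝ (fun y => u (t, meanVec A f t + sqrtCov A B t y)) y‖ₑ ^ 2 ≤
      (K : ℝ≥0∞) ^ 2 * ‖dx u (t, meanVec A f t + sqrtCov A B t y)‖ₑ ^ 2 := fun y => by
    have e1 : HasFDerivAt (fun y => meanVec A f t + sqrtCov A B t y) (sqrtCov A B t) y :=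
      (sqrtCov A B t).hasFDerivAt.const_add _
    have e2 : HasFDerivAt (fun x => u (t, x)) (dx u (t, meanVec A f t + sqrtCov A B t y))
        (meanVec A f t + sqrtCov A B t y) :=
      (((contDiff_slice hu t).differentiable one_ne_zero) _).hasFDerivAt
    have e3 : fderiv ℝ (fun y => u (t, meanVec A f t + sqrtCov A B t y)) y =
        (dx u (t, meanVec A f t + sqrtCov A B t y)).comp (sqrtCov A B t) := by
      have e4 := HasFDerivAt.comp y e2 e1
      exact e4.fderiv
    rw [← mul_pow, e3]
    gcongr
    rw [mul_comm]
    refine (ContinuousLinearMap.opENorm_comp_le _ _).trans ?_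
    gcongr
    exact enorm_le_coe.2 h2
  have hpt : ∀ y, (‖meanVec A f t + sqrtCov A B t y‖ₑ *
      ‖u (t, meanVec A f t + sqrtCov A B t y)‖ₑ) ^ 2 ≤
      2 * (K : ℝ≥0∞) ^ 2 * (‖u (t, meanVec A f t + sqrtCov A B t y)‖ₑ ^ 2 +
        (‖y‖ₑ * ‖u (t, meanVec A f t + sqrtCov A B t y)‖ₑ) ^ 2) := fun y => by
    have e1 : ‖meanVec A f t + sqrtCov A B t y‖ₑ ≤ K * (1 + ‖y‖ₑ) := by
      refine (enorm_add_le _ _).trans ?_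
      rw [mul_add, mul_one]
      refine add_le_add (enorm_le_coe.2 h1) ?_
      refine (ContinuousLinearMap.le_opENorm _ _).trans ?_
      gcongr
      exact enorm_le_coe.2 h2
    calc _ ≤ ((K : ℝ≥0∞) * (1 + ‖y‖ₑ) * ‖u (t, meanVec A f t + sqrtCov A B t y)‖ₑ) ^ 2 := by
          gcongr
      _ = (K : ℝ≥0∞) ^ 2 * (1 + ‖y‖ₑ) ^ 2 * ‖u (t, meanVec A f t + sqrtCov A B t y)‖ₑ ^ 2 := by
          ring
      _ ≤ (K : ℝ≥0∞) ^ 2 * (2 * (1 ^ 2 + ‖y‖ₑ ^ 2)) *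
          ‖u (t, meanVec A f t + sqrtCov A B t y)‖ₑ ^ 2 := by
          gcongr
          exact ennreal_add_sq_le _ _
      _ = _ := by ring
  have hm1'' : Measurable fun y => ‖u (t, meanVec A f t + sqrtCov A B t y)‖ₑ ^ 2 := hm1'.comp ha
  refine (lintegral_mono hpt).trans ?_
  rw [lintegral_const_mul' _ _ (by finiteness), lintegral_add_left hm1'']
  have h3 := lintegral_mono (μ := stdGaussian (E n)) hfd
  rw [lintegral_const_mul' _ _ (by finiteness)] at h3
  generalize ∫⁻ y, (‖y‖ₑ * ‖u (t, meanVec A f t + sqrtCov A B t y)‖ₑ) ^ 2 ∂stdGaussian (E n) = q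
    at *
  generalize ∫⁻ y, ‖fderiv ℝ (fun y => u (t, meanVec A f t + sqrtCov A B t y)) y‖ₑ ^ 2
    ∂stdGaussian (E n) = r at *
  generalize ∫⁻ y, ‖u (t, meanVec A f t + sqrtCov A B t y)‖ₑ ^ 2 ∂stdGaussian (E n) = a at *
  generalize ∫⁻ y, ‖dx u (t, meanVec A f t + sqrtCov A B t y)‖ₑ ^ 2 ∂stdGaussian (E n) = d at *
  push_cast
  rw [mul_assoc (2 * (K : ℝ≥0∞) ^ 2)]
  gcongr
  calc a + q ≤ a + C₀ * (a + (K : ℝ≥0∞) ^ 2 * d) := by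
        gcongr
        exact h0.trans (by gcongr)
    _ ≤ (a + C₀ * (a + (K : ℝ≥0∞) ^ 2 * d)) + (d + C₀ * d + C₀ * (K : ℝ≥0∞) ^ 2 * a) :=
        le_self_add
    _ = _ := by ring

/-- Mollification in the space variable only. -/
def spaceMollify (ρ : E n → ℝ) (u : ℝ × E n → ℝ) (z : ℝ × E n) : ℝ :=
  mollify volume ρ (fun x => u (z.1, x)) z.2

lemma measurable_spaceMollify {ρ : E n → ℝ} {u : ℝ × E n → ℝ} (hρ : Continuous ρ)
    (hu : Continuous u) : Measurable (spaceMollify ρ u) := by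
  have h : Continuous fun p : (ℝ × E n) × E n => ρ p.2 * u (p.1.1, p.1.2 - p.2) := by fun_prop
  exact (h.stronglyMeasurable.integral_prod_right (ν := (volume : Measure (E n)))).measurable

lemma spaceMollify_eq {ρ : E n → ℝ} {u : ℝ × E n → ℝ} (z : ℝ × E n) :
    spaceMollify ρ u z = ∫ y, u (z.1, y) * ρ (z.2 - y) := by
  rw [spaceMollify, mollify, ← integral_sub_left_eq_self
    (fun y => u (z.1, y) * ρ (z.2 - y)) volume z.2]
  simp only [sub_sub_cancel, mul_comm]

/-- The error of a mollification in space at scale `δ` is at most `δ ‖Dₓu‖`. -/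
lemma lintegral_sub_spaceMollify_le {ρ : E n → ℝ} {δ : ℝ} (hρ : IsMollifier volume ρ δ)
    (hδ : δ ≤ 1) {u : ℝ × E n → ℝ} (hu : ContDiff ℝ 1 u) (R : ℝ) :
    ∫⁻ z in Set.Ioo 0 T ×ˢ Metric.closedBall 0 R, ‖u z - spaceMollify ρ u z‖ₑ ^ 2 ≤
      ENNReal.ofReal δ ^ 2 *
        ∫⁻ z in Set.Ioo 0 T ×ˢ Metric.closedBall 0 (R + 1), ‖dx u z‖ₑ ^ 2 := by
  have hm : Measurable fun z => ‖u z - spaceMollify ρ u z‖ₑ ^ 2 :=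
    ((hu.continuous.measurable.sub
      (measurable_spaceMollify hρ.smooth.continuous hu.continuous)).enorm).pow_const 2
  have hm2 : Measurable fun z : ℝ × E n => ‖dx u z‖ₑ ^ 2 :=
    (continuous_enorm_sq (continuous_dx hu)).measurable
  rw [Measure.volume_eq_prod, ← Measure.prod_restrict, ← Measure.prod_restrict,
    lintegral_prod _ hm.aemeasurable, lintegral_prod _ hm2.aemeasurable,
    ← lintegral_const_mul' _ _ (by finiteness)]
  refine lintegral_mono fun t => ?_
  have hs := contDiff_slice hu t
  refine hρ.lintegral_sub_mollify_le hs.continuous.locallyIntegrable hs.continuous.measurable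
    fun y hy => (lintegral_sub_translate_le hs R y).trans ?_
  gcongr
  · rw [← ofReal_norm]
    exact ENNReal.ofReal_le_ofReal hy
  · exact hy.trans hδ
  · exact le_rfl

lemma Setting.exists_lintegral_volume_le (H : Setting A B f T) (R : ℝ) : ∃ C : ℝ≥0,
    ∀ F : ℝ × E n → ℝ≥0∞, ∫⁻ z in Set.Ioo 0 T ×ˢ Metric.closedBall 0 R, F z ≤
      C * ∫⁻ z, F z ∂(periodMeasure T (nu A B f)) := by
  obtain ⟨C, hC⟩ := H.exists_volume_le R
  refine ⟨C, fun F => (lintegral_mono' hC le_rfl).trans (le_of_eq ?_)⟩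
  rw [lintegral_smul_measure, smul_eq_mul]

lemma Setting.exists_lintegral_periodMeasure_le (H : Setting A B f T) : ∃ C : ℝ≥0,
    ∀ F : ℝ × E n → ℝ≥0∞, ∫⁻ z, F z ∂(periodMeasure T (nu A B f)) ≤
      C * ∫⁻ z in Set.Ioo 0 T ×ˢ Set.univ, F z := by
  obtain ⟨C, hC⟩ := H.exists_periodMeasure_le
  refine ⟨C, fun F => (lintegral_mono' hC le_rfl).trans (le_of_eq ?_)⟩
  rw [lintegral_smul_measure, smul_eq_mul]

/-- The function `1_{(a, b)}(t) ψ(x)`. Integrals against it are time averages of `∫ u(t, x) ψ(x) dx`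
(`intervalIntegral_slice`). -/
def slabTest (ψ : E n → ℝ) (a b : ℝ) (z : ℝ × E n) : ℝ := (Set.Ioo a b).indicator 1 z.1 * ψ z.2

lemma measurable_slabTest {ψ : E n → ℝ} (hψ : Continuous ψ) (a b : ℝ) :
    Measurable (slabTest ψ a b) :=
  ((measurable_one.indicator measurableSet_Ioo).comp measurable_fst).mul
    (hψ.measurable.comp measurable_snd)

lemma abs_slabTest_le {ψ : E n → ℝ} {L : ℝ} (hψ : ∀ x, |ψ x| ≤ L) (a b : ℝ) (z : ℝ × E n) :
    |slabTest ψ a b z| ≤ L := by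
  have hL : 0 ≤ L := (abs_nonneg _).trans (hψ 0)
  rw [slabTest]
  by_cases h : z.1 ∈ Set.Ioo a b
  · rw [Set.indicator_of_mem h, Pi.one_apply, one_mul]; exact hψ _
  · rw [Set.indicator_of_notMem h, zero_mul, abs_zero]; exact hL

lemma volume_slab_lt_top (T L : ℝ) :
    (volume : Measure (ℝ × E n)) (Set.Ioo 0 T ×ˢ Metric.closedBall 0 L) < ⊤ := by
  rw [Measure.volume_eq_prod, Measure.prod_prod]
  exact ENNReal.mul_lt_top (by simp) measure_closedBall_lt_top

lemma intervalIntegral_slice {u : ℝ × E n → ℝ} (hu : Continuous u) {ψ : E n → ℝ}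
    (hψ : Continuous ψ) {L : ℝ} (h0 : ∀ x, L < ‖x‖ → ψ x = 0) {a b : ℝ} (ha : 0 ≤ a)
    (hab : a ≤ b) (hb : b ≤ T) : ∫ s in a..b, ∫ y, u (s, y) * ψ y =
      ∫ z in Set.Ioo 0 T ×ˢ Metric.closedBall 0 L, u z * slabTest ψ a b z := by
  have hi0 : IntegrableOn (fun z => u z * ψ z.2) (Set.Ioo 0 T ×ˢ Metric.closedBall 0 L)
      (volume : Measure (ℝ × E n)) := by
    have hc : Continuous fun z : ℝ × E n => u z * ψ z.2 := by fun_prop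
    exact (hc.continuousOn.integrableOn_compact
      (isCompact_Icc.prod (isCompact_closedBall (0 : E n) L))).mono_set
      (Set.prod_mono Set.Ioo_subset_Icc_self le_rfl)
  have hms : MeasurableSet {z : ℝ × E n | z.1 ∈ Set.Ioo a b} := measurable_fst measurableSet_Ioo
  have e0 : (fun z => u z * slabTest ψ a b z) =
      {z : ℝ × E n | z.1 ∈ Set.Ioo a b}.indicator fun z => u z * ψ z.2 := by
    ext1 z
    by_cases h : z.1 ∈ Set.Ioo a b
    · rw [slabTest, Set.indicator_of_mem h, Set.indicator_of_mem (by exact h)]; simp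
    · rw [slabTest, Set.indicator_of_notMem h, Set.indicator_of_notMem (by exact h)]; simp
  have hi : IntegrableOn (fun z => u z * slabTest ψ a b z)
      (Set.Ioo 0 T ×ˢ Metric.closedBall 0 L) (volume : Measure (ℝ × E n)) := by
    rw [e0]; exact hi0.indicator hms
  rw [Measure.volume_eq_prod] at hi ⊢
  rw [setIntegral_prod _ hi, intervalIntegral.integral_of_le hab, integral_Ioc_eq_integral_Ioo]
  have e1 : ∀ t, ∫ y in Metric.closedBall 0 L, u (t, y) * slabTest ψ a b (t, y) =
      (Set.Ioo a b).indicator (fun t => ∫ y, u (t, y) * ψ y) t := by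
    intro t
    by_cases h : t ∈ Set.Ioo a b
    · rw [Set.indicator_of_mem h, setIntegral_eq_integral_of_forall_compl_eq_zero]
      · simp only [slabTest, Set.indicator_of_mem h, Pi.one_apply, one_mul]
      · intro x hx
        rw [mem_closedBall_zero_iff, not_le] at hx
        simp [slabTest, h0 x hx]
    · rw [Set.indicator_of_notMem h]
      simp [slabTest, Set.indicator_of_notMem h]
  simp_rw [e1]
  rw [setIntegral_indicator measurableSet_Ioo, Set.inter_eq_self_of_subset_right
    (Set.Ioo_subset_Ioo ha hb)]

/-- The sequence `u` satisfies a Hölder estimate in time, uniformly after testing with smooth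
functions of the space variable with support, values and gradients bounded by `L`. -/
def TimeEquicontinuous (T : ℝ) (u : ℕ → ℝ × E n → ℝ) : Prop :=
  ∀ L : ℝ, ∃ C : ℝ, ∀ ψ : E n → ℝ, ContDiff ℝ ∞ ψ → (∀ x, L < ‖x‖ → ψ x = 0) →
    (∀ x, |ψ x| ≤ L) → (∀ x, ‖fderiv ℝ ψ x‖ ≤ L) → ∀ k, ∀ s ∈ Set.Icc 0 T, ∀ t ∈ Set.Icc 0 T,
      |(∫ x, u k (t, x) * ψ x) - ∫ x, u k (s, x) * ψ x| ≤ C * √|t - s|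

/-- All integrals of `u k` against square integrable functions converge as `k → ∞`, also for
measures `μ' ≤ C μ`. The limit is not required to be given by a function. -/
def WeaklyConvergent {α : Type*} [MeasurableSpace α] (μ : Measure α) (u : ℕ → α → ℝ) : Prop :=
  ∀ (μ' : Measure α) (C : ℝ≥0), μ' ≤ (C : ℝ≥0∞) • μ →
      ∀ ψ : α → ℝ, MemLp ψ 2 μ' → ∃ l : ℝ, Tendsto (fun k => ∫ a, u k a * ψ a ∂μ') atTop (𝓝 l)

/-- The functions `y ↦ ρ(x - y)` with `|x| ≤ R` are admissible in `TimeEquicontinuous`, with the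
same `L` for all `x`. -/
lemma IsMollifier.exists_translate_bound {ρ : E n → ℝ} {δ : ℝ} (hρ : IsMollifier volume ρ δ)
    (hδ : δ ≤ 1) (R : ℝ) : ∃ L : ℝ, 0 ≤ L ∧ ∀ x ∈ Metric.closedBall (0 : E n) R,
      ContDiff ℝ ∞ (fun y => ρ (x - y)) ∧ (∀ y, L < ‖y‖ → ρ (x - y) = 0) ∧
      (∀ y, |ρ (x - y)| ≤ L) ∧ ∀ y, ‖fderiv ℝ (fun y => ρ (x - y)) y‖ ≤ L := by
  obtain ⟨C1, h1⟩ := hρ.hasCompactSupport.exists_bound_of_continuous hρ.smooth.continuous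
  obtain ⟨C2, h2⟩ := (hρ.hasCompactSupport.fderiv ℝ).exists_bound_of_continuous
    (hρ.smooth.continuous_fderiv (by simp))
  refine ⟨max (R + 1) (max C1 C2), (le_max_right _ _).trans' ((le_max_left _ _).trans'
    ((norm_nonneg _).trans (h1 0))), fun x hx => ⟨?_, fun y hy => ?_, fun y => ?_, fun y => ?_⟩⟩
  · exact hρ.smooth.comp (contDiff_const.sub contDiff_id)
  · refine hρ.eq_zero _ ?_
    rw [mem_closedBall_zero_iff] at hx
    have h3 : R + 1 < ‖y‖ := (le_max_left _ _).trans_lt hy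
    have h4 : ‖y‖ ≤ ‖x‖ + ‖x - y‖ := by
      calc ‖y‖ = ‖x - (x - y)‖ := by rw [sub_sub_cancel]
        _ ≤ _ := norm_sub_le _ _
    linarith
  · exact (h1 _).trans (by simp)
  · have : fderiv ℝ (fun y => ρ (x - y)) y = -fderiv ℝ ρ (x - y) := by
      have e1 : HasFDerivAt (fun y => x - y) (-ContinuousLinearMap.id ℝ (E n)) y :=
        (hasFDerivAt_id y).const_sub x
      have e2 := ((hρ.smooth.differentiable (by simp)) (x - y)).hasFDerivAt
      have e3 : HasFDerivAt (fun y => ρ (x - y)) _ y := HasFDerivAt.comp y e2 e1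
      rw [e3.fderiv]
      ext; simp
    rw [this, norm_neg]
    exact (h2 _).trans (by simp)

/-- Pointwise convergence of the space mollifications, and a uniform bound for them. Both come
from comparing `t ↦ ∫ u k (t, y) ρ(x - y) dy` with its time averages: short averages for the
convergence, the average over `(0, T)` for the bound. -/
lemma Setting.spaceMollify_cauchy_and_bound (H : Setting A B f T) {u : ℕ → ℝ × E n → ℝ}
    (hu : ∀ k, Continuous (u k)) {M : ℝ≥0} (hM : ∀ k, l2Norm T (nu A B f) (u k) ≤ M)
    (hh : TimeEquicontinuous T u) (hw : WeaklyConvergent (periodMeasure T (nu A B f)) u)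
    {ρ : E n → ℝ} {δ : ℝ} (hρ : IsMollifier volume ρ δ) (hδ : δ ≤ 1) (R : ℝ) :
    (∀ t ∈ Set.Ioo 0 T, ∀ x ∈ Metric.closedBall (0 : E n) R,
      CauchySeq fun k => spaceMollify ρ (u k) (t, x)) ∧
    ∃ D : ℝ, ∀ k, ∀ t ∈ Set.Ioo 0 T, ∀ x ∈ Metric.closedBall (0 : E n) R,
      |spaceMollify ρ (u k) (t, x)| ≤ D := by
  obtain ⟨L, hL, hψ⟩ := hρ.exists_translate_bound hδ R
  obtain ⟨C', hC'⟩ := hh L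
  obtain ⟨C, hC0, hC⟩ : ∃ C : ℝ, 0 ≤ C ∧ ∀ ψ : E n → ℝ, ContDiff ℝ ∞ ψ →
    (∀ x, L < ‖x‖ → ψ x = 0) → (∀ x, |ψ x| ≤ L) → (∀ x, ‖fderiv ℝ ψ x‖ ≤ L) → ∀ k,
      ∀ s ∈ Set.Icc 0 T, ∀ t ∈ Set.Icc 0 T,
      |(∫ x, u k (t, x) * ψ x) - ∫ x, u k (s, x) * ψ x| ≤ C * √|t - s| :=
    ⟨max C' 0, le_max_right _ _, fun ψ h1 h2 h3 h4 k s hs t ht =>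
      (hC' ψ h1 h2 h3 h4 k s hs t ht).trans (by gcongr; exact le_max_left _ _)⟩
  obtain ⟨CL, hCL⟩ := H.exists_volume_le L
  have hfin : IsFiniteMeasure ((volume : Measure (ℝ × E n)).restrict
      (Set.Ioo 0 T ×ˢ Metric.closedBall 0 L)) := ⟨by simpa using volume_slab_lt_top T L⟩
  have hTpos := H.pos
  constructor
  · intro t ht x hx
    obtain ⟨h1, h2, h3, h4⟩ := hψ x hx
    simp only [spaceMollify_eq]
    refine cauchySeq_of_holder (c := fun k s => ∫ y, u k (s, y) * ρ (x - y)) hC0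
      (hC _ h1 h2 h3 h4) (fun a b ha hab hb => ?_) (Set.Ioo_subset_Ico_self ht)
    have hmem : MemLp (slabTest (fun y => ρ (x - y)) a b) 2
        ((volume : Measure (ℝ × E n)).restrict (Set.Ioo 0 T ×ˢ Metric.closedBall 0 L)) :=
      MemLp.of_bound (measurable_slabTest h1.continuous a b).aestronglyMeasurable L
        (Eventually.of_forall fun z => abs_slabTest_le h3 a b z)
    obtain ⟨l, hl⟩ := hw _ CL hCL _ hmem
    refine ⟨l, hl.congr fun k => ?_⟩
    exact (intervalIntegral_slice (hu k) h1.continuous h2 ha hab.le hb).symm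
  · obtain ⟨P, hP⟩ : ∃ P : ℝ, ∀ k, ∫ z in Set.Ioo 0 T ×ˢ Metric.closedBall (0 : E n) L, |u k z| ≤ P :=
      by
      obtain ⟨V, hV⟩ : ∃ V : ℝ≥0∞, V ≠ ⊤ ∧ ∀ k, eLpNorm (u k) 1 ((volume : Measure (ℝ × E n)).restrict
          (Set.Ioo 0 T ×ˢ Metric.closedBall 0 L)) ≤ V := by
        refine ⟨((CL : ℝ≥0∞) ^ (1 / (2 : ℝ≥0∞)).toReal * M) * ((volume : Measure (ℝ × E n)).restrict
          (Set.Ioo 0 T ×ˢ Metric.closedBall 0 L) Set.univ) ^ (1 / 2 : ℝ), ?_, fun k => ?_⟩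
        · refine ENNReal.mul_ne_top (ENNReal.mul_ne_top (ENNReal.rpow_ne_top_of_nonneg (by positivity)
            ENNReal.coe_ne_top) ENNReal.coe_ne_top) (ENNReal.rpow_ne_top_of_nonneg (by norm_num)
            (measure_ne_top _ _))
        · refine (eLpNorm_le_eLpNorm_mul_rpow_measure_univ one_le_two
            (hu k).aestronglyMeasurable).trans ?_
          have e : (1 / (1 : ℝ≥0∞).toReal - 1 / (2 : ℝ≥0∞).toReal) = (1 / 2 : ℝ) := by norm_num
          rw [e]
          gcongr
          refine (eLpNorm_mono_measure _ hCL).trans ?_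
          rw [eLpNorm_smul_measure_of_ne_top (by norm_num)]
          exact mul_le_mul_right (hM k) _
      refine ⟨V.toReal, fun k => ?_⟩
      simp_rw [← Real.norm_eq_abs]
      rw [integral_norm_eq_lintegral_enorm (hu k).aestronglyMeasurable,
        ← eLpNorm_one_eq_lintegral_enorm]
      exact ENNReal.toReal_mono hV.1 (hV.2 k)
    refine ⟨C * √T + T⁻¹ * (P * L), fun k t ht x hx => ?_⟩
    obtain ⟨h1, h2, h3, h4⟩ := hψ x hx
    have ht' := Set.Ioo_subset_Icc_self ht
    have h5 := abs_sub_average_le hC0 (hC _ h1 h2 h3 h4 k) le_rfl H.pos le_rfl ht'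
      (d := T) (fun s hs => abs_le.2 ⟨by linarith [hs.2, ht'.1], by linarith [hs.1, ht'.2]⟩)
    rw [intervalIntegral_slice (hu k) h1.continuous h2 le_rfl H.pos.le le_rfl, sub_zero] at h5
    have hint : IntegrableOn (u k) (Set.Ioo 0 T ×ˢ Metric.closedBall (0 : E n) L) :=
      ((hu k).continuousOn.integrableOn_compact
        (isCompact_Icc.prod (isCompact_closedBall (0 : E n) L))).mono_set
        (Set.prod_mono Set.Ioo_subset_Icc_self le_rfl)
    have h6 : |∫ z in Set.Ioo 0 T ×ˢ Metric.closedBall 0 L,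
        u k z * slabTest (fun y => ρ (x - y)) 0 T z| ≤ P * L := by
      calc _ ≤ ∫ z in Set.Ioo 0 T ×ˢ Metric.closedBall (0 : E n) L, |u k z| * L := by
            rw [← Real.norm_eq_abs]
            refine norm_integral_le_of_norm_le (hint.abs.mul_const L)
              (Eventually.of_forall fun z => ?_)
            rw [Real.norm_eq_abs, abs_mul]
            gcongr
            exact abs_slabTest_le h3 0 T z
        _ = (∫ z in Set.Ioo 0 T ×ˢ Metric.closedBall (0 : E n) L, |u k z|) * L :=
            integral_mul_const _ _
        _ ≤ P * L := by gcongr; exact hP k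
    rw [spaceMollify_eq]
    generalize (∫ z in Set.Ioo 0 T ×ˢ Metric.closedBall 0 L,
        u k z * slabTest (fun y => ρ (x - y)) 0 T z) = q at h5 h6
    have h7 : |T⁻¹ * q| ≤ T⁻¹ * (P * L) := by
      rw [abs_mul, abs_of_pos (inv_pos.2 H.pos)]
      gcongr
    change |∫ y, u k (t, y) * ρ (x - y)| ≤ _
    calc |∫ y, u k (t, y) * ρ (x - y)|
        = |((∫ y, u k (t, y) * ρ (x - y)) - T⁻¹ * q) + T⁻¹ * q| := by rw [sub_add_cancel]
      _ ≤ _ := (abs_add_le _ _).trans (add_le_add h5 h7)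

/-- Dominated convergence turns `spaceMollify_cauchy_and_bound` into convergence in `L²`. -/
lemma Setting.tendsto_lintegral_spaceMollify_sub (H : Setting A B f T) {u : ℕ → ℝ × E n → ℝ}
    (hu : ∀ k, Continuous (u k)) {M : ℝ≥0} (hM : ∀ k, l2Norm T (nu A B f) (u k) ≤ M)
    (hh : TimeEquicontinuous T u) (hw : WeaklyConvergent (periodMeasure T (nu A B f)) u)
    {ρ : E n → ℝ} {δ : ℝ} (hρ : IsMollifier volume ρ δ) (hδ : δ ≤ 1) (R : ℝ) :
    Tendsto (fun p : ℕ × ℕ => ∫⁻ z in Set.Ioo 0 T ×ˢ Metric.closedBall 0 R,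
      ‖spaceMollify ρ (u p.1) z - spaceMollify ρ (u p.2) z‖ₑ ^ 2) atTop (𝓝 0) := by
  obtain ⟨hc, D, hD⟩ := H.spaceMollify_cauchy_and_bound hu hM hh hw hρ hδ R
  have hms : MeasurableSet (Set.Ioo 0 T ×ˢ Metric.closedBall (0 : E n) R) :=
    measurableSet_Ioo.prod Metric.isClosed_closedBall.measurableSet
  have hm := fun k => measurable_spaceMollify hρ.smooth.continuous (hu k)
  have h0 : (0 : ℝ≥0∞) = ∫⁻ _ in Set.Ioo 0 T ×ˢ Metric.closedBall (0 : E n) R, 0 := by simp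
  rw [h0]
  refine tendsto_lintegral_filter_of_dominated_convergence
    (fun _ => ENNReal.ofReal (2 * D) ^ 2) (Eventually.of_forall fun p => ?_)
    (Eventually.of_forall fun p => ?_) ?_ ?_
  · exact ((hm p.1).sub (hm p.2)).enorm.pow_const 2
  · refine (ae_restrict_iff' hms).2 (Eventually.of_forall fun z hz => ?_)
    gcongr
    rw [← ofReal_norm]
    refine ENNReal.ofReal_le_ofReal ((norm_sub_le _ _).trans ?_)
    rw [two_mul]
    exact add_le_add (hD p.1 z.1 hz.1 z.2 hz.2) (hD p.2 z.1 hz.1 z.2 hz.2)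
  · rw [lintegral_const, Measure.restrict_apply MeasurableSet.univ, Set.univ_inter]
    exact ENNReal.mul_ne_top (by finiteness) (volume_slab_lt_top T R).ne
  · refine (ae_restrict_iff' hms).2 (Eventually.of_forall fun z hz => ?_)
    have h1 := cauchySeq_iff_tendsto_dist_atTop_0.1 (hc z.1 hz.1 z.2 hz.2)
    have h2 : Tendsto (fun p : ℕ × ℕ => ENNReal.ofReal (dist (spaceMollify ρ (u p.1) z)
        (spaceMollify ρ (u p.2) z)) ^ 2) atTop (𝓝 (ENNReal.ofReal 0 ^ 2)) :=
      ((ENNReal.continuous_pow 2).comp ENNReal.continuous_ofReal).continuousAt.tendsto.comp h1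
    rw [ENNReal.ofReal_zero, zero_pow two_ne_zero] at h2
    refine h2.congr fun p => ?_
    rw [dist_eq_norm, ofReal_norm]

lemma tendsto_zero_of_sq {ι : Type*} {l : Filter ι} {a : ι → ℝ≥0∞}
    (h : Tendsto (fun i => a i ^ 2) l (𝓝 0)) : Tendsto a l (𝓝 0) := by
  have h1 := h.ennrpow_const (1 / 2)
  have h2 : ∀ i, (a i ^ 2) ^ (1 / 2 : ℝ) = a i := fun i => by
    rw [← ENNReal.rpow_natCast, ← ENNReal.rpow_mul]
    norm_num
  simpa only [h2, ENNReal.zero_rpow_of_pos (show (0 : ℝ) < 1 / 2 by norm_num)] using h1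

/-- The basic splitting: the `L²(ν)` norm of `g` is controlled by its tail `|x| > R`, by the error
of a mollification in space, and by the mollified function on `|x| ≤ R`. -/
lemma Setting.exists_lintegral_sq_le (H : Setting A B f T) : ∃ C : ℝ≥0, ∀ R : ℝ, 0 < R →
    ∃ C' : ℝ≥0, ∀ (δ : ℝ) (ρ : E n → ℝ), IsMollifier volume ρ δ → δ ≤ 1 →
    ∀ g : ℝ × E n → ℝ, ContDiff ℝ 1 g →
      ∫⁻ z, ‖g z‖ₑ ^ 2 ∂(periodMeasure T (nu A B f)) ≤
        (ENNReal.ofReal R)⁻¹ ^ 2 * (C * (∫⁻ z, ‖g z‖ₑ ^ 2 ∂(periodMeasure T (nu A B f)) +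
          ∫⁻ z, ‖dx g z‖ₑ ^ 2 ∂(periodMeasure T (nu A B f)))) +
        C' * (ENNReal.ofReal δ ^ 2 * ∫⁻ z, ‖dx g z‖ₑ ^ 2 ∂(periodMeasure T (nu A B f)) +
          ∫⁻ z in Set.Ioo 0 T ×ˢ Metric.closedBall 0 R, ‖spaceMollify ρ g z‖ₑ ^ 2) := by
  obtain ⟨C, hC⟩ := H.exists_tail_le
  obtain ⟨C1, hC1⟩ := H.exists_lintegral_periodMeasure_le
  refine ⟨C, fun R hR => ?_⟩
  obtain ⟨C2, hC2⟩ := H.exists_lintegral_volume_le (R + 1)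
  refine ⟨2 * C1 * (1 + C2), fun δ ρ hρ hδ g hg => ?_⟩
  have hmR : MeasurableSet {z : ℝ × E n | ‖z.2‖ ≤ R} :=
    measurableSet_le measurable_snd.norm measurable_const
  refine (lintegral_add_compl _ hmR).symm.le.trans ?_
  rw [add_comm]
  refine add_le_add ?_ ?_
  · refine le_trans ?_ (mul_le_mul_right (hC g hg) _)
    rw [← lintegral_const_mul' _ _ (by simp [hR])]
    refine (setLIntegral_mono' hmR.compl fun z hz => ?_).trans (setLIntegral_le_lintegral _ _)
    have hz' : R < ‖z.2‖ := not_le.1 hz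
    rw [← mul_pow, ← mul_assoc]
    gcongr
    refine le_mul_of_one_le_left' ?_
    rw [← ofReal_norm z.2, ← ENNReal.div_eq_inv_mul]
    rw [ENNReal.le_div_iff_mul_le (by simp [hR]) (by simp), one_mul]
    exact ENNReal.ofReal_le_ofReal hz'.le
  · rw [← lintegral_indicator hmR]
    refine (hC1 _).trans ?_
    have hms : MeasurableSet (Set.Ioo 0 T ×ˢ (Set.univ : Set (E n))) :=
      measurableSet_Ioo.prod MeasurableSet.univ
    have e1 : ∫⁻ z in Set.Ioo 0 T ×ˢ Set.univ,
        {z : ℝ × E n | ‖z.2‖ ≤ R}.indicator (fun z => ‖g z‖ₑ ^ 2) z =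
        ∫⁻ z in Set.Ioo 0 T ×ˢ Metric.closedBall 0 R, ‖g z‖ₑ ^ 2 := by
      rw [setLIntegral_indicator hmR]
      congr 2
      ext z
      simp [and_comm]
    rw [e1]
    have hgm : Measurable (spaceMollify ρ g) := measurable_spaceMollify hρ.smooth.continuous
      hg.continuous
    have e2 : ∫⁻ z in Set.Ioo 0 T ×ˢ Metric.closedBall 0 R, ‖g z‖ₑ ^ 2 ≤
        2 * ((∫⁻ z in Set.Ioo 0 T ×ˢ Metric.closedBall 0 R, ‖g z - spaceMollify ρ g z‖ₑ ^ 2) +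
          ∫⁻ z in Set.Ioo 0 T ×ˢ Metric.closedBall 0 R, ‖spaceMollify ρ g z‖ₑ ^ 2) := by
      rw [← lintegral_add_right _ (hgm.enorm.pow_const 2), ← lintegral_const_mul' _ _ (by simp)]
      refine lintegral_mono fun z => ?_
      refine le_trans ?_ (ennreal_add_sq_le _ _)
      gcongr
      calc ‖g z‖ₑ = ‖(g z - spaceMollify ρ g z) + spaceMollify ρ g z‖ₑ := by rw [sub_add_cancel]
        _ ≤ _ := enorm_add_le _ _
    have e3 := (lintegral_sub_spaceMollify_le (T := T) hρ hδ hg R).trans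
      (mul_le_mul_right (hC2 _) _)
    generalize ∫⁻ z in Set.Ioo 0 T ×ˢ Metric.closedBall 0 R, ‖spaceMollify ρ g z‖ₑ ^ 2 = q at *
    generalize ∫⁻ z, ‖dx g z‖ₑ ^ 2 ∂(periodMeasure T (nu A B f)) = d at *
    calc (C1 : ℝ≥0∞) * _ ≤ C1 * (2 * (ENNReal.ofReal δ ^ 2 * (C2 * d) + q)) := by
          gcongr
          exact e2.trans (by gcongr)
      _ ≤ C1 * (2 * (ENNReal.ofReal δ ^ 2 * (C2 * d) + q)) +
          (2 * C1 * (ENNReal.ofReal δ ^ 2 * d) + 2 * C1 * C2 * q) := le_self_add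
      _ = _ := by push_cast; ring

lemma spaceMollify_sub {ρ : E n → ℝ} {δ : ℝ} (hρ : IsMollifier volume ρ δ) {u v : ℝ × E n → ℝ}
    (hu : Continuous u) (hv : Continuous v) (z : ℝ × E n) :
    spaceMollify ρ (u - v) z = spaceMollify ρ u z - spaceMollify ρ v z := by
  have h1 := hρ.integrable_mul (v := fun x => u (z.1, x))
    (Continuous.locallyIntegrable (by fun_prop)) z.2
  have h2 := hρ.integrable_mul (v := fun x => v (z.1, x))
    (Continuous.locallyIntegrable (by fun_prop)) z.2
  simp only [spaceMollify, mollify]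
  rw [← integral_sub h1 h2]
  simp only [Pi.sub_apply, mul_sub]

lemma dx_sub {u v : ℝ × E n → ℝ} (hu : ContDiff ℝ 1 u) (hv : ContDiff ℝ 1 v) (z : ℝ × E n) :
    dx (u - v) z = dx u z - dx v z := by
  have h1 := ((contDiff_slice hu z.1).differentiable one_ne_zero) z.2
  have h2 := ((contDiff_slice hv z.1).differentiable one_ne_zero) z.2
  exact fderiv_sub h1 h2

lemma lintegral_sub_sq_le {α X : Type*} [MeasurableSpace α] {μ : Measure α} [NormedAddCommGroup X]
    {g h : α → X} (hg : AEStronglyMeasurable g μ) (hh : AEStronglyMeasurable h μ) {M : ℝ≥0∞}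
    (h1 : eLpNorm g 2 μ ≤ M) (h2 : eLpNorm h 2 μ ≤ M) :
    ∫⁻ a, ‖g a - h a‖ₑ ^ 2 ∂μ ≤ (2 * M) ^ 2 := by
  have h3 := eLpNorm_two_sq μ (g - h)
  simp only [Pi.sub_apply] at h3
  rw [← h3, two_mul]
  gcongr
  exact (eLpNorm_sub_le hg hh one_le_two).trans (add_le_add h1 h2)

/-- The Cauchy property in `L²(ν)`: in `exists_lintegral_sq_le` choose first `R` large, then the
scale `δ` of the mollification small, then the indices large. -/
lemma Setting.tendsto_lintegral_sub (H : Setting A B f T) {u : ℕ → ℝ × E n → ℝ}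
    (hu : ∀ k, ContDiff ℝ 1 (u k)) {M : ℝ≥0} (hM : ∀ k, l2Norm T (nu A B f) (u k) ≤ M)
    (hd : ∀ k, eLpNorm (dx (u k)) 2 (periodMeasure T (nu A B f)) ≤ M)
    (hh : TimeEquicontinuous T u) (hw : WeaklyConvergent (periodMeasure T (nu A B f)) u) :
    Tendsto (fun p : ℕ × ℕ => ∫⁻ z, ‖(u p.1 - u p.2) z‖ₑ ^ 2 ∂(periodMeasure T (nu A B f)))
      atTop (𝓝 0) := by
  obtain ⟨C, hC⟩ := H.exists_lintegral_sq_le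
  have ha : ∀ p : ℕ × ℕ, ∫⁻ z, ‖(u p.1 - u p.2) z‖ₑ ^ 2 ∂(periodMeasure T (nu A B f)) ≤
      (2 * M) ^ 2 := fun p =>
    lintegral_sub_sq_le (hu _).continuous.aestronglyMeasurable
      (hu _).continuous.aestronglyMeasurable (hM _) (hM _)
  have hb : ∀ p : ℕ × ℕ, ∫⁻ z, ‖dx (u p.1 - u p.2) z‖ₑ ^ 2 ∂(periodMeasure T (nu A B f)) ≤
      (2 * M) ^ 2 := fun p => by
    simp only [dx_sub (hu p.1) (hu p.2)]
    exact lintegral_sub_sq_le (continuous_dx (hu _)).aestronglyMeasurable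
      (continuous_dx (hu _)).aestronglyMeasurable (hd _) (hd _)
  rw [ENNReal.tendsto_nhds_zero]
  intro ε hε
  have hε3 : 0 < ε / 3 := ENNReal.div_pos hε.ne' (by simp)
  have hN : Tendsto (fun N : ℕ => (N : ℝ) + 1) atTop atTop :=
    tendsto_atTop_add_const_right _ _ tendsto_natCast_atTop_atTop
  have hR : Tendsto (fun N : ℕ => (ENNReal.ofReal ((N : ℝ) + 1))⁻¹ ^ 2 *
      (C * ((2 * M : ℝ≥0∞) ^ 2 + (2 * M) ^ 2))) atTop (𝓝 0) := by
    have h1 : Tendsto (fun N : ℕ => (ENNReal.ofReal ((N : ℝ) + 1))⁻¹) atTop (𝓝 0) := by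
      rw [← ENNReal.inv_top]
      exact (tendsto_inv_iff (G := ℝ≥0∞)).2 (ENNReal.tendsto_ofReal_atTop.comp hN)
    have h2 : Tendsto (fun N : ℕ => (ENNReal.ofReal ((N : ℝ) + 1))⁻¹ ^ 2) atTop (𝓝 (0 ^ 2)) :=
      ENNReal.Tendsto.pow h1
    rw [zero_pow two_ne_zero] at h2
    simpa using ENNReal.Tendsto.mul_const h2 (Or.inr (by finiteness))
  obtain ⟨N, hN1⟩ := (ENNReal.tendsto_nhds_zero.1 hR _ hε3).exists
  obtain ⟨C', hC'⟩ := hC ((N : ℝ) + 1) (by positivity)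
  have hδ : Tendsto (fun N : ℕ => (C' : ℝ≥0∞) *
      (ENNReal.ofReal (((N : ℝ) + 1)⁻¹) ^ 2 * (2 * M : ℝ≥0∞) ^ 2)) atTop (𝓝 0) := by
    have h1 : Tendsto (fun N : ℕ => ENNReal.ofReal (((N : ℝ) + 1)⁻¹)) atTop (𝓝 0) := by
      rw [← ENNReal.ofReal_zero]
      exact (ENNReal.continuous_ofReal.tendsto 0).comp (tendsto_inv_atTop_zero.comp hN)
    have h2 : Tendsto (fun N : ℕ => ENNReal.ofReal (((N : ℝ) + 1)⁻¹) ^ 2) atTop (𝓝 (0 ^ 2)) :=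
      ENNReal.Tendsto.pow h1
    rw [zero_pow two_ne_zero] at h2
    have h3 := ENNReal.Tendsto.mul_const h2 (b := (2 * M : ℝ≥0∞) ^ 2) (Or.inr (by finiteness))
    rw [zero_mul] at h3
    simpa using ENNReal.Tendsto.const_mul h3 (a := (C' : ℝ≥0∞)) (Or.inr (by finiteness))
  obtain ⟨N', hN2⟩ := (ENNReal.tendsto_nhds_zero.1 hδ _ hε3).exists
  have hδ1 : ((N' : ℝ) + 1)⁻¹ ≤ 1 := inv_le_one_of_one_le₀ (by linarith [N'.cast_nonneg (α := ℝ)])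
  obtain ⟨ρ, hρ⟩ := exists_isMollifier (volume : Measure (E n))
    (show (0 : ℝ) < ((N' : ℝ) + 1)⁻¹ by positivity)
  have hlim := H.tendsto_lintegral_spaceMollify_sub (fun k => (hu k).continuous) hM hh hw hρ hδ1
    ((N : ℝ) + 1)
  have hlim' := ENNReal.Tendsto.const_mul hlim (a := (C' : ℝ≥0∞)) (Or.inr (by finiteness))
  rw [mul_zero] at hlim'
  filter_upwards [ENNReal.tendsto_nhds_zero.1 hlim' _ hε3] with p hp
  have h := hC' _ ρ hρ hδ1 (u p.1 - u p.2) ((hu _).sub (hu _))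
  simp only [spaceMollify_sub hρ (hu p.1).continuous (hu p.2).continuous] at h
  calc _ ≤ _ := h
    _ ≤ ε / 3 + (ε / 3 + ε / 3) := by
        refine add_le_add (le_trans ?_ hN1) ?_
        · gcongr
          · exact ha p
          · exact hb p
        · rw [mul_add]
          refine add_le_add (le_trans ?_ hN2) hp
          gcongr
          exact hb p
    _ = ε := by rw [← add_assoc, ENNReal.add_thirds]

/-- The periodic extension of a function on `(0, T) × ℝⁿ`. Limits in `L²(T⁻¹ ν)` on the period
carry no information outside `(0, T)`; this makes them elements of `L²_#`. -/
def timePeriodize (T : ℝ) (v : ℝ × E n → ℝ) (z : ℝ × E n) : ℝ := v (T * Int.fract (z.1 / T), z.2)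

lemma memL2Sharp_timePeriodize (hT : 0 < T) {ν : Measure (ℝ × E n)} {v : ℝ × E n → ℝ}
    (hv : StronglyMeasurable v) (hm : MemLp v 2 (periodMeasure T ν)) :
    MemL2Sharp T ν (timePeriodize T v) ∧ timePeriodize T v =ᵐ[periodMeasure T ν] v := by
  have h1 : timePeriodize T v =ᵐ[periodMeasure T ν] v := by
    refine Measure.ae_smul_measure ?_ _
    refine (ae_restrict_iff' (measurableSet_Ioo.prod MeasurableSet.univ)).2
      (Eventually.of_forall fun z hz => ?_)
    have hz' : z.1 / T ∈ Set.Ico (0 : ℝ) 1 :=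
      ⟨div_nonneg hz.1.1.le hT.le, (div_lt_one hT).2 hz.1.2⟩
    rw [timePeriodize, Int.fract_eq_self.2 hz', mul_div_cancel₀ _ hT.ne']
  have h2 : Measurable (timePeriodize T v) :=
    hv.measurable.comp (((measurable_fract.comp (measurable_fst.div_const T)).const_mul T).prodMk
      measurable_snd)
  refine ⟨⟨h2.aestronglyMeasurable, Eventually.of_forall fun z => ?_, (memLp_congr_ae h1).2 hm⟩, h1⟩
  simp only [timePeriodize]
  rw [add_div, div_self hT.ne', Int.fract_add_one]

/-- Compactness criterion: functions `w k` of class `C¹` that are bounded, together with their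
spatial gradients, in `L²(ν)`, and that are equicontinuous in time after testing in space, have a
subsequence that converges in `L²_#`; so has any sequence `u k` with `u k - w k → 0`. -/
theorem Setting.exists_subseq_tendsto (H : Setting A B f T) {w : ℕ → ℝ × E n → ℝ}
    (hw : ∀ k, ContDiff ℝ 1 (w k)) {M : ℝ≥0} (hM : ∀ k, l2Norm T (nu A B f) (w k) ≤ M)
    (hd : ∀ k, eLpNorm (dx (w k)) 2 (periodMeasure T (nu A B f)) ≤ M)
    (hh : TimeEquicontinuous T w) {u : ℕ → ℝ × E n → ℝ}
    (hu : ∀ k, MemL2Sharp T (nu A B f) (u k))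
    (hwu : Tendsto (fun k => l2Norm T (nu A B f) (w k - u k)) atTop (𝓝 0)) :
    ∃ φ : ℕ → ℕ, StrictMono φ ∧ ∃ v : ℝ × E n → ℝ, MemL2Sharp T (nu A B f) v ∧
      Tendsto (fun k => l2Norm T (nu A B f) (u (φ k) - v)) atTop (𝓝 0) := by
  have := H.isProbabilityMeasure_periodMeasure
  have hwL : ∀ k, MemLp (w k) 2 (periodMeasure T (nu A B f)) := fun k =>
    ⟨(hw k).continuous.aestronglyMeasurable, (hM k).trans_lt ENNReal.coe_lt_top⟩
  obtain ⟨φ, hφ, hφw⟩ := exists_subseq_tendsto_integral hwL hM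
  have hc : Tendsto (fun p : ℕ × ℕ => eLpNorm (w (φ p.1) - w (φ p.2)) 2
      (periodMeasure T (nu A B f))) atTop (𝓝 0) := by
    refine tendsto_zero_of_sq ?_
    simp only [eLpNorm_two_sq]
    exact H.tendsto_lintegral_sub (u := fun k => w (φ k)) (fun k => hw _) (fun k => hM _)
      (fun k => hd _) (fun L => (hh L).imp fun C hC ψ h1 h2 h3 h4 k => hC ψ h1 h2 h3 h4 (φ k)) hφw
  have hcs : CauchySeq fun k => (hwL (φ k)).toLp (w (φ k)) := by
    rw [cauchySeq_iff_tendsto_dist_atTop_0]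
    have h1 := (ENNReal.tendsto_toReal ENNReal.zero_ne_top).comp hc
    rw [ENNReal.toReal_zero] at h1
    refine h1.congr fun p => ?_
    rw [Function.comp_apply, dist_edist, Lp.edist_toLp_toLp]
  have : Fact ((1 : ℝ≥0∞) ≤ 2) := ⟨one_le_two⟩
  obtain ⟨v₀, hv₀⟩ := cauchySeq_tendsto_of_complete hcs
  obtain ⟨hv, hvv⟩ := memL2Sharp_timePeriodize H.pos (Lp.stronglyMeasurable v₀) (Lp.memLp v₀)
  refine ⟨φ, hφ, _, hv, ?_⟩
  rw [← Lp.toLp_coeFn v₀ (Lp.memLp v₀), Lp.tendsto_Lp_iff_tendsto_eLpNorm''] at hv₀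
  have h2 := (hwu.comp hφ.tendsto_atTop).add hv₀
  rw [add_zero] at h2
  refine tendsto_of_tendsto_of_tendsto_of_le_of_le tendsto_const_nhds h2 (fun _ => bot_le) fun k => ?_
  have e : eLpNorm (w (φ k) - ⇑v₀) 2 (periodMeasure T (nu A B f)) =
      eLpNorm (w (φ k) - timePeriodize T v₀) 2 (periodMeasure T (nu A B f)) :=
    eLpNorm_congr_ae ((EventuallyEq.refl _ _).sub hvv.symm)
  have hm1 := (hu (φ k)).2.2.aestronglyMeasurable
  have hm2 := (hwL (φ k)).aestronglyMeasurable
  rw [e, Function.comp_apply, l2Norm, l2Norm, eLpNorm_sub_comm (w (φ k)) (u (φ k))]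
  calc eLpNorm (u (φ k) - timePeriodize T v₀) 2 (periodMeasure T (nu A B f))
      = eLpNorm ((u (φ k) - w (φ k)) + (w (φ k) - timePeriodize T v₀)) 2
        (periodMeasure T (nu A B f)) := by rw [sub_add_sub_cancel]
    _ ≤ _ := eLpNorm_add_le (hm1.sub hm2) (hm2.sub hv.2.2.aestronglyMeasurable) one_le_two

end Criterion

/-! ### Mollification of weakly differentiable functions -/

section Weak

variable {n : ℕ}

instance : (volume : Measure (ℝ × E n)).IsAddHaarMeasure := by
  rw [Measure.volume_eq_prod]; infer_instance

lemma mollify_congr_ae {ρ v w : ℝ × E n → ℝ} (h : v =ᵐ[volume] w) :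
    mollify volume ρ v = mollify volume ρ w := by
  ext1 z
  refine integral_congr_ae ?_
  filter_upwards [(quasiMeasurePreserving_sub_left_of_right_invariant volume z).ae_eq_comp h]
    with y hy
  rw [Function.comp_apply, Function.comp_apply] at hy
  rw [hy]

lemma mollify_eq_integral_sub {ρ v : ℝ × E n → ℝ} (z : ℝ × E n) :
    mollify volume ρ v z = ∫ y, v y * ρ (z - y) := by
  rw [mollify, ← integral_sub_left_eq_self (fun y => v y * ρ (z - y)) volume z]
  simp only [sub_sub_cancel, mul_comm]

lemma IsMollifier.contDiff_mollify {ρ v : ℝ × E n → ℝ} {δ : ℝ} (hρ : IsMollifier volume ρ δ)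
    (hv : LocallyIntegrable v volume) : ContDiff ℝ ∞ (mollify volume ρ v) :=
  hρ.hasCompactSupport.contDiff_convolution_left (n := ⊤) (ContinuousLinearMap.mul ℝ ℝ)
    hρ.smooth hv

/-- The derivatives of a mollification are the mollifications of the weak derivatives. -/
lemma IsMollifier.fderiv_mollify {ρ u v : ℝ × E n → ℝ} {δ : ℝ} (hρ : IsMollifier volume ρ δ)
    {e : ℝ × E n} (h : HasWeakDeriv u v e) (z : ℝ × E n) :
    fderiv ℝ (mollify volume ρ u) z e = mollify volume ρ v z := by
  have hρ1 : ContDiff ℝ 1 ρ := hρ.smooth.of_le (by simp)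
  have h1 := hρ.hasCompactSupport.hasFDerivAt_convolution_left (ContinuousLinearMap.mul ℝ ℝ)
    hρ1 h.1 z
  have h2 : fderiv ℝ (mollify volume ρ u) z = _ := h1.fderiv
  have h3 := (hρ.hasCompactSupport.fderiv ℝ).convolutionExists_left
    ((ContinuousLinearMap.mul ℝ ℝ).precompL (ℝ × E n)) (hρ1.continuous_fderiv one_ne_zero) h.1 z
  rw [h2, convolution, ContinuousLinearMap.integral_apply h3]
  simp only [ContinuousLinearMap.precompL_apply, ContinuousLinearMap.mul_apply']
  rw [mollify_eq_integral_sub]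
  have hφ : ContDiff ℝ ∞ fun y => ρ (z - y) := hρ.smooth.comp (contDiff_const.sub contDiff_id)
  have hφc : HasCompactSupport fun y => ρ (z - y) :=
    hρ.hasCompactSupport.comp_homeomorph (Homeomorph.subLeft z)
  have h4 := h.2.2 _ hφ hφc
  have h5 : ∀ y, fderiv ℝ (fun y => ρ (z - y)) y e = -fderiv ℝ ρ (z - y) e := fun y => by
    have e1 : HasFDerivAt (fun y => z - y) (-ContinuousLinearMap.id ℝ (ℝ × E n)) y :=
      (hasFDerivAt_id y).const_sub z
    have e2 := ((hρ1.differentiable one_ne_zero) (z - y)).hasFDerivAt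
    have e3 : HasFDerivAt (fun y => ρ (z - y)) _ y := HasFDerivAt.comp y e2 e1
    rw [e3.fderiv]
    simp
  simp only [h5, mul_neg, integral_neg, neg_inj] at h4
  rw [← h4, ← integral_sub_left_eq_self (fun y => u y * fderiv ℝ ρ (z - y) e) volume z]
  simp only [sub_sub_cancel, mul_comm]

lemma MemL2Loc.locallyIntegrable {v : ℝ × E n → ℝ} (hv : MemL2Loc v) :
    LocallyIntegrable v volume := by
  rw [locallyIntegrable_iff]
  intro K hK
  have : IsFiniteMeasure ((volume : Measure (ℝ × E n)).restrict K) :=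
    ⟨by simpa using hK.measure_lt_top⟩
  exact (hv K hK).integrable one_le_two

variable {A B : ℝ → E n →L[ℝ] E n} {f : ℝ → E n} {T : ℝ}

/-- Mollification in time and space converges in `L²(ν)` on `|x| ≤ L`, over a period. -/
lemma Setting.exists_mollify_sub_le (H : Setting A B f T) {v : ℝ × E n → ℝ} (hv : MemL2Loc v)
    (L : ℝ) {ε : ℝ≥0∞} (hε : 0 < ε) : ∃ δ₀ : ℝ, 0 < δ₀ ∧ ∀ ρ : ℝ × E n → ℝ, ∀ δ ≤ δ₀,
      IsMollifier volume ρ δ →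
      eLpNorm ({z : ℝ × E n | ‖z.2‖ ≤ L}.indicator (mollify volume ρ v - v)) 2
        (periodMeasure T (nu A B f)) ≤ ε := by
  obtain ⟨C, hC⟩ := H.exists_periodMeasure_le
  have hms : MeasurableSet {z : ℝ × E n | ‖z.2‖ ≤ L} :=
    measurableSet_le measurable_snd.norm measurable_const
  have hac : periodMeasure T (nu A B f) ≪ volume :=
    (Measure.absolutelyContinuous_of_le_smul hC).trans Measure.restrict_le_self.absolutelyContinuous
  have hvi := hv.locallyIntegrable
  have hva := hvi.aestronglyMeasurable
  -- replace `v` by a Borel representative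
  obtain ⟨w, hw⟩ : ∃ w, w = hva.mk v := ⟨_, rfl⟩
  have hwm : Measurable w := hw ▸ hva.stronglyMeasurable_mk.measurable
  have hvw : v =ᵐ[volume] w := hw ▸ hva.ae_eq_mk
  have hwL : ∀ R : ℝ, MemLp w 2 ((volume : Measure (ℝ × E n)).restrict (Metric.closedBall 0 R)) :=
    fun R => (memLp_congr_ae (ae_restrict_of_ae hvw)).1 (hv _ (isCompact_closedBall _ _))
  have hwi : LocallyIntegrable w volume := by
    refine MemL2Loc.locallyIntegrable fun K hK => ?_
    exact (memLp_congr_ae (ae_restrict_of_ae hvw)).1 (hv K hK)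
  obtain ⟨η, hη0, hη⟩ : ∃ η : ℝ≥0∞, 0 < η ∧ (C : ℝ≥0∞) * η ≤ ε ^ 2 := by
    obtain ⟨a, ha0, ha⟩ := ENNReal.exists_pos_mul_lt (a := (C : ℝ≥0∞)) (b := ε ^ 2)
      ENNReal.coe_ne_top (pow_ne_zero 2 hε.ne')
    exact ⟨a, ha0, by rw [mul_comm]; exact ha.le⟩
  obtain ⟨δ₀, h0, -, h2⟩ := exists_lintegral_sub_translate_le hwm hwL (max T L) hη0
  refine ⟨δ₀, h0, fun ρ δ hδ hρ => ?_⟩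
  have e1 : ({z : ℝ × E n | ‖z.2‖ ≤ L}.indicator (mollify volume ρ v - v)) =ᵐ[periodMeasure T
      (nu A B f)] {z : ℝ × E n | ‖z.2‖ ≤ L}.indicator (mollify volume ρ w - w) := by
    rw [mollify_congr_ae hvw]
    filter_upwards [hac.ae_le hvw] with z hz
    simp only [Set.indicator, Pi.sub_apply, hz]
  rw [eLpNorm_congr_ae e1, ← (ENNReal.pow_right_strictMono two_ne_zero).le_iff_le, eLpNorm_two_sq]
  refine le_trans ?_ hη
  refine (lintegral_mono' hC le_rfl).trans ?_
  rw [lintegral_smul_measure, smul_eq_mul]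
  refine mul_le_mul_right ?_ _
  have e2 : ∀ z, ‖{z : ℝ × E n | ‖z.2‖ ≤ L}.indicator (mollify volume ρ w - w) z‖ₑ ^ 2 =
      {z : ℝ × E n | ‖z.2‖ ≤ L}.indicator (fun z => ‖w z - mollify volume ρ w z‖ₑ ^ 2) z := by
    intro z
    by_cases hz : z ∈ {z : ℝ × E n | ‖z.2‖ ≤ L}
    · rw [Set.indicator_of_mem hz, Set.indicator_of_mem hz, Pi.sub_apply, enorm_sub_rev]
    · rw [Set.indicator_of_notMem hz, Set.indicator_of_notMem hz]; simp
  simp only [e2]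
  rw [setLIntegral_indicator hms]
  refine (lintegral_mono_set ?_).trans
    (hρ.lintegral_sub_mollify_le hwi hwm (fun y hy => h2 y (hy.trans hδ)))
  rintro z ⟨hz1, hz2⟩
  rw [mem_closedBall_zero_iff, Prod.norm_def]
  refine max_le_max ?_ hz1
  rw [Real.norm_eq_abs, abs_of_pos hz2.1.1]
  exact hz2.1.2.le

lemma hasWeakDeriv_weakDeriv {u : ℝ × E n → ℝ} {e : ℝ × E n} (h : ∃ v, HasWeakDeriv u v e) :
    HasWeakDeriv u (weakDeriv e u) e := by
  rw [weakDeriv, dif_pos h]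
  exact h.choose_spec

lemma norm_clm_le_sum (ℓ : E n →L[ℝ] ℝ) : ‖ℓ‖ ≤ ∑ i, ‖ℓ (EuclideanSpace.single i 1)‖ := by
  refine ContinuousLinearMap.opNorm_le_bound _ (Finset.sum_nonneg fun _ _ => norm_nonneg _)
    fun x => ?_
  have hx : x = ∑ i, x i • (EuclideanSpace.single i 1 : E n) := by
    have := (EuclideanSpace.basisFun (Fin n) ℝ).sum_repr x
    simpa using this.symm
  have h1 : ℓ x = ∑ i, x i • ℓ (EuclideanSpace.single i 1) := by
    conv_lhs => rw [hx]
    rw [map_sum]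
    simp only [map_smul]
  rw [h1, Finset.sum_mul]
  refine (norm_sum_le _ _).trans (Finset.sum_le_sum fun i _ => ?_)
  rw [norm_smul, mul_comm]
  gcongr
  exact PiLp.norm_apply_le x i

end Weak

/-! ### Hölder continuity in time -/

section Holder

variable {n : ℕ} {A B : ℝ → E n →L[ℝ] E n} {f : ℝ → E n} {T : ℝ}

lemma Setting.exists_eLpNorm_volume_le (H : Setting A B f T) (L : ℝ) : ∃ C : ℝ≥0,
    ∀ {Y : Type} [NormedAddCommGroup Y] (g : ℝ × E n → Y),
      eLpNorm g 2 (volume.restrict (Set.Ioo 0 T ×ˢ Metric.closedBall 0 L)) ≤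
      C * eLpNorm g 2 (periodMeasure T (nu A B f)) := by
  obtain ⟨C, hC⟩ := H.exists_volume_le L
  refine ⟨C ^ (1 / (2 : ℝ≥0∞)).toReal, fun g => (eLpNorm_mono_measure _ hC).trans (le_of_eq ?_)⟩
  rw [eLpNorm_smul_measure_of_ne_top (by norm_num), smul_eq_mul,
    ENNReal.coe_rpow_of_nonneg _ ENNReal.toReal_nonneg]

lemma hasDerivAt_time {w : ℝ × E n → ℝ} (hw : ContDiff ℝ 1 w) (t : ℝ) (x : E n) :
    HasDerivAt (fun s => w (s, x)) (fderiv ℝ w (t, x) (1, 0)) t := by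
  have h1 : HasDerivAt (fun s : ℝ => (s, x)) (1, 0) t :=
    (hasDerivAt_id t).prodMk (hasDerivAt_const t x)
  have h2 := ((hw.differentiable one_ne_zero) (t, x)).hasFDerivAt
  exact h2.comp_hasDerivAt t h1

/-- If the time derivative of `w`, tested with `ψ`, is represented by a square integrable
function `q`, then `t ↦ ∫ w(t, x) ψ(x) dx` is Hölder continuous with exponent `1/2`, by the
Cauchy–Schwarz inequality on `(s, t) × {|x| ≤ L}`. -/
lemma abs_integral_sub_le {w : ℝ × E n → ℝ} (hw : ContDiff ℝ 1 w) {ψ : E n → ℝ}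
    (hψ : Continuous ψ) {L : ℝ} (h0 : ∀ x, L < ‖x‖ → ψ x = 0) {q : ℝ × E n → ℝ}
    (hq : Measurable q) (hq0 : ∀ z, L < ‖z.2‖ → q z = 0)
    (hwq : ∀ τ ∈ Set.Icc 0 T, ∫ x, fderiv ℝ w (τ, x) (1, 0) * ψ x = ∫ x, q (τ, x)) {D : ℝ≥0}
    (hD : eLpNorm q 2 (volume.restrict (Set.Ioo 0 T ×ˢ Metric.closedBall 0 L)) ≤ D) :
    ∀ s ∈ Set.Icc 0 T, ∀ t ∈ Set.Icc 0 T, |(∫ x, w (t, x) * ψ x) - ∫ x, w (s, x) * ψ x| ≤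
      D * √(volume.real (Metric.closedBall (0 : E n) L)) * √|t - s| := by
  have hψc : HasCompactSupport ψ :=
    HasCompactSupport.of_support_subset_isCompact (isCompact_closedBall (0 : E n) L) fun y hy => by
      rw [mem_closedBall_zero_iff]
      by_contra h'
      exact hy (h0 y (not_le.1 h'))
  have hwc := hw.continuous
  have hdc : Continuous fun z => fderiv ℝ w z (1, 0) :=
    (hw.continuous_fderiv one_ne_zero).clm_apply continuous_const
  have hint : ∀ t, Integrable fun x => w (t, x) * ψ x := fun t =>
    Continuous.integrable_of_hasCompactSupport (by fun_prop) hψc.mul_left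
  have key : ∀ s ∈ Set.Icc 0 T, ∀ t ∈ Set.Icc 0 T, s ≤ t →
      |(∫ x, w (t, x) * ψ x) - ∫ x, w (s, x) * ψ x| ≤
      D * √(volume.real (Metric.closedBall (0 : E n) L)) * √|t - s| := by
    intro s hs t ht hst
    have hsub : Set.uIoc s t ⊆ Set.Icc 0 T := by
      rw [Set.uIoc_of_le hst]
      exact fun τ hτ => ⟨hs.1.trans hτ.1.le, hτ.2.trans ht.2⟩
    have e1 : (∫ x, w (t, x) * ψ x) - ∫ x, w (s, x) * ψ x =
        ∫ τ in s..t, ∫ x, q (τ, x) := by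
      rw [← integral_sub (hint t) (hint s)]
      have e2 : ∀ x, w (t, x) * ψ x - w (s, x) * ψ x =
          ∫ τ in s..t, fderiv ℝ w (τ, x) (1, 0) * ψ x := fun x => by
        rw [intervalIntegral.integral_mul_const, intervalIntegral.integral_eq_sub_of_hasDerivAt
          (fun τ _ => hasDerivAt_time hw τ x)
          ((hdc.comp (by fun_prop : Continuous fun τ : ℝ => (τ, x))).intervalIntegrable _ _)]
        ring
      simp_rw [e2]
      rw [← intervalIntegral_integral_swap]
      · refine intervalIntegral.integral_congr_ae (Eventually.of_forall fun τ hτ => ?_)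
        exact hwq τ (hsub hτ)
      · have hc : Continuous fun z : ℝ × E n => fderiv ℝ w z (1, 0) * ψ z.2 := by fun_prop
        have h3 : IntegrableOn (fun z : ℝ × E n => fderiv ℝ w z (1, 0) * ψ z.2)
            (Set.uIoc s t ×ˢ Metric.closedBall 0 L) volume :=
          (hc.continuousOn.integrableOn_compact
            (isCompact_Icc.prod (isCompact_closedBall (0 : E n) L))).mono_set
            (Set.prod_mono hsub le_rfl)
        have h4 : IntegrableOn (fun z : ℝ × E n => fderiv ℝ w z (1, 0) * ψ z.2)
            (Set.uIoc s t ×ˢ Set.univ) volume := by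
          refine h3.of_forall_sdiff_eq_zero (measurableSet_uIoc.prod MeasurableSet.univ) ?_
          rintro z ⟨hz1, hz2⟩
          have : L < ‖z.2‖ := by
            by_contra h
            exact hz2 ⟨hz1.1, by simpa using h⟩
          rw [h0 _ this, mul_zero]
        rw [IntegrableOn, Measure.volume_eq_prod, ← Measure.prod_restrict,
          Measure.restrict_univ] at h4
        exact h4
    have hmp : Measurable fun z : ℝ × E n => ‖q z‖ₑ := hq.enorm
    have e3 : ‖∫ τ in s..t, ∫ x, q (τ, x)‖ₑ ≤ ∫⁻ z in Set.Ioo s t ×ˢ Metric.closedBall 0 L, ‖q z‖ₑ := by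
      rw [intervalIntegral.integral_of_le hst, integral_Ioc_eq_integral_Ioo,
        Measure.volume_eq_prod, ← Measure.prod_restrict, lintegral_prod _ hmp.aemeasurable]
      refine (enorm_integral_le_lintegral_enorm _).trans (lintegral_mono fun τ => ?_)
      refine (enorm_integral_le_lintegral_enorm _).trans (le_of_eq ?_)
      rw [← lintegral_indicator Metric.isClosed_closedBall.measurableSet]
      congr 1
      ext1 x
      by_cases hx : x ∈ Metric.closedBall (0 : E n) L
      · rw [Set.indicator_of_mem hx]
      · rw [Set.indicator_of_notMem hx, hq0, enorm_zero]
        simpa using hx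
    have e4 : ∫⁻ z in Set.Ioo s t ×ˢ Metric.closedBall 0 L, ‖q z‖ₑ ≤
        D * (ENNReal.ofReal (t - s) * volume (Metric.closedBall (0 : E n) L)) ^ (1 / 2 : ℝ) := by
      rw [← eLpNorm_one_eq_lintegral_enorm]
      refine (eLpNorm_le_eLpNorm_mul_rpow_measure_univ one_le_two hq.aestronglyMeasurable).trans ?_
      have e : (1 / (1 : ℝ≥0∞).toReal - 1 / (2 : ℝ≥0∞).toReal) = (1 / 2 : ℝ) := by norm_num
      rw [e, Measure.restrict_apply MeasurableSet.univ, Set.univ_inter, Measure.volume_eq_prod,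
        Measure.prod_prod, Real.volume_Ioo]
      gcongr
      refine (eLpNorm_mono_measure _ (Measure.restrict_mono ?_ le_rfl)).trans hD
      exact Set.prod_mono (Set.Ioo_subset_Ioo hs.1 ht.2) le_rfl
    have e5 : |∫ τ in s..t, ∫ x, q (τ, x)| = ‖∫ τ in s..t, ∫ x, q (τ, x)‖ₑ.toReal := by
      rw [toReal_enorm, Real.norm_eq_abs]
    have hV : volume (Metric.closedBall (0 : E n) L) ≠ ⊤ := measure_closedBall_lt_top.ne
    rw [e1, e5]
    refine (ENNReal.toReal_mono ?_ (e3.trans e4)).trans (le_of_eq ?_)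
    · exact ENNReal.mul_ne_top ENNReal.coe_ne_top (ENNReal.rpow_ne_top_of_nonneg (by norm_num)
        (ENNReal.mul_ne_top ENNReal.ofReal_ne_top hV))
    · rw [ENNReal.toReal_mul, ← ENNReal.toReal_rpow, ENNReal.toReal_mul,
        ENNReal.toReal_ofReal (sub_nonneg.2 hst), ← Real.sqrt_eq_rpow, Real.sqrt_mul
        (sub_nonneg.2 hst), abs_of_nonneg (sub_nonneg.2 hst), ENNReal.coe_toReal, measureReal_def]
      ring
  intro s hs t ht
  rcases le_total s t with h | h
  · exact key s hs t ht h
  · rw [abs_sub_comm, abs_sub_comm t s]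
    exact key t ht s hs h

/-- Functions of class `C¹` with time derivatives bounded in `L²(ν)` are equicontinuous in time. -/
lemma Setting.timeEquicontinuous (H : Setting A B f T) {w : ℕ → ℝ × E n → ℝ}
    (hw : ∀ k, ContDiff ℝ 1 (w k)) {M : ℝ≥0}
    (hM : ∀ k, l2Norm T (nu A B f) (fun z => fderiv ℝ (w k) z (1, 0)) ≤ M) :
    TimeEquicontinuous T w := by
  intro L
  obtain ⟨C, hC⟩ := H.exists_eLpNorm_volume_le L
  refine ⟨(L.toNNReal * (C * M) : ℝ≥0) * √(volume.real (Metric.closedBall (0 : E n) L)),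
    fun ψ h1 h2 h3 h4 k => ?_⟩
  have hdc : Continuous fun z => fderiv ℝ (w k) z (1, 0) :=
    ((hw k).continuous_fderiv one_ne_zero).clm_apply continuous_const
  have hψ := h1.continuous
  have hqc : Continuous fun z : ℝ × E n => fderiv ℝ (w k) z (1, 0) * ψ z.2 := by fun_prop
  refine abs_integral_sub_le (hw k) hψ h2 (q := fun z => fderiv ℝ (w k) z (1, 0) * ψ z.2)
    hqc.measurable (fun z hz => by simp only [h2 _ hz, mul_zero]) (fun τ _ => rfl) ?_
  refine (eLpNorm_le_nnreal_smul_eLpNorm_of_ae_le_mul (c := L.toNNReal)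
    (g := fun z => fderiv ℝ (w k) z (1, 0)) (Eventually.of_forall fun z => ?_) 2).trans ?_
  · rw [← NNReal.coe_le_coe]
    push_cast
    rw [norm_mul, mul_comm]
    gcongr
    rw [Real.coe_toNNReal']
    exact (h3 _).trans (le_max_left _ _)
  · rw [ENNReal.smul_def, smul_eq_mul]
    push_cast
    gcongr
    exact (hC _).trans (by gcongr; exact hM k)

end Holder

/-! ### Approximation in `H^{1,2}_#` and its compactness -/

section Sobolev

variable {n : ℕ} {A B : ℝ → E n →L[ℝ] E n} {f : ℝ → E n} {T : ℝ}

/-- Cutting off in space converges in `L²(ν)`. -/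
lemma tendsto_eLpNorm_cutoff {μ : Measure (ℝ × E n)} {u : ℝ × E n → ℝ} (hu : MemLp u 2 μ)
    {χ : ℕ → E n → ℝ} (hχ : ∀ k, Continuous (χ k)) (h1 : ∀ k y, |χ k y| ≤ 1)
    (h2 : ∀ k : ℕ, ∀ y, ‖y‖ ≤ k + 1 → χ k y = 1) :
    Tendsto (fun k => eLpNorm (fun z => χ k z.2 * u z - u z) 2 μ) atTop (𝓝 0) := by
  refine tendsto_zero_of_sq ?_
  simp only [eLpNorm_two_sq]
  have h0 : (0 : ℝ≥0∞) = ∫⁻ _, 0 ∂μ := by simp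
  rw [h0]
  have hm := hu.aestronglyMeasurable
  have hc : ∀ k, Continuous fun z : ℝ × E n => χ k z.2 := fun k => (hχ k).comp continuous_snd
  refine tendsto_lintegral_of_dominated_convergence' (fun z => (2 * ‖u z‖ₑ) ^ 2)
    (fun k => ?_) (fun k => Eventually.of_forall fun z => ?_) ?_ ?_
  · exact ((((hc k).aestronglyMeasurable.mul hm).sub hm).enorm.pow_const 2)
  · refine pow_le_pow_left' (?_ : ‖χ k z.2 * u z - u z‖ₑ ≤ 2 * ‖u z‖ₑ) 2
    refine (enorm_sub_le).trans ?_
    rw [two_mul, enorm_mul]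
    refine add_le_add ?_ le_rfl
    refine mul_le_of_le_one_left' ?_
    have := h1 k z.2
    rw [← ofReal_norm, Real.norm_eq_abs]
    exact ENNReal.ofReal_le_one.2 this
  · simp only [mul_pow]
    rw [lintegral_const_mul' _ _ (by finiteness), ← eLpNorm_two_sq]
    exact ENNReal.mul_ne_top (by finiteness) (ENNReal.pow_ne_top hu.2.ne)
  · refine Eventually.of_forall fun z => tendsto_const_nhds.congr' ?_
    obtain ⟨N, hN⟩ := exists_nat_ge ‖z.2‖
    filter_upwards [eventually_ge_atTop N] with k hk
    have : ‖z.2‖ ≤ k + 1 := hN.trans (by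
      have : (N : ℝ) ≤ k := by exact_mod_cast hk
      linarith)
    rw [h2 k _ this]
    simp

lemma l2Norm_le_of_abs_le {T : ℝ} {ν : Measure (ℝ × E n)} {g h : ℝ × E n → ℝ}
    (H : ∀ z, |g z| ≤ |h z|) : l2Norm T ν g ≤ l2Norm T ν h :=
  eLpNorm_mono fun z => H z

/-- Functions in `H^{1,2}_#` can be approximated in `L²(ν)` by functions of class `C¹`, with control
of the first derivatives: mollify, and cut off in space. -/
lemma Setting.exists_approx_h12 (H : Setting A B f T) : ∃ C : ℝ≥0, ∀ (u : ℝ × E n → ℝ) (N : ℝ≥0),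
    MemH12Sharp T (nu A B f) u → h12Norm T (nu A B f) u ≤ N → ∀ ε : ℝ≥0∞, 0 < ε → ε ≤ 1 →
    ∃ w : ℝ × E n → ℝ, ContDiff ℝ 1 w ∧ l2Norm T (nu A B f) (w - u) ≤ ε ∧
      l2Norm T (nu A B f) w ≤ C * (1 + N) ∧
      eLpNorm (dx w) 2 (periodMeasure T (nu A B f)) ≤ C * (1 + N) ∧
      l2Norm T (nu A B f) (fun z => fderiv ℝ w z (1, 0)) ≤ C * (1 + N) := by
  obtain ⟨χ, Cχ, hχ⟩ := exists_cutoff (E n)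
  refine ⟨1 + n + Cχ, fun u N hu hN ε hε hε1 => ?_⟩
  obtain ⟨⟨hloc, ⟨hexT, hlocT⟩, hlocX, -⟩, hu2, hut, hux, -⟩ := hu
  have hε2 : 0 < ε / 2 := ENNReal.div_pos hε.ne' (by simp)
  -- `u`, `∂ₜu` and `D_i u` as one finite family, to choose one mollifier for all of them
  obtain ⟨V, hV0, hV1, hVi⟩ : ∃ V : Option (Option (Fin n)) → ℝ × E n → ℝ,
      V none = u ∧ V (some none) = wdt u ∧ ∀ i, V (some (some i)) = wdx i u :=
    ⟨fun j => j.elim u fun j => j.elim (wdt u) fun i => wdx i u, rfl, rfl, fun _ => rfl⟩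
  have hV2 : ∀ j, MemL2Sharp T (nu A B f) (V j) := by
    rintro (_ | _ | i)
    exacts [hV0 ▸ hu2, hV1 ▸ hut, hVi i ▸ hux i]
  have hVloc : ∀ j, MemL2Loc (V j) := by
    rintro (_ | _ | i)
    exacts [hV0 ▸ hloc, hV1 ▸ hlocT, hVi i ▸ (hlocX i).2]
  have hVN : ∀ j, l2Norm T (nu A B f) (V j) ≤ N := by
    have h1 : l2Norm T (nu A B f) u + l2Norm T (nu A B f) (wdt u) +
        ∑ i, l2Norm T (nu A B f) (wdx i u) ≤ N := le_self_add.trans hN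
    rintro (_ | _ | i)
    · rw [hV0]
      exact (le_self_add.trans le_self_add).trans h1
    · rw [hV1]
      exact (le_add_self.trans le_self_add).trans h1
    · rw [hVi]
      exact ((Finset.single_le_sum (f := fun i => l2Norm T (nu A B f) (wdx i u))
        (fun _ _ => bot_le) (Finset.mem_univ i)).trans le_add_self).trans h1
  obtain ⟨k, hk⟩ := (ENNReal.tendsto_nhds_zero.1 (tendsto_eLpNorm_cutoff hu2.2.2
    (fun k => (hχ k).1.continuous) (fun k => (hχ k).2.2.1) (fun k => (hχ k).2.2.2.1)) _ hε2).exists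
  obtain ⟨hχs, hχc, hχ1, -, hχd⟩ := hχ k
  generalize χ k = χ at *
  obtain ⟨L, hL⟩ := hχc.isCompact.isBounded.subset_closedBall 0
  have hχ0 : ∀ x, L < ‖x‖ → x ∉ tsupport χ := fun x hx h => by
    have := hL h
    rw [mem_closedBall_zero_iff] at this
    linarith
  -- the cutoff is fixed first: the scale of the mollifier depends on the radius `L` of its support
  choose δ hδ0 hδ using fun j => H.exists_mollify_sub_le (hVloc j) L hε2
  obtain ⟨j₀, hj₀⟩ := Finite.exists_min δ
  obtain ⟨ρ, hρ⟩ := exists_isMollifier (volume : Measure (ℝ × E n)) (hδ0 j₀)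
  have hms : MeasurableSet {z : ℝ × E n | ‖z.2‖ ≤ L} :=
    measurableSet_le measurable_snd.norm measurable_const
  have hmol : ∀ j, l2Norm T (nu A B f)
      ({z : ℝ × E n | ‖z.2‖ ≤ L}.indicator (mollify volume ρ (V j) - V j)) ≤ ε / 2 := fun j =>
    hδ j ρ _ (hj₀ j) hρ
  have hcm : ∀ j, Continuous (mollify volume ρ (V j)) := fun j =>
    (hρ.contDiff_mollify (hVloc j).locallyIntegrable).continuous
  have hind : ∀ j, AEStronglyMeasurable ({z : ℝ × E n | ‖z.2‖ ≤ L}.indicator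
      (mollify volume ρ (V j))) (periodMeasure T (nu A B f)) := fun j =>
    ((hcm j).aestronglyMeasurable).indicator hms
  have hmol' : ∀ j, l2Norm T (nu A B f)
      ({z : ℝ × E n | ‖z.2‖ ≤ L}.indicator (mollify volume ρ (V j))) ≤ 1 + N := fun j => by
    have e : {z : ℝ × E n | ‖z.2‖ ≤ L}.indicator (mollify volume ρ (V j)) =
        {z : ℝ × E n | ‖z.2‖ ≤ L}.indicator (mollify volume ρ (V j) - V j) +
        {z : ℝ × E n | ‖z.2‖ ≤ L}.indicator (V j) := by
      rw [← Set.indicator_add', sub_add_cancel]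
    have hm := (hV2 j).2.2.aestronglyMeasurable
    rw [e]
    refine (eLpNorm_add_le (((hcm j).aestronglyMeasurable.sub hm).indicator hms)
      (hm.indicator hms) one_le_two).trans (add_le_add ?_ ?_)
    · exact (hmol j).trans (ENNReal.half_le_self.trans hε1)
    · exact (eLpNorm_indicator_le _).trans (hVN j)
  have hmu := hV0 ▸ hmol' none
  have hmi := fun i => hVi i ▸ hmol' (some (some i))
  have hindi := fun i => hVi i ▸ hind (some (some i))
  have hindu := hV0 ▸ hind none
  have hmol0 := hV0 ▸ hmol none
  have hmt' := hV1 ▸ hmol' (some none)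
  obtain ⟨m, hm⟩ : ∃ m, m = mollify volume ρ u := ⟨_, rfl⟩
  have hm1 : ContDiff ℝ 1 m := hm ▸ (hρ.contDiff_mollify hloc.locallyIntegrable).of_le (by simp)
  have hmt : ∀ z, fderiv ℝ m z (1, 0) = mollify volume ρ (wdt u) z := fun z =>
    hm ▸ hρ.fderiv_mollify (hasWeakDeriv_weakDeriv hexT) z
  have hmx : ∀ i z, dx m z (EuclideanSpace.single i 1) = mollify volume ρ (wdx i u) z :=
    fun i z => by
      rw [dx_eq hm1, ← hρ.fderiv_mollify (hasWeakDeriv_weakDeriv (hlocX i).1) z, ← hm]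
      rfl
  have hχs1 : ContDiff ℝ 1 χ := hχs.of_le (by simp)
  have hw : ContDiff ℝ 1 fun z : ℝ × E n => χ z.2 * m z := (hχs1.comp contDiff_snd).mul hm1
  -- a product with the cutoff is dominated by the restriction to the ball
  have hcut : ∀ g : ℝ × E n → ℝ, ∀ z, |χ z.2 * g z| ≤
      |{z : ℝ × E n | ‖z.2‖ ≤ L}.indicator g z| := fun g z => by
    by_cases hz : ‖z.2‖ ≤ L
    · rw [Set.indicator_of_mem (by exact hz), abs_mul]
      exact mul_le_of_le_one_left (abs_nonneg _) (hχ1 _)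
    · rw [image_eq_zero_of_notMem_tsupport (hχ0 _ (not_le.1 hz)), zero_mul, abs_zero]
      exact abs_nonneg _
  have hC1 : (1 : ℝ≥0∞) * (1 + N) ≤ ((1 + n + Cχ : ℝ≥0) : ℝ≥0∞) * (1 + N) := by
    gcongr
    push_cast
    rw [add_assoc]
    exact le_self_add
  rw [one_mul] at hC1
  refine ⟨_, hw, ?_, ?_, ?_, ?_⟩
  · have e : ((fun z : ℝ × E n => χ z.2 * m z) - u) =
        (fun z => χ z.2 * (m - u) z) + fun z => χ z.2 * u z - u z := by
      ext1 z; simp only [Pi.sub_apply, Pi.add_apply]; ring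
    have hum := hu2.2.2.aestronglyMeasurable
    have hχm : AEStronglyMeasurable (fun z : ℝ × E n => χ z.2) (periodMeasure T (nu A B f)) :=
      (hχs.continuous.comp continuous_snd).aestronglyMeasurable
    rw [e, ← ENNReal.add_halves ε]
    refine (eLpNorm_add_le (hχm.mul (hm1.continuous.aestronglyMeasurable.sub hum))
      ((hχm.mul hum).sub hum) one_le_two).trans (add_le_add ?_ hk)
    refine (l2Norm_le_of_abs_le (hcut _)).trans ?_
    rw [hm]
    exact hmol0
  · refine (l2Norm_le_of_abs_le (hcut m)).trans (le_trans ?_ hC1)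
    rw [hm]
    exact hmu
  · have hd : ∀ z, ‖dx (fun z : ℝ × E n => χ z.2 * m z) z‖ ≤
        ∑ i, |{z : ℝ × E n | ‖z.2‖ ≤ L}.indicator (mollify volume ρ (wdx i u)) z| +
        Cχ * |{z : ℝ × E n | ‖z.2‖ ≤ L}.indicator m z| := fun z => by
      have e : dx (fun z : ℝ × E n => χ z.2 * m z) z =
          χ z.2 • dx m z + m z • fderiv ℝ χ z.2 :=
        fderiv_fun_mul ((hχs1.differentiable one_ne_zero) _)
          (((contDiff_slice hm1 z.1).differentiable one_ne_zero) _)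
      rw [e]
      by_cases hz : ‖z.2‖ ≤ L
      · refine (norm_add_le _ _).trans (add_le_add ?_ ?_)
        · rw [norm_smul]
          refine (mul_le_of_le_one_left (norm_nonneg _) (hχ1 _)).trans ?_
          refine (norm_clm_le_sum _).trans (Finset.sum_le_sum fun i _ => ?_)
          rw [hmx, Set.indicator_of_mem (by exact hz), Real.norm_eq_abs]
        · rw [norm_smul, Set.indicator_of_mem (by exact hz), mul_comm, Real.norm_eq_abs]
          gcongr
          exact hχd _
      · have h1 := hχ0 _ (not_le.1 hz)
        rw [image_eq_zero_of_notMem_tsupport h1, image_eq_zero_of_notMem_tsupport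
          (fun h => h1 (tsupport_fderiv_subset ℝ h)), zero_smul, smul_zero, add_zero, norm_zero]
        positivity
    refine (eLpNorm_mono_real hd).trans ?_
    have hind0 : AEStronglyMeasurable (fun z => |{z : ℝ × E n | ‖z.2‖ ≤ L}.indicator m z|)
        (periodMeasure T (nu A B f)) := by
      rw [hm]; exact hindu.norm
    have hindi' : ∀ i, AEStronglyMeasurable (fun z => |{z : ℝ × E n | ‖z.2‖ ≤ L}.indicator
        (mollify volume ρ (wdx i u)) z|) (periodMeasure T (nu A B f)) :=
      fun i => (hindi i).norm
    have e1 : (fun z => ∑ i, |{z : ℝ × E n | ‖z.2‖ ≤ L}.indicator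
        (mollify volume ρ (wdx i u)) z| + Cχ * |{z : ℝ × E n | ‖z.2‖ ≤ L}.indicator m z|) =
        (∑ i, fun z => |{z : ℝ × E n | ‖z.2‖ ≤ L}.indicator (mollify volume ρ (wdx i u)) z|) +
        (Cχ : ℝ) • fun z => |{z : ℝ × E n | ‖z.2‖ ≤ L}.indicator m z| := by
      ext1 z; simp
    rw [e1]
    refine (eLpNorm_add_le (Finset.aestronglyMeasurable_sum _ fun i _ => hindi' i)
      (hind0.const_smul _) one_le_two).trans ?_
    have e2 : ((1 + n + Cχ : ℝ≥0) : ℝ≥0∞) * (1 + N) =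
        (n : ℝ≥0∞) * (1 + N) + Cχ * (1 + N) + (1 + N) := by push_cast; ring
    rw [e2]
    refine le_trans (add_le_add ?_ ?_) le_self_add
    · refine (eLpNorm_sum_le (fun i _ => hindi' i) one_le_two).trans ?_
      refine (Finset.sum_le_card_nsmul _ _ (1 + N : ℝ≥0∞) fun i _ => ?_).trans ?_
      · exact (l2Norm_le_of_abs_le fun z => (abs_abs _).le).trans (hmi i)
      · rw [Finset.card_univ, Fintype.card_fin, nsmul_eq_mul]
    · rw [eLpNorm_const_smul]
      refine mul_le_mul' (by simp [Real.enorm_of_nonneg]) ?_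
      refine (l2Norm_le_of_abs_le fun z => (abs_abs _).le).trans ?_
      rw [hm]
      exact hmu
  · have e : (fun z : ℝ × E n => fderiv ℝ (fun z : ℝ × E n => χ z.2 * m z) z (1, 0)) =
        fun z => χ z.2 * mollify volume ρ (wdt u) z := by
      ext1 z
      have h1 : HasFDerivAt (fun z : ℝ × E n => χ z.2)
          ((fderiv ℝ χ z.2).comp (ContinuousLinearMap.snd ℝ ℝ (E n))) z :=
        ((hχs1.differentiable one_ne_zero) z.2).hasFDerivAt.comp z hasFDerivAt_snd
      rw [fderiv_fun_mul h1.differentiableAt ((hm1.differentiable one_ne_zero) z), h1.fderiv,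
        ← hmt]
      simp
    rw [e]
    exact ((l2Norm_le_of_abs_le (hcut _)).trans hmt').trans hC1

theorem Setting.compactlyEmbedded_h12 (H : Setting A B f T) :
    CompactlyEmbedded T (nu A B f) {u | MemH12Sharp T (nu A B f) u} (h12Norm T (nu A B f)) := by
  refine ⟨fun u hu => hu.2.1, ⟨1, fun u _ => ?_⟩, fun u hu ⟨N, hN⟩ => ?_⟩
  · rw [ENNReal.coe_one, one_mul, h12Norm, add_assoc, add_assoc]
    exact le_self_add
  · obtain ⟨C, hC⟩ := H.exists_approx_h12
    choose w hw1 hw2 hw3 hw4 hw5 using fun k : ℕ => hC (u k) N (hu k) (hN k)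
      ((k : ℝ≥0∞) + 1)⁻¹ (by simp) (ENNReal.inv_le_one.2 le_add_self)
    refine H.exists_subseq_tendsto (M := C * (1 + N)) hw1 (fun k => by simpa using hw3 k)
      (fun k => by simpa using hw4 k) (H.timeEquicontinuous hw1 (M := C * (1 + N))
      (fun k => by simpa using hw5 k)) (fun k => (hu k).2.1) ?_
    refine tendsto_of_tendsto_of_tendsto_of_le_of_le tendsto_const_nhds ?_ (fun _ => bot_le) hw2
    have h := (tendsto_add_atTop_iff_nat (f := fun k : ℕ => (k : ℝ≥0∞)⁻¹) 1).2
      ENNReal.tendsto_inv_nat_nhds_zero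
    simpa using h

end Sobolev

/-! ### Calculus for the Kolmogorov operator -/

section Diffusion

variable {F : Type*} [NormedAddCommGroup F] [InnerProductSpace ℝ F] [FiniteDimensional ℝ F]

/-- The spatial part `½ Tr(C D²v) + ⟨b, Dv⟩` of the Kolmogorov operator at a fixed time. -/
def diffusion (C : F →L[ℝ] F) (b : F) (v : F → ℝ) (x : F) : ℝ :=
  (1 / 2 : ℝ) * LinearMap.trace ℝ F (C * fderiv ℝ (gradient v) x : F →L[ℝ] F).toLinearMap +
    ⟪b, gradient v x⟫_ℝ

lemma gradient_eq_toDual_symm (v : F → ℝ) :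
    gradient v = fun x => (InnerProductSpace.toDual ℝ F).symm (fderiv ℝ v x) := rfl

lemma norm_gradient (v : F → ℝ) (x : F) : ‖gradient v x‖ = ‖fderiv ℝ v x‖ :=
  (InnerProductSpace.toDual ℝ F).symm.norm_map _

lemma contDiff_gradient {v : F → ℝ} (hv : ContDiff ℝ 2 v) : ContDiff ℝ 1 (gradient v) :=
  (InnerProductSpace.toDual ℝ F).symm.toContinuousLinearEquiv.toContinuousLinearMap.contDiff.comp
    (hv.fderiv_right (m := 1) (by norm_num))

lemma gradient_fun_add {v w : F → ℝ} (hv : Differentiable ℝ v) (hw : Differentiable ℝ w) :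
    gradient (fun x => v x + w x) = fun x => gradient v x + gradient w x := by
  ext1 x
  simp only [gradient_eq_toDual_symm]
  rw [fderiv_fun_add (hv x) (hw x), map_add]

lemma gradient_fun_mul {v w : F → ℝ} (hv : Differentiable ℝ v) (hw : Differentiable ℝ w) :
    gradient (fun x => v x * w x) = fun x => v x • gradient w x + w x • gradient v x := by
  ext1 x
  simp only [gradient_eq_toDual_symm]
  rw [fderiv_fun_mul (hv x) (hw x), map_add]
  simp only [map_smulₛₗ, RCLike.conj_to_real]

lemma gradient_const_mul (c : ℝ) {v : F → ℝ} (hv : Differentiable ℝ v) :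
    gradient (fun x => c * v x) = fun x => c • gradient v x := by
  ext1 x
  simp only [gradient_eq_toDual_symm]
  rw [fderiv_const_mul (hv x)]
  simp only [map_smulₛₗ, RCLike.conj_to_real]

lemma trace_mul_smulRight (C : F →L[ℝ] F) (ℓ : F →L[ℝ] ℝ) (y : F) :
    LinearMap.trace ℝ F (C * ℓ.smulRight y : F →L[ℝ] F).toLinearMap = ℓ (C y) := by
  have h : (C * ℓ.smulRight y : F →L[ℝ] F).toLinearMap = ℓ.toLinearMap.smulRight (C y) := by
    ext x
    simp
  rw [h, LinearMap.trace_smulRight]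
  rfl

omit [FiniteDimensional ℝ F] in
lemma trace_mul_add (C L M : F →L[ℝ] F) :
    LinearMap.trace ℝ F (C * (L + M) : F →L[ℝ] F).toLinearMap =
      LinearMap.trace ℝ F (C * L : F →L[ℝ] F).toLinearMap +
      LinearMap.trace ℝ F (C * M : F →L[ℝ] F).toLinearMap := by
  rw [mul_add, ContinuousLinearMap.toLinearMap_add, map_add]

omit [FiniteDimensional ℝ F] in
lemma trace_mul_smul (C L : F →L[ℝ] F) (c : ℝ) :
    LinearMap.trace ℝ F (C * (c • L) : F →L[ℝ] F).toLinearMap =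
      c * LinearMap.trace ℝ F (C * L : F →L[ℝ] F).toLinearMap := by
  rw [mul_smul_comm, ContinuousLinearMap.toLinearMap_smul, map_smul, smul_eq_mul]

lemma diffusion_add (C : F →L[ℝ] F) (b : F) {v w : F → ℝ} (hv : ContDiff ℝ 2 v)
    (hw : ContDiff ℝ 2 w) (x : F) :
    diffusion C b (fun x => v x + w x) x = diffusion C b v x + diffusion C b w x := by
  have h1 := (contDiff_gradient hv).differentiable one_ne_zero x
  have h2 := (contDiff_gradient hw).differentiable one_ne_zero x
  rw [diffusion, diffusion, diffusion, gradient_fun_add (hv.differentiable two_ne_zero)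
    (hw.differentiable two_ne_zero), fderiv_fun_add h1 h2, trace_mul_add, inner_add_right]
  ring

lemma diffusion_const_mul (C : F →L[ℝ] F) (b : F) (c : ℝ) {v : F → ℝ} (hv : ContDiff ℝ 2 v)
    (x : F) : diffusion C b (fun x => c * v x) x = c * diffusion C b v x := by
  have h1 := (contDiff_gradient hv).differentiable one_ne_zero x
  rw [diffusion, diffusion, gradient_const_mul c (hv.differentiable two_ne_zero),
    fderiv_fun_const_smul h1, trace_mul_smul, real_inner_smul_right]
  ring

lemma fderiv_eq_innerSL_gradient (v : F → ℝ) (x y : F) : fderiv ℝ v x y = ⟪gradient v x, y⟫_ℝ := by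
  rw [inner_gradient_left]

/-- The square field identity `L(v²) = 2 v L v + |S* Dv|²` for `L = ½ Tr(S S* D²) + ⟨b, D⟩`. -/
lemma diffusion_mul_self (S : F →L[ℝ] F) (b : F) {v : F → ℝ} (hv : ContDiff ℝ 2 v) (x : F) :
    diffusion (S * ContinuousLinearMap.adjoint S) b (fun x => v x * v x) x =
      2 * (v x * diffusion (S * ContinuousLinearMap.adjoint S) b v x) +
        ‖ContinuousLinearMap.adjoint S (gradient v x)‖ ^ 2 := by
  have hd := hv.differentiable two_ne_zero
  have h1 := (contDiff_gradient hv).differentiable one_ne_zero x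
  have h2 : HasFDerivAt (fun x => v x • gradient v x + v x • gradient v x)
      ((2 : ℝ) • (v x • fderiv ℝ (gradient v) x + (fderiv ℝ v x).smulRight (gradient v x))) x := by
    have h3 := (hd x).hasFDerivAt.smul h1.hasFDerivAt
    refine (h3.add h3).congr_fderiv ?_
    rw [two_smul]
  have h4 : ‖ContinuousLinearMap.adjoint S (gradient v x)‖ ^ 2 =
      fderiv ℝ v x ((S * ContinuousLinearMap.adjoint S) (gradient v x)) := by
    rw [fderiv_eq_innerSL_gradient, mul_apply_eq_comp, ← ContinuousLinearMap.adjoint_inner_left,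
      real_inner_self_eq_norm_sq]
  rw [diffusion, diffusion, gradient_fun_mul hd hd, h2.fderiv, trace_mul_smul, trace_mul_add,
    trace_mul_smul, trace_mul_smulRight, ← h4, inner_add_right, real_inner_smul_right]
  ring

omit [FiniteDimensional ℝ F] in
lemma contDiff_const_mul_cos (c : ℝ) (h : F) (a : ℝ) {k : WithTop ℕ∞} :
    ContDiff ℝ k fun x : F => c * Real.cos (⟪x, h⟫_ℝ + a) :=
  contDiff_const.mul (Real.contDiff_cos.comp
    ((contDiff_id.inner ℝ contDiff_const).add contDiff_const))

omit [FiniteDimensional ℝ F] in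
lemma hasFDerivAt_inner_add (h : F) (a : ℝ) (x : F) :
    HasFDerivAt (fun x : F => ⟪x, h⟫_ℝ + a) (innerSL ℝ h) x := by
  have e : (fun x : F => ⟪x, h⟫_ℝ + a) = fun x => innerSL ℝ h x + a := by
    ext1 x; rw [innerSL_apply_apply, real_inner_comm]
  rw [e]
  exact (innerSL ℝ h).hasFDerivAt.add_const a

lemma gradient_const_mul_cos (c : ℝ) (h : F) (a : ℝ) :
    gradient (fun x : F => c * Real.cos (⟪x, h⟫_ℝ + a)) =
      fun x => -(c * Real.sin (⟪x, h⟫_ℝ + a)) • h := by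
  ext1 x
  refine HasGradientAt.gradient ?_
  rw [hasGradientAt_iff_hasFDerivAt]
  refine ((hasFDerivAt_inner_add h a x).cos.const_mul c).congr_fderiv ?_
  ext y
  simp only [smul_apply, innerSL_apply_apply, InnerProductSpace.toDual_apply_apply,
    real_inner_smul_left, smul_eq_mul]
  ring

lemma diffusion_const_mul_cos (C : F →L[ℝ] F) (b : F) (c : ℝ) (h : F) (a : ℝ) (x : F) :
    diffusion C b (fun x : F => c * Real.cos (⟪x, h⟫_ℝ + a)) x =
      -(1 / 2 * (c * ⟪h, C h⟫_ℝ)) * Real.cos (⟪x, h⟫_ℝ + a) -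
        c * ⟪b, h⟫_ℝ * Real.sin (⟪x, h⟫_ℝ + a) := by
  have h2 : HasFDerivAt (fun x : F => -(c * Real.sin (⟪x, h⟫_ℝ + a)) • h)
      (-(c * Real.cos (⟪x, h⟫_ℝ + a)) • (innerSL ℝ h).smulRight h) x := by
    refine ((((hasFDerivAt_inner_add h a x).sin.const_mul c).neg).smul_const h).congr_fderiv ?_
    ext y
    simp only [smul_apply, neg_apply, ContinuousLinearMap.smulRight_apply, innerSL_apply_apply,
      smul_eq_mul, smul_smul]
    congr 1
    ring
  rw [diffusion, gradient_const_mul_cos, h2.fderiv, trace_mul_smul, trace_mul_smulRight,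
    innerSL_apply_apply, real_inner_smul_right]
  ring

end Diffusion

section DiffusionParts

variable {F : Type*} [NormedAddCommGroup F] [InnerProductSpace ℝ F] [FiniteDimensional ℝ F]
  [MeasurableSpace F] [BorelSpace F]

/-- Integration by parts for the second order term, with a constant matrix `C`. -/
lemma integral_trace_mul_eq (C : F →L[ℝ] F) {v ψ : F → ℝ} (hv : ContDiff ℝ 2 v)
    (hψ : ContDiff ℝ 1 ψ) (hs : HasCompactSupport ψ) :
    ∫ x, LinearMap.trace ℝ F (C * fderiv ℝ (gradient v) x : F →L[ℝ] F).toLinearMap * ψ x =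
      -∫ x, fderiv ℝ ψ x (C (gradient v x)) := by
  have hg := contDiff_gradient hv
  have hgc := hg.continuous
  have hfc := hg.continuous_fderiv one_ne_zero
  have hψc := hψ.continuous
  have hψd := hψ.continuous_fderiv one_ne_zero
  let e := stdOrthonormalBasis ℝ F
  have hfd : ∀ i x, HasFDerivAt (fun y => ⟪e i, C (gradient v y)⟫_ℝ)
      ((innerSL ℝ (e i)).comp (C.comp (fderiv ℝ (gradient v) x))) x := fun i x => by
    have h1 : HasFDerivAt (fun y => C (gradient v y)) (C.comp (fderiv ℝ (gradient v) x)) x :=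
      C.hasFDerivAt.comp x ((hg.differentiable one_ne_zero) x).hasFDerivAt
    exact (innerSL ℝ (e i)).hasFDerivAt.comp x h1
  have h1 : ∀ x, LinearMap.trace ℝ F (C * fderiv ℝ (gradient v) x : F →L[ℝ] F).toLinearMap * ψ x =
      ∑ i, fderiv ℝ (fun y => ⟪e i, C (gradient v y)⟫_ℝ) x (e i) * ψ x := fun x => by
    rw [LinearMap.trace_eq_sum_inner _ e, Finset.sum_mul]
    refine Finset.sum_congr rfl fun i _ => ?_
    rw [(hfd i x).fderiv]
    rfl
  have h2 : ∀ x, fderiv ℝ ψ x (C (gradient v x)) =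
      ∑ i, ⟪e i, C (gradient v x)⟫_ℝ * fderiv ℝ ψ x (e i) := fun x => by
    conv_lhs => rw [← e.sum_repr' (C (gradient v x)), map_sum]
    simp only [map_smul, smul_eq_mul]
  have hc : ∀ i, Continuous fun y => ⟪e i, C (gradient v y)⟫_ℝ := fun i => by fun_prop
  have hc' : ∀ i, Continuous fun x => fderiv ℝ (fun y => ⟪e i, C (gradient v y)⟫_ℝ) x (e i) :=
    fun i => by
      simp only [fun x => (hfd i x).fderiv]
      fun_prop
  have hi1 : ∀ i, Integrable fun x => fderiv ℝ (fun y => ⟪e i, C (gradient v y)⟫_ℝ) x (e i) * ψ x :=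
    fun i => ((hc' i).mul hψc).integrable_of_hasCompactSupport hs.mul_left
  have hi2 : ∀ i, Integrable fun x => ⟪e i, C (gradient v x)⟫_ℝ * fderiv ℝ ψ x (e i) := fun i =>
    ((hc i).mul (by fun_prop)).integrable_of_hasCompactSupport (hs.fderiv_apply ℝ (e i)).mul_left
  have hi3 : ∀ i, Integrable fun x => ⟪e i, C (gradient v x)⟫_ℝ * ψ x := fun i =>
    ((hc i).mul hψc).integrable_of_hasCompactSupport hs.mul_left
  simp only [h1, h2]
  rw [integral_finsetSum _ fun i _ => hi1 i, integral_finsetSum _ fun i _ => hi2 i,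
    ← Finset.sum_neg_distrib]
  refine Finset.sum_congr rfl fun i _ => ?_
  rw [integral_mul_fderiv_eq_neg_fderiv_mul_of_integrable (hi1 i) (hi2 i) (hi3 i)
    (fun x _ => (hfd i x).differentiableAt) (fun x _ => (hψ.differentiable one_ne_zero) x), neg_neg]

end DiffusionParts

section Kolmogorov

variable {n : ℕ} {A B : ℝ → E n →L[ℝ] E n} {f : ℝ → E n} {T : ℝ}

lemma kolmogorov_eq (u : ℝ × E n → ℝ) (z : ℝ × E n) : kolmogorov A B f u z =
    deriv (fun s => u (s, z.2)) z.1 + diffusion (B z.1 * ContinuousLinearMap.adjoint (B z.1))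
      (A z.1 z.2 + f z.1) (fun x => u (z.1, x)) z.2 :=
  add_assoc _ _ _

/-- `u` is jointly of class `C¹`, and of class `C²` in the space variable. -/
structure IsC12 (u : ℝ × E n → ℝ) : Prop where
  contDiff : ContDiff ℝ 1 u
  contDiff_slice : ∀ t, ContDiff ℝ 2 fun x => u (t, x)

lemma IsC12.add {u v : ℝ × E n → ℝ} (hu : IsC12 u) (hv : IsC12 v) : IsC12 (u + v) :=
  ⟨hu.1.add hv.1, fun t => (hu.2 t).add (hv.2 t)⟩

lemma IsC12.const_smul {u : ℝ × E n → ℝ} (hu : IsC12 u) (c : ℝ) : IsC12 (c • u) :=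
  ⟨hu.1.const_smul c, fun t => (hu.2 t).const_smul c⟩

lemma IsC12.kolmogorov_add {u v : ℝ × E n → ℝ} (hu : IsC12 u) (hv : IsC12 v) (z : ℝ × E n) :
    kolmogorov A B f (u + v) z = kolmogorov A B f u z + kolmogorov A B f v z := by
  have h1 := ((hasDerivAt_time hu.1 z.1 z.2).add (hasDerivAt_time hv.1 z.1 z.2)).deriv
  have h2 := diffusion_add (B z.1 * ContinuousLinearMap.adjoint (B z.1)) (A z.1 z.2 + f z.1)
    (hu.2 z.1) (hv.2 z.1) z.2
  rw [kolmogorov_eq, kolmogorov_eq, kolmogorov_eq, (hasDerivAt_time hu.1 z.1 z.2).deriv,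
    (hasDerivAt_time hv.1 z.1 z.2).deriv]
  refine (congrArg₂ (· + ·) h1 h2).trans ?_
  ring

lemma IsC12.kolmogorov_const_smul {u : ℝ × E n → ℝ} (hu : IsC12 u) (c : ℝ) (z : ℝ × E n) :
    kolmogorov A B f (c • u) z = c * kolmogorov A B f u z := by
  have h1 := ((hasDerivAt_time hu.1 z.1 z.2).const_mul c).deriv
  have h2 := diffusion_const_mul (B z.1 * ContinuousLinearMap.adjoint (B z.1)) (A z.1 z.2 + f z.1)
    c (hu.2 z.1) z.2
  rw [kolmogorov_eq, kolmogorov_eq, (hasDerivAt_time hu.1 z.1 z.2).deriv]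
  refine (congrArg₂ (· + ·) h1 h2).trans ?_
  ring

/-- The square field identity `𝒢(u²) = 2 u 𝒢u + |B* Dₓu|²`. -/
lemma IsC12.kolmogorov_mul_self {u : ℝ × E n → ℝ} (hu : IsC12 u) (z : ℝ × E n) :
    kolmogorov A B f (u * u) z = 2 * (u z * kolmogorov A B f u z) +
      ‖ContinuousLinearMap.adjoint (B z.1) (gradient (fun x => u (z.1, x)) z.2)‖ ^ 2 := by
  have h1 := ((hasDerivAt_time hu.1 z.1 z.2).mul (hasDerivAt_time hu.1 z.1 z.2)).deriv
  have h2 := diffusion_mul_self (B z.1) (A z.1 z.2 + f z.1) (hu.2 z.1) z.2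
  rw [kolmogorov_eq, kolmogorov_eq, (hasDerivAt_time hu.1 z.1 z.2).deriv]
  refine (congrArg₂ (· + ·) h1 h2).trans ?_
  ring

/-- The function `Φ(t) cos(⟨x, h(t)⟩ + a)`. The phase `a` covers the sine as well. -/
def trigWave (Φ : ℝ → ℝ) (h : ℝ → E n) (a : ℝ) (z : ℝ × E n) : ℝ :=
  Φ z.1 * Real.cos (⟪z.2, h z.1⟫_ℝ + a)

lemma isC12_trigWave {Φ : ℝ → ℝ} {h : ℝ → E n} (hΦ : ContDiff ℝ 1 Φ) (hh : ContDiff ℝ 1 h)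
    (a : ℝ) : IsC12 (trigWave Φ h a) :=
  ⟨(hΦ.comp contDiff_fst).mul (Real.contDiff_cos.comp
    ((contDiff_snd.inner ℝ (hh.comp contDiff_fst)).add contDiff_const)),
    fun t => contDiff_const_mul_cos (Φ t) (h t) a⟩

/-- On a wave `Φ cos(⟨x, h⟩ + a)` the operator `𝒢` has coefficients that depend on `t` only, except
for one factor linear in `x`. -/
lemma kolmogorov_trigWave {Φ : ℝ → ℝ} {h : ℝ → E n} (hΦ : ContDiff ℝ 1 Φ) (hh : ContDiff ℝ 1 h)
    (a : ℝ) (z : ℝ × E n) : kolmogorov A B f (trigWave Φ h a) z =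
      (deriv Φ z.1 - 1 / 2 * (Φ z.1 *
        ⟪h z.1, B z.1 (ContinuousLinearMap.adjoint (B z.1) (h z.1))⟫_ℝ)) *
        Real.cos (⟪z.2, h z.1⟫_ℝ + a) -
      (⟪z.2, Φ z.1 • (deriv h z.1 + ContinuousLinearMap.adjoint (A z.1) (h z.1))⟫_ℝ +
        Φ z.1 * ⟪f z.1, h z.1⟫_ℝ) * Real.sin (⟪z.2, h z.1⟫_ℝ + a) := by
  have e1 : HasDerivAt Φ (deriv Φ z.1) z.1 := ((hΦ.differentiable one_ne_zero) z.1).hasDerivAt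
  have e2 : HasDerivAt h (deriv h z.1) z.1 := ((hh.differentiable one_ne_zero) z.1).hasDerivAt
  have e3 : HasDerivAt (fun s => ⟪z.2, h s⟫_ℝ + a) ⟪z.2, deriv h z.1⟫_ℝ z.1 :=
    ((innerSL ℝ z.2).hasFDerivAt.comp_hasDerivAt z.1 e2).add_const a
  have h1 := (e1.mul e3.cos).deriv
  have h2 := diffusion_const_mul_cos (B z.1 * ContinuousLinearMap.adjoint (B z.1))
    (A z.1 z.2 + f z.1) (Φ z.1) (h z.1) a z.2
  rw [kolmogorov_eq]
  refine (congrArg₂ (· + ·) h1 h2).trans ?_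
  rw [real_inner_smul_right, inner_add_right, inner_add_left,
    ContinuousLinearMap.adjoint_inner_right, mul_apply_eq_comp]
  ring

end Kolmogorov

/-! ### Infinitesimal invariance of `ν` -/

section Invariance

variable {n : ℕ} {A B : ℝ → E n →L[ℝ] E n} {f : ℝ → E n} {T : ℝ}

/-- The periodic measure as the image of a product measure, which allows the use of Fubini's
theorem for the Bochner integral. -/
lemma Setting.periodMeasure_eq_map (H : Setting A B f T) : periodMeasure T (nu A B f) =
    (ENNReal.ofReal T)⁻¹ • (((volume : Measure ℝ).restrict (Set.Ioo 0 T)).prod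
      (stdGaussian (E n))).map fun z => (z.1, meanVec A f z.1 + sqrtCov A B z.1 z.2) := by
  have hS := H.continuous_sqrtCov
  have hg := H.continuous_meanVec
  have hm : Measurable fun z : ℝ × E n => (z.1, meanVec A f z.1 + sqrtCov A B z.1 z.2) :=
    Continuous.measurable (by fun_prop)
  refine Measure.ext_of_lintegral _ fun F hF => ?_
  rw [H.lintegral_periodMeasure hF, lintegral_smul_measure, lintegral_map hF hm,
    lintegral_prod (fun z : ℝ × E n => F (z.1, meanVec A f z.1 + sqrtCov A B z.1 z.2))
    (hF.comp hm).aemeasurable, smul_eq_mul]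
  congr 2
  ext1 t
  rw [nuAt_eq_map]
  exact lintegral_map (hF.comp measurable_prodMk_left) (by fun_prop)

lemma Setting.integral_periodMeasure (H : Setting A B f T) {F : ℝ × E n → ℝ} (hF : Continuous F)
    (hi : Integrable F (periodMeasure T (nu A B f))) : ∫ z, F z ∂(periodMeasure T (nu A B f)) =
      T⁻¹ * ∫ t in 0..T, ∫ x, F (t, x) ∂(nuAt A B f t) := by
  have hS := H.continuous_sqrtCov
  have hg := H.continuous_meanVec
  have hm : Measurable fun z : ℝ × E n => (z.1, meanVec A f z.1 + sqrtCov A B z.1 z.2) :=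
    Continuous.measurable (by fun_prop)
  have hT := H.pos
  rw [H.periodMeasure_eq_map] at hi ⊢
  rw [integrable_smul_measure (by simp) (by simpa using hT),
    integrable_map_measure hF.aestronglyMeasurable hm.aemeasurable] at hi
  rw [integral_smul_measure, integral_map hm.aemeasurable hF.aestronglyMeasurable,
    ENNReal.toReal_inv, ENNReal.toReal_ofReal hT.le, smul_eq_mul,
    integral_prod (fun z : ℝ × E n => F (z.1, meanVec A f z.1 + sqrtCov A B z.1 z.2)) hi,
    intervalIntegral.integral_of_le hT.le, integral_Ioc_eq_integral_Ioo]
  congr 2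
  ext1 t
  rw [nuAt_eq_map, integral_map (by fun_prop) (by fun_prop)]

instance (t : ℝ) : IsGaussian (nuAt A B f t) :=
  inferInstanceAs (IsGaussian (multivariateGaussian _ _))

lemma integrable_norm_nuAt (t : ℝ) : Integrable (fun x => ‖x‖) (nuAt A B f t) :=
  IsGaussian.integrable_id.norm

/-- The real part of the characteristic function of `ν_t`, with a phase. -/
lemma Setting.integral_cos_nuAt (H : Setting A B f T) (t : ℝ) (h : E n) (a : ℝ) :
    ∫ x, Real.cos (⟪x, h⟫_ℝ + a) ∂(nuAt A B f t) =
      Real.cos (⟪meanVec A f t, h⟫_ℝ + a) * Real.exp (-(1 / 2) * ⟪h, covOp A B t h⟫_ℝ) := by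
  have h1 : charFun (nuAt A B f t) h =
      Complex.exp (⟪h, meanVec A f t⟫_ℝ * Complex.I - (⟪h, covOp A B t h⟫_ℝ : ℝ) / 2) := by
    rw [nuAt, charFun_multivariateGaussian (H.posSemidef_covMatrix t), dotProduct_covMatrix]
  have h2 : ∀ x : E n, Real.cos (⟪x, h⟫_ℝ + a) =
      RCLike.re (Complex.exp (a * Complex.I) * Complex.exp (⟪x, h⟫_ℝ * Complex.I)) := fun x => by
    rw [← Complex.exp_add, ← add_mul, ← Complex.ofReal_add, add_comm a]
    exact (Complex.exp_ofReal_mul_I_re _).symm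
  have hi : Integrable (fun x : E n => Complex.exp (⟪x, h⟫_ℝ * Complex.I)) (nuAt A B f t) := by
    refine Integrable.of_bound (C := 1) ?_ (Eventually.of_forall fun x => ?_)
    · have : Continuous fun x : E n => Complex.exp (⟪x, h⟫_ℝ * Complex.I) := by fun_prop
      exact this.aestronglyMeasurable
    · rw [Complex.norm_exp_ofReal_mul_I]
  refine (integral_congr_ae (Eventually.of_forall h2)).trans ?_
  rw [integral_re (hi.const_mul _), integral_const_mul, ← charFun_apply, h1, ← Complex.exp_add]
  have e : (a : ℂ) * Complex.I + (⟪h, meanVec A f t⟫_ℝ * Complex.I -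
      (⟪h, covOp A B t h⟫_ℝ : ℝ) / 2) =
      ((⟪meanVec A f t, h⟫_ℝ + a : ℝ) : ℂ) * Complex.I +
        ((-(1 / 2) * ⟪h, covOp A B t h⟫_ℝ : ℝ) : ℂ) := by
    rw [real_inner_comm h]
    push_cast
    ring
  rw [e, Complex.exp_add, ← Complex.ofReal_exp]
  change (_ * (_ : ℂ)).re = _
  rw [Complex.re_mul_ofReal, Complex.exp_ofReal_mul_I_re]

lemma Setting.integral_sin_nuAt (H : Setting A B f T) (t : ℝ) (h : E n) (a : ℝ) :
    ∫ x, Real.sin (⟪x, h⟫_ℝ + a) ∂(nuAt A B f t) =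
      Real.sin (⟪meanVec A f t, h⟫_ℝ + a) * Real.exp (-(1 / 2) * ⟪h, covOp A B t h⟫_ℝ) := by
  have h1 := H.integral_cos_nuAt t h (a - Real.pi / 2)
  simpa only [← add_sub_assoc, Real.cos_sub_pi_div_two] using h1

/-- Differentiating `integral_cos_nuAt` in the direction `k` of the frequency. -/
lemma Setting.integral_inner_mul_sin_nuAt (H : Setting A B f T) (t : ℝ) (h k : E n) (a : ℝ) :
    ∫ x, ⟪x, k⟫_ℝ * Real.sin (⟪x, h⟫_ℝ + a) ∂(nuAt A B f t) =
      (⟪meanVec A f t, k⟫_ℝ * Real.sin (⟪meanVec A f t, h⟫_ℝ + a) +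
        ⟪k, covOp A B t h⟫_ℝ * Real.cos (⟪meanVec A f t, h⟫_ℝ + a)) *
        Real.exp (-(1 / 2) * ⟪h, covOp A B t h⟫_ℝ) := by
  have hlin : ∀ (x : E n) (ε : ℝ), HasDerivAt (fun ε : ℝ => ⟪x, h + ε • k⟫_ℝ + a) ⟪x, k⟫_ℝ ε :=
    fun x ε => by
      have e : (fun ε : ℝ => ⟪x, h + ε • k⟫_ℝ + a) = fun ε => (⟪x, h⟫_ℝ + a) + ε * ⟪x, k⟫_ℝ := by
        ext1 ε; rw [inner_add_right, real_inner_smul_right]; ring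
      rw [e]
      simpa using ((hasDerivAt_id ε).mul_const ⟪x, k⟫_ℝ).const_add (⟪x, h⟫_ℝ + a)
  have hd : ∀ (x : E n) (ε : ℝ), HasDerivAt (fun ε : ℝ => Real.cos (⟪x, h + ε • k⟫_ℝ + a))
      (-Real.sin (⟪x, h + ε • k⟫_ℝ + a) * ⟪x, k⟫_ℝ) ε := fun x ε => (hlin x ε).cos
  have hc : ∀ ε : ℝ, Continuous fun x : E n => Real.cos (⟪x, h + ε • k⟫_ℝ + a) := fun ε => by
    fun_prop
  have hc' : Continuous fun x : E n => -Real.sin (⟪x, h + (0 : ℝ) • k⟫_ℝ + a) * ⟪x, k⟫_ℝ := by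
    fun_prop
  have h1 := hasDerivAt_integral_of_dominated_loc_of_deriv_le (μ := nuAt A B f t)
    (F := fun ε x => Real.cos (⟪x, h + ε • k⟫_ℝ + a))
    (F' := fun ε x => -Real.sin (⟪x, h + ε • k⟫_ℝ + a) * ⟪x, k⟫_ℝ) (x₀ := (0 : ℝ))
    (s := Set.univ) (bound := fun x => ‖x‖ * ‖k‖) univ_mem
    (Eventually.of_forall fun ε => (hc ε).aestronglyMeasurable)
    (Integrable.of_bound (C := 1) (hc 0).aestronglyMeasurable
      (Eventually.of_forall fun x => Real.abs_cos_le_one _)) hc'.aestronglyMeasurable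
    (Eventually.of_forall fun x ε _ => by
      rw [norm_mul, norm_neg]
      refine (mul_le_of_le_one_left (norm_nonneg _) (Real.abs_sin_le_one _)).trans ?_
      exact norm_inner_le_norm x k)
    ((integrable_norm_nuAt t).mul_const _)
    (Eventually.of_forall fun x ε _ => hd x ε)
  have h2 := h1.2
  simp only [H.integral_cos_nuAt, zero_smul, add_zero] at h2
  have h3 : HasDerivAt (fun ε : ℝ => -(1 / 2) * ⟪h + ε • k, covOp A B t (h + ε • k)⟫_ℝ)
      (-⟪k, covOp A B t h⟫_ℝ) 0 := by
    have e : (fun ε : ℝ => -(1 / 2) * ⟪h + ε • k, covOp A B t (h + ε • k)⟫_ℝ) = fun ε =>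
        -(1 / 2) * ⟪h, covOp A B t h⟫_ℝ + (ε * (-⟪k, covOp A B t h⟫_ℝ) +
          ε ^ 2 * (-(1 / 2) * ⟪k, covOp A B t k⟫_ℝ)) := by
      ext1 ε
      have : ⟪h, covOp A B t k⟫_ℝ = ⟪k, covOp A B t h⟫_ℝ := by
        rw [H.inner_covOp_comm, real_inner_comm]
      simp only [map_add, map_smul, inner_add_left, inner_add_right, real_inner_smul_left,
        real_inner_smul_right, this]
      ring
    rw [e]
    have := (((hasDerivAt_id (0 : ℝ)).mul_const (-⟪k, covOp A B t h⟫_ℝ)).add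
      ((hasDerivAt_pow 2 (0 : ℝ)).mul_const (-(1 / 2) * ⟪k, covOp A B t k⟫_ℝ))).const_add
      (-(1 / 2) * ⟪h, covOp A B t h⟫_ℝ)
    refine this.congr_deriv ?_
    simp
  have h4 := (hlin (meanVec A f t) 0).cos.mul h3.exp
  simp only [zero_smul, add_zero] at h4
  have h5 := h2.unique h4
  have h6 : ∫ x, ⟪x, k⟫_ℝ * Real.sin (⟪x, h⟫_ℝ + a) ∂(nuAt A B f t) =
      -∫ x, -Real.sin (⟪x, h⟫_ℝ + a) * ⟪x, k⟫_ℝ ∂(nuAt A B f t) := by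
    rw [← integral_neg]
    congr 1; ext1 x; ring
  rw [h6, h5]
  ring

/-- The function `t ↦ ∫ v(t, x) dν_t` has derivative `∫ 𝒢v(t, x) dν_t` for `v = Φ cos(⟨x, h⟩ + a)`.
The function on the left is written in the closed form of `integral_cos_nuAt`, and the identity
combines the equations `g' = A g + f` and `Q' = A Q + Q A* + B B*`. -/
lemma Setting.hasDerivAt_trigWave (H : Setting A B f T) {Φ : ℝ → ℝ} {h : ℝ → E n}
    (hΦ : ContDiff ℝ 1 Φ) (hh : ContDiff ℝ 1 h) (a t : ℝ) :
    HasDerivAt (fun t => Φ t * (Real.cos (⟪meanVec A f t, h t⟫_ℝ + a) *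
      Real.exp (-(1 / 2) * ⟪h t, covOp A B t (h t)⟫_ℝ)))
      (∫ x, kolmogorov A B f (trigWave Φ h a) (t, x) ∂(nuAt A B f t)) t := by
  have e1 : HasDerivAt Φ (deriv Φ t) t := ((hΦ.differentiable one_ne_zero) t).hasDerivAt
  have e2 : HasDerivAt h (deriv h t) t := ((hh.differentiable one_ne_zero) t).hasDerivAt
  have e3 := ((H.hasDerivAt_meanVec t).inner ℝ e2).add_const a
  have e4 := (e2.inner ℝ ((H.hasDerivAt_covOp t).clm_apply e2)).const_mul (-(1 / 2) : ℝ)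
  refine (e1.mul (e3.cos.mul e4.exp)).congr_deriv ?_
  simp only [kolmogorov_trigWave hΦ hh]
  have i1 : Integrable (fun x => Real.cos (⟪x, h t⟫_ℝ + a)) (nuAt A B f t) :=
    Integrable.of_bound (C := 1) (by fun_prop)
      (Eventually.of_forall fun x => Real.abs_cos_le_one _)
  have i2 : Integrable (fun x => Real.sin (⟪x, h t⟫_ℝ + a)) (nuAt A B f t) :=
    Integrable.of_bound (C := 1) (by fun_prop)
      (Eventually.of_forall fun x => Real.abs_sin_le_one _)
  have i3 : ∀ k, Integrable (fun x => ⟪x, k⟫_ℝ * Real.sin (⟪x, h t⟫_ℝ + a)) (nuAt A B f t) :=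
    fun k => by
      refine ((integrable_norm_nuAt t).mul_const ‖k‖).mono' (by fun_prop)
        (Eventually.of_forall fun x => ?_)
      rw [norm_mul]
      exact (mul_le_of_le_one_right (norm_nonneg _) (Real.abs_sin_le_one _)).trans
        (norm_inner_le_norm x k)
  have key : ∀ (α β : ℝ) (k : E n), ∫ x, α * Real.cos (⟪x, h t⟫_ℝ + a) -
      (⟪x, k⟫_ℝ + β) * Real.sin (⟪x, h t⟫_ℝ + a) ∂(nuAt A B f t) =
      α * (∫ x, Real.cos (⟪x, h t⟫_ℝ + a) ∂(nuAt A B f t)) -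
      ((∫ x, ⟪x, k⟫_ℝ * Real.sin (⟪x, h t⟫_ℝ + a) ∂(nuAt A B f t)) +
        β * ∫ x, Real.sin (⟪x, h t⟫_ℝ + a) ∂(nuAt A B f t)) := fun α β k => by
    have i4 : Integrable (fun x => ⟪x, k⟫_ℝ * Real.sin (⟪x, h t⟫_ℝ + a) +
        β * Real.sin (⟪x, h t⟫_ℝ + a)) (nuAt A B f t) := (i3 k).add (i2.const_mul β)
    simp only [add_mul]
    rw [integral_sub (i1.const_mul _) i4, integral_add (i3 k) (i2.const_mul β),
      integral_const_mul, integral_const_mul]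
  rw [key, H.integral_cos_nuAt, H.integral_sin_nuAt, H.integral_inner_mul_sin_nuAt]
  have s1 : ⟪h t, A t (covOp A B t (h t))⟫_ℝ =
      ⟪ContinuousLinearMap.adjoint (A t) (h t), covOp A B t (h t)⟫_ℝ := by
    rw [ContinuousLinearMap.adjoint_inner_left]
  have s2 : ⟪h t, covOp A B t (ContinuousLinearMap.adjoint (A t) (h t))⟫_ℝ =
      ⟪ContinuousLinearMap.adjoint (A t) (h t), covOp A B t (h t)⟫_ℝ := by
    rw [H.inner_covOp_comm, real_inner_comm]
  have s3 : ⟪h t, covOp A B t (deriv h t)⟫_ℝ = ⟪deriv h t, covOp A B t (h t)⟫_ℝ := by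
    rw [H.inner_covOp_comm, real_inner_comm]
  have s4 : ⟪A t (meanVec A f t), h t⟫_ℝ =
      ⟪meanVec A f t, ContinuousLinearMap.adjoint (A t) (h t)⟫_ℝ := by
    rw [ContinuousLinearMap.adjoint_inner_right]
  simp only [Pi.mul_apply, add_apply, mul_apply_eq_comp, inner_add_right, inner_add_left,
    real_inner_smul_right, real_inner_smul_left, s1, s2, s3, s4]
  ring

/-- Infinitesimal invariance: `∫ 𝒢v dν = 0` over a period, because `t ↦ ∫ v(t, x) dν_t` is
periodic. -/
lemma Setting.integral_kolmogorov_trigWave (H : Setting A B f T) {Φ : ℝ → ℝ} {h : ℝ → E n}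
    (hΦ : ContDiff ℝ 1 Φ) (hh : ContDiff ℝ 1 h) (hΦT : Function.Periodic Φ T)
    (hhT : Function.Periodic h T) (a : ℝ) (hc : Continuous (kolmogorov A B f (trigWave Φ h a)))
    (hi : Integrable (kolmogorov A B f (trigWave Φ h a)) (periodMeasure T (nu A B f))) :
    ∫ z, kolmogorov A B f (trigWave Φ h a) z ∂(periodMeasure T (nu A B f)) = 0 := by
  have hint : IntervalIntegrable (fun t => ∫ x, kolmogorov A B f (trigWave Φ h a) (t, x)
      ∂(nuAt A B f t)) volume 0 T := by
    have hS := H.continuous_sqrtCov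
    have hg := H.continuous_meanVec
    have hm : Measurable fun z : ℝ × E n => (z.1, meanVec A f z.1 + sqrtCov A B z.1 z.2) :=
      Continuous.measurable (by fun_prop)
    rw [H.periodMeasure_eq_map, integrable_smul_measure (by simp) (by simpa using H.pos),
      integrable_map_measure hc.aestronglyMeasurable hm.aemeasurable] at hi
    rw [intervalIntegrable_iff_integrableOn_Ioo_of_le H.pos.le]
    refine hi.integral_prod_left.congr (Eventually.of_forall fun t => ?_)
    have hct : Continuous fun x => kolmogorov A B f (trigWave Φ h a) (t, x) := by fun_prop
    change ∫ y, kolmogorov A B f (trigWave Φ h a) (t, meanVec A f t + sqrtCov A B t y)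
      ∂(stdGaussian (E n)) = ∫ x, kolmogorov A B f (trigWave Φ h a) (t, x) ∂(nuAt A B f t)
    rw [nuAt_eq_map, integral_map (by fun_prop) hct.aestronglyMeasurable]
  rw [H.integral_periodMeasure hc hi, intervalIntegral.integral_eq_sub_of_hasDerivAt
    (fun t _ => H.hasDerivAt_trigWave hΦ hh a t) hint]
  have e1 := hΦT 0
  have e2 := hhT 0
  have e3 := H.periodic_meanVec 0
  have e4 := H.periodic_covOp 0
  rw [zero_add] at e1 e2 e3 e4
  rw [e1, e2, e3, e4, sub_self, mul_zero]

end Invariance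

/-! ### The core of `G_#` -/

section Core

variable {n : ℕ} {A B : ℝ → E n →L[ℝ] E n} {f : ℝ → E n} {T : ℝ}

lemma exists_eq_trigWave {u : ℝ × E n → ℝ} (hu : ∃ (Φ : ℝ → ℝ) (h : ℝ → E n), ContDiff ℝ 1 Φ ∧
    Function.Periodic Φ T ∧ ContDiff ℝ 1 h ∧ Function.Periodic h T ∧
    ((u = fun z => Φ z.1 * Real.cos ⟪z.2, h z.1⟫_ℝ) ∨
      (u = fun z => Φ z.1 * Real.sin ⟪z.2, h z.1⟫_ℝ))) :
    ∃ (Φ : ℝ → ℝ) (h : ℝ → E n) (a : ℝ), ContDiff ℝ 1 Φ ∧ Function.Periodic Φ T ∧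
      ContDiff ℝ 1 h ∧ Function.Periodic h T ∧ u = trigWave Φ h a := by
  obtain ⟨Φ, h, h1, h2, h3, h4, rfl | rfl⟩ := hu
  · exact ⟨Φ, h, 0, h1, h2, h3, h4, by ext z; simp [trigWave]⟩
  · exact ⟨Φ, h, -(Real.pi / 2), h1, h2, h3, h4, by
      ext z; simp only [trigWave, ← sub_eq_add_neg, Real.cos_sub_pi_div_two]⟩

lemma trigWave_mem_coreSharp {Φ : ℝ → ℝ} {h : ℝ → E n} (h1 : ContDiff ℝ 1 Φ)
    (h2 : Function.Periodic Φ T) (h3 : ContDiff ℝ 1 h) (h4 : Function.Periodic h T) (a : ℝ) :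
    trigWave Φ h a ∈ coreSharp n T := by
  have e : trigWave Φ h a = Real.cos a • (fun z : ℝ × E n => Φ z.1 * Real.cos ⟪z.2, h z.1⟫_ℝ) +
      (-Real.sin a) • fun z : ℝ × E n => Φ z.1 * Real.sin ⟪z.2, h z.1⟫_ℝ := by
    ext z
    simp only [trigWave, Real.cos_add, Pi.add_apply, Pi.smul_apply, smul_eq_mul]
    ring
  rw [e]
  exact Submodule.add_mem _
    (Submodule.smul_mem _ _ (Submodule.subset_span ⟨Φ, h, h1, h2, h3, h4, Or.inl rfl⟩))
    (Submodule.smul_mem _ _ (Submodule.subset_span ⟨Φ, h, h1, h2, h3, h4, Or.inr rfl⟩))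

/-- `D(G_0^#)` is an algebra, by the product formula for cosines. -/
lemma mul_mem_coreSharp {u v : ℝ × E n → ℝ} (hu : u ∈ coreSharp n T) (hv : v ∈ coreSharp n T) :
    u * v ∈ coreSharp n T := by
  have h : coreSharp n T * coreSharp n T ≤ coreSharp n T := by
    conv_lhs => rw [coreSharp, Submodule.span_mul_span]
    rw [Submodule.span_le]
    rintro _ ⟨u, hu, v, hv, rfl⟩
    obtain ⟨Φ, h, a, h1, h2, h3, h4, rfl⟩ := exists_eq_trigWave hu
    obtain ⟨Ψ, k, b, k1, k2, k3, k4, rfl⟩ := exists_eq_trigWave hv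
    have e : trigWave Φ h a * trigWave Ψ k b = (1 / 2 : ℝ) • trigWave (Φ * Ψ) (h + k) (a + b) +
        (1 / 2 : ℝ) • trigWave (Φ * Ψ) (h - k) (a - b) := by
      ext z
      have e1 : ⟪z.2, h z.1⟫_ℝ + ⟪z.2, k z.1⟫_ℝ + (a + b) =
          (⟪z.2, h z.1⟫_ℝ + a) + (⟪z.2, k z.1⟫_ℝ + b) := by ring
      have e2 : ⟪z.2, h z.1⟫_ℝ - ⟪z.2, k z.1⟫_ℝ + (a - b) =
          (⟪z.2, h z.1⟫_ℝ + a) - (⟪z.2, k z.1⟫_ℝ + b) := by ring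
      simp only [trigWave, Pi.add_apply, Pi.smul_apply, Pi.mul_apply, Pi.sub_apply, smul_eq_mul,
        inner_add_right, inner_sub_right, e1, e2, Real.cos_add (_ + a), Real.cos_sub (_ + a)]
      ring
    change trigWave Φ h a * trigWave Ψ k b ∈ coreSharp n T
    rw [e]
    exact Submodule.add_mem _
      (Submodule.smul_mem _ _ (trigWave_mem_coreSharp (h1.mul k1) (h2.mul k2) (h3.add k3)
        (h4.add k4) _))
      (Submodule.smul_mem _ _ (trigWave_mem_coreSharp (h1.mul k1) (h2.mul k2) (h3.sub k3)
        (h4.sub k4) _))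
  exact h (Submodule.mul_mem_mul hu hv)

lemma Setting.ae_mem_Icc (H : Setting A B f T) :
    ∀ᵐ z ∂(periodMeasure T (nu A B f)), z.1 ∈ Set.Icc 0 T := by
  obtain ⟨C, hC⟩ := H.exists_periodMeasure_le
  refine (Measure.absolutelyContinuous_of_le_smul hC).ae_le ?_
  refine (ae_restrict_iff' (measurableSet_Ioo.prod MeasurableSet.univ)).2
    (Eventually.of_forall fun z hz => Set.Ioo_subset_Icc_self hz.1)

/-- Second moments of `ν` are finite: apply the tail estimate to the constant function `1`. -/
lemma Setting.memLp_of_linear_growth (H : Setting A B f T) {g : ℝ × E n → ℝ} (hg : Continuous g)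
    {C : ℝ} (hC : ∀ z : ℝ × E n, z.1 ∈ Set.Icc 0 T → |g z| ≤ C * (1 + ‖z.2‖)) :
    MemLp g 2 (periodMeasure T (nu A B f)) := by
  have := H.isProbabilityMeasure_periodMeasure
  have h1 : MemLp (fun z : ℝ × E n => ‖z.2‖) 2 (periodMeasure T (nu A B f)) := by
    refine ⟨by fun_prop, ?_⟩
    obtain ⟨C₁, hC₁⟩ := H.exists_tail_le
    have h2 := hC₁ (fun _ => 1) contDiff_const
    have h3 : ∀ z : ℝ × E n, ‖dx (fun _ => (1 : ℝ)) z‖ₑ ^ 2 = 0 := fun z => by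
      have : dx (fun _ : ℝ × E n => (1 : ℝ)) z = 0 := by simp [dx]
      rw [enorm_sq_eq_ofReal, this, norm_zero, zero_pow two_ne_zero, ENNReal.ofReal_zero]
    simp only [h3, lintegral_zero, enorm_one, mul_one, one_pow, lintegral_one, measure_univ] at h2
    have h4 : eLpNorm (fun z : ℝ × E n => ‖z.2‖) 2 (periodMeasure T (nu A B f)) ^ 2 < ⊤ := by
      rw [eLpNorm_two_sq]
      simp only [enorm_norm]
      refine h2.trans_lt ?_
      simp
    exact (ENNReal.pow_lt_top_iff.1 h4).resolve_right two_ne_zero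
  refine MemLp.of_le (((memLp_const (1 : ℝ)).add h1).const_mul C) hg.aestronglyMeasurable ?_
  filter_upwards [H.ae_mem_Icc] with z hz
  exact (hC z hz).trans (le_abs_self _)

/-- The properties of the functions in `D(G_0^#)` that the energy estimate relies on. -/
structure IsTame (A B : ℝ → E n →L[ℝ] E n) (f : ℝ → E n) (T : ℝ) (u : ℝ × E n → ℝ) : Prop where
  isC12 : IsC12 u
  continuous_kolmogorov : Continuous (kolmogorov A B f u)
  bound : ∃ C : ℝ, ∀ z : ℝ × E n, z.1 ∈ Set.Icc 0 T →
    |u z| ≤ C ∧ |kolmogorov A B f u z| ≤ C * (1 + ‖z.2‖)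
  integral_kolmogorov : ∫ z, kolmogorov A B f u z ∂(periodMeasure T (nu A B f)) = 0

lemma IsTame.memLp (H : Setting A B f T) {u : ℝ × E n → ℝ} (hu : IsTame A B f T u) :
    MemLp u 2 (periodMeasure T (nu A B f)) := by
  obtain ⟨C, hC⟩ := hu.bound
  refine H.memLp_of_linear_growth (C := C) hu.isC12.contDiff.continuous fun z hz => ?_
  have h1 := (hC z hz).1
  have h2 : 0 ≤ C := (abs_nonneg _).trans h1
  nlinarith [norm_nonneg z.2]

lemma IsTame.memLp_kolmogorov (H : Setting A B f T) {u : ℝ × E n → ℝ} (hu : IsTame A B f T u) :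
    MemLp (kolmogorov A B f u) 2 (periodMeasure T (nu A B f)) := by
  obtain ⟨C, hC⟩ := hu.bound
  exact H.memLp_of_linear_growth hu.continuous_kolmogorov fun z hz => (hC z hz).2

lemma IsTame.integrable_kolmogorov (H : Setting A B f T) {u : ℝ × E n → ℝ}
    (hu : IsTame A B f T u) : Integrable (kolmogorov A B f u) (periodMeasure T (nu A B f)) :=
  have := H.isProbabilityMeasure_periodMeasure
  (hu.memLp_kolmogorov H).integrable one_le_two

lemma isTame_trigWave (H : Setting A B f T) {Φ : ℝ → ℝ} {h : ℝ → E n} (h1 : ContDiff ℝ 1 Φ)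
    (h2 : Function.Periodic Φ T) (h3 : ContDiff ℝ 1 h) (h4 : Function.Periodic h T) (a : ℝ) :
    IsTame A B f T (trigWave Φ h a) := by
  have hA := H.contA
  have hB := H.contB
  have hf := H.contf
  have hA' : Continuous fun t => ContinuousLinearMap.adjoint (A t) :=
    (ContinuousLinearMap.adjoint (𝕜 := ℝ) (E := E n) (F := E n)).continuous.comp hA
  have hB' : Continuous fun t => ContinuousLinearMap.adjoint (B t) :=
    (ContinuousLinearMap.adjoint (𝕜 := ℝ) (E := E n) (F := E n)).continuous.comp hB
  have hΦ := h1.continuous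
  have hh := h3.continuous
  have hΦd := h1.continuous_deriv le_rfl
  have hhd := h3.continuous_deriv le_rfl
  have hα : Continuous fun t => deriv Φ t - 1 / 2 * (Φ t *
      ⟪h t, B t (ContinuousLinearMap.adjoint (B t) (h t))⟫_ℝ) :=
    hΦd.sub (continuous_const.mul (hΦ.mul (hh.inner (hB.clm_apply (hB'.clm_apply hh)))))
  have hp : Continuous fun t => Φ t • (deriv h t + ContinuousLinearMap.adjoint (A t) (h t)) :=
    hΦ.smul (hhd.add (hA'.clm_apply hh))
  have hq : Continuous fun t => Φ t * ⟪f t, h t⟫_ℝ := hΦ.mul (hf.inner hh)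
  have hform : kolmogorov A B f (trigWave Φ h a) = _ := funext (kolmogorov_trigWave h1 h3 a)
  have hc : Continuous (kolmogorov A B f (trigWave Φ h a)) := by
    rw [hform]
    have hθ : Continuous fun z : ℝ × E n => ⟪z.2, h z.1⟫_ℝ + a := by fun_prop
    exact ((hα.comp continuous_fst).mul (Real.continuous_cos.comp hθ)).sub
      (((continuous_snd.inner (hp.comp continuous_fst)).add (hq.comp continuous_fst)).mul
        (Real.continuous_sin.comp hθ))
  obtain ⟨C, hC⟩ := (isCompact_Icc (a := (0 : ℝ)) (b := T)).exists_bound_of_continuousOn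
    (((hΦ.norm.add hα.norm).add hp.norm).add hq.norm).continuousOn
  have hb : ∀ z : ℝ × E n, z.1 ∈ Set.Icc 0 T → |trigWave Φ h a z| ≤ C ∧
      |kolmogorov A B f (trigWave Φ h a) z| ≤ C * (1 + ‖z.2‖) := fun z hz => by
    have hCz : ‖Φ z.1‖ + ‖deriv Φ z.1 - 1 / 2 * (Φ z.1 *
        ⟪h z.1, B z.1 (ContinuousLinearMap.adjoint (B z.1) (h z.1))⟫_ℝ)‖ +
        ‖Φ z.1 • (deriv h z.1 + ContinuousLinearMap.adjoint (A z.1) (h z.1))‖ +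
        ‖Φ z.1 * ⟪f z.1, h z.1⟫_ℝ‖ ≤ C := (le_abs_self _).trans (hC z.1 hz)
    rw [kolmogorov_trigWave h1 h3, trigWave]
    generalize hα0 : deriv Φ z.1 - 1 / 2 * (Φ z.1 *
      ⟪h z.1, B z.1 (ContinuousLinearMap.adjoint (B z.1) (h z.1))⟫_ℝ) = α at *
    generalize Φ z.1 • (deriv h z.1 + ContinuousLinearMap.adjoint (A z.1) (h z.1)) = p at *
    generalize Φ z.1 * ⟪f z.1, h z.1⟫_ℝ = q at *
    simp only [Real.norm_eq_abs] at hCz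
    have n1 := abs_nonneg (Φ z.1)
    have n2 := abs_nonneg α
    have n3 := norm_nonneg p
    have n4 := abs_nonneg q
    have n5 := norm_nonneg z.2
    constructor
    · rw [abs_mul]
      refine (mul_le_of_le_one_right (abs_nonneg _) (Real.abs_cos_le_one _)).trans ?_
      linarith
    · refine (abs_sub _ _).trans ?_
      rw [abs_mul, abs_mul]
      have m1 := mul_le_of_le_one_right n2 (Real.abs_cos_le_one (⟪z.2, h z.1⟫_ℝ + a))
      have m2 := mul_le_of_le_one_right (abs_nonneg (⟪z.2, p⟫_ℝ + q))
        (Real.abs_sin_le_one (⟪z.2, h z.1⟫_ℝ + a))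
      have m3 : |⟪z.2, p⟫_ℝ + q| ≤ ‖z.2‖ * ‖p‖ + |q| :=
        (abs_add_le _ _).trans (add_le_add (abs_real_inner_le_norm _ _) le_rfl)
      have m4 : ‖z.2‖ * ‖p‖ ≤ ‖z.2‖ * C := by gcongr; linarith
      have m5 : |α| + |q| ≤ C := by linarith
      linarith
  exact ⟨isC12_trigWave h1 h3 a, hc, ⟨C, hb⟩, H.integral_kolmogorov_trigWave h1 h3 h2 h4 a hc
    (have := H.isProbabilityMeasure_periodMeasure
    (H.memLp_of_linear_growth hc fun z hz => (hb z hz).2).integrable one_le_two)⟩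

lemma isTame_of_mem_coreSharp (H : Setting A B f T) {u : ℝ × E n → ℝ} (hu : u ∈ coreSharp n T) :
    IsTame A B f T u := by
  induction hu using Submodule.span_induction with
  | mem u hu =>
    obtain ⟨Φ, h, a, h1, h2, h3, h4, rfl⟩ := exists_eq_trigWave hu
    exact isTame_trigWave H h1 h2 h3 h4 a
  | zero =>
    have e : (0 : ℝ × E n → ℝ) = trigWave (fun _ => 0) (fun _ => 0) 0 := by
      ext z; simp [trigWave]
    rw [e]
    exact isTame_trigWave H contDiff_const (fun _ => rfl) contDiff_const (fun _ => rfl) 0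
  | add u v _ _ hu hv =>
    have e : kolmogorov A B f (u + v) = fun z => kolmogorov A B f u z + kolmogorov A B f v z :=
      funext (hu.isC12.kolmogorov_add hv.isC12)
    obtain ⟨C, hC⟩ := hu.bound
    obtain ⟨D, hD⟩ := hv.bound
    refine ⟨hu.isC12.add hv.isC12, ?_, ⟨C + D, fun z hz => ⟨?_, ?_⟩⟩, ?_⟩
    · rw [e]
      exact hu.continuous_kolmogorov.add hv.continuous_kolmogorov
    · exact (abs_add_le _ _).trans (add_le_add (hC z hz).1 (hD z hz).1)
    · rw [e, add_mul]
      exact (abs_add_le _ _).trans (add_le_add (hC z hz).2 (hD z hz).2)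
    · rw [e, integral_add (hu.integrable_kolmogorov H) (hv.integrable_kolmogorov H),
        hu.integral_kolmogorov, hv.integral_kolmogorov, add_zero]
  | smul c u _ hu =>
    have e : kolmogorov A B f (c • u) = fun z => c * kolmogorov A B f u z :=
      funext (hu.isC12.kolmogorov_const_smul c)
    obtain ⟨C, hC⟩ := hu.bound
    refine ⟨hu.isC12.const_smul c, ?_, ⟨|c| * C, fun z hz => ⟨?_, ?_⟩⟩, ?_⟩
    · rw [e]
      exact continuous_const.mul hu.continuous_kolmogorov
    · rw [Pi.smul_apply, smul_eq_mul, abs_mul]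
      exact mul_le_mul_of_nonneg_left (hC z hz).1 (abs_nonneg c)
    · rw [e, abs_mul, mul_assoc]
      exact mul_le_mul_of_nonneg_left (hC z hz).2 (abs_nonneg c)
    · rw [e, integral_const_mul, hu.integral_kolmogorov, mul_zero]

/-- The energy estimate: integrating `𝒢(u²) = 2 u 𝒢u + |B* Dₓu|²` with respect to the invariant
measure bounds the gradient by `u` and `𝒢u`. Here `𝒢(u²)` has integral zero because `u²` belongs to
the core. -/
lemma Setting.exists_eLpNorm_dx_le (H : Setting A B f T) : ∃ K : ℝ≥0, ∀ u ∈ coreSharp n T,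
    eLpNorm (dx u) 2 (periodMeasure T (nu A B f)) ≤
      K * (l2Norm T (nu A B f) u + l2Norm T (nu A B f) (kolmogorov A B f u)) := by
  obtain ⟨μ₀, hμ, hB⟩ := H.lower_adjoint
  refine ⟨(μ₀⁻¹).toNNReal, fun u hu => ?_⟩
  have := H.isProbabilityMeasure_periodMeasure
  have hut := isTame_of_mem_coreSharp H hu
  have hu2 := isTame_of_mem_coreSharp H (mul_mem_coreSharp hu hu)
  have hi1 := hu2.integrable_kolmogorov H
  have hi2 : Integrable (fun z => u z ^ 2 + kolmogorov A B f u z ^ 2)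
      (periodMeasure T (nu A B f)) :=
    (hut.memLp H).integrable_sq.add (hut.memLp_kolmogorov H).integrable_sq
  have hi3 : Integrable (fun z => kolmogorov A B f (u * u) z +
      (u z ^ 2 + kolmogorov A B f u z ^ 2)) (periodMeasure T (nu A B f)) := hi1.add hi2
  have hpt : ∀ z, ‖ContinuousLinearMap.adjoint (B z.1) (gradient (fun x => u (z.1, x)) z.2)‖ ^ 2 ≤
      kolmogorov A B f (u * u) z + (u z ^ 2 + kolmogorov A B f u z ^ 2) := fun z => by
    rw [hut.isC12.kolmogorov_mul_self]
    nlinarith [sq_nonneg (u z + kolmogorov A B f u z)]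
  have h1 : ENNReal.ofReal μ₀ ^ 2 * eLpNorm (dx u) 2 (periodMeasure T (nu A B f)) ^ 2 ≤
      l2Norm T (nu A B f) u ^ 2 + l2Norm T (nu A B f) (kolmogorov A B f u) ^ 2 := by
    rw [l2Norm, l2Norm, eLpNorm_two_sq, eLpNorm_two_sq, eLpNorm_two_sq,
      ← lintegral_const_mul' _ _ (by finiteness),
      ← lintegral_add_left (continuous_enorm_sq hut.isC12.contDiff.continuous).measurable]
    calc ∫⁻ z, ENNReal.ofReal μ₀ ^ 2 * ‖dx u z‖ₑ ^ 2 ∂(periodMeasure T (nu A B f))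
        ≤ ∫⁻ z, ENNReal.ofReal (kolmogorov A B f (u * u) z +
          (u z ^ 2 + kolmogorov A B f u z ^ 2)) ∂(periodMeasure T (nu A B f)) := by
          refine lintegral_mono fun z => ?_
          rw [← ofReal_norm, ← mul_pow, ← ENNReal.ofReal_mul hμ.le,
            ← ENNReal.ofReal_pow (by positivity)]
          refine ENNReal.ofReal_le_ofReal (le_trans ?_ (hpt z))
          gcongr
          refine le_trans ?_ (hB z.1 _)
          rw [norm_gradient]
          exact le_rfl
      _ = ∫⁻ z, ENNReal.ofReal (u z ^ 2 + kolmogorov A B f u z ^ 2)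
          ∂(periodMeasure T (nu A B f)) := by
          rw [← ofReal_integral_eq_lintegral_ofReal hi3
            (Eventually.of_forall fun z => (sq_nonneg _).trans (hpt z)),
            ← ofReal_integral_eq_lintegral_ofReal hi2
            (Eventually.of_forall fun z => by positivity)]
          congr 1
          exact (integral_add hi1 hi2).trans (by rw [hu2.integral_kolmogorov, zero_add])
      _ = _ := by
          refine lintegral_congr fun z => ?_
          rw [ENNReal.ofReal_add (sq_nonneg _) (sq_nonneg _), enorm_sq_eq_ofReal,
            enorm_sq_eq_ofReal, Real.norm_eq_abs, Real.norm_eq_abs, sq_abs, sq_abs]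
  have h2 : (ENNReal.ofReal μ₀ * eLpNorm (dx u) 2 (periodMeasure T (nu A B f))) ^ 2 ≤
      (l2Norm T (nu A B f) u + l2Norm T (nu A B f) (kolmogorov A B f u)) ^ 2 := by
    rw [mul_pow]
    refine h1.trans ?_
    rw [add_sq]
    exact add_le_add le_self_add le_rfl
  have h3 := (ENNReal.pow_le_pow_left_iff two_ne_zero).1 h2
  have h4 : ((μ₀⁻¹).toNNReal : ℝ≥0∞) = (ENNReal.ofReal μ₀)⁻¹ := by
    rw [← ENNReal.ofReal_inv_of_pos hμ]; rfl
  rw [h4, ← ENNReal.div_eq_inv_mul, ENNReal.le_div_iff_mul_le (Or.inl (by simpa using hμ))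
    (Or.inl ENNReal.ofReal_ne_top), mul_comm]
  exact h3

end Core

/-! ### Compactness of the domain of `G_#` -/

section Domain

variable {n : ℕ} {A B : ℝ → E n →L[ℝ] E n} {f : ℝ → E n} {T : ℝ}

lemma continuous_gradient_slice {u : ℝ × E n → ℝ} (hu : ContDiff ℝ 1 u) :
    Continuous fun z : ℝ × E n => gradient (fun x => u (z.1, x)) z.2 :=
  (InnerProductSpace.toDual ℝ (E n)).symm.continuous.comp (continuous_dx hu)

/-- The density whose integral over `x` is the time derivative of `∫ u(t, x) ψ(x) dx`, without second
order derivatives of `u`: that of `½ Tr(B B* Dₓ²u)` has been moved to `ψ`. -/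
def timeFlux (A B : ℝ → E n →L[ℝ] E n) (f : ℝ → E n) (ψ : E n → ℝ) (u : ℝ × E n → ℝ)
    (z : ℝ × E n) : ℝ :=
  (kolmogorov A B f u z - ⟪A z.1 z.2 + f z.1, gradient (fun x => u (z.1, x)) z.2⟫_ℝ) * ψ z.2 +
    1 / 2 * fderiv ℝ ψ z.2 ((B z.1 * ContinuousLinearMap.adjoint (B z.1))
      (gradient (fun x => u (z.1, x)) z.2))

lemma integral_fderiv_time_mul_eq {ψ : E n → ℝ} (hψ : ContDiff ℝ 1 ψ) (hs : HasCompactSupport ψ)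
    {u : ℝ × E n → ℝ} (hu : IsC12 u) (t : ℝ) :
    ∫ x, fderiv ℝ u (t, x) (1, 0) * ψ x = ∫ x, timeFlux A B f ψ u (t, x) := by
  have hψc := hψ.continuous
  have hg1 := contDiff_gradient (hu.2 t)
  have hg := hg1.continuous
  have hgd := hg1.continuous_fderiv one_ne_zero
  have hψd := hψ.continuous_fderiv one_ne_zero
  have hdc : Continuous fun x => fderiv ℝ u (t, x) (1, 0) :=
    ((hu.1.continuous_fderiv one_ne_zero).comp (Continuous.prodMk_right t)).clm_apply
      continuous_const
  have hC : ∀ C : E n →L[ℝ] E n, Continuous fun x => LinearMap.trace ℝ (E n)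
      (C * fderiv ℝ (gradient fun x => u (t, x)) x : E n →L[ℝ] E n).toLinearMap := fun C => by
    let e := stdOrthonormalBasis ℝ (E n)
    have h : ∀ x, LinearMap.trace ℝ (E n)
        (C * fderiv ℝ (gradient fun x => u (t, x)) x : E n →L[ℝ] E n).toLinearMap =
        ∑ i, ⟪e i, C (fderiv ℝ (gradient fun x => u (t, x)) x (e i))⟫_ℝ := fun x =>
      LinearMap.trace_eq_sum_inner _ e
    simp only [h]
    exact continuous_finsetSum _ fun i _ =>
      continuous_const.inner (C.continuous.comp (hgd.clm_apply continuous_const))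
  obtain ⟨C, hCC⟩ : ∃ C, C = B t * ContinuousLinearMap.adjoint (B t) := ⟨_, rfl⟩
  have hk : ∀ x, timeFlux A B f ψ u (t, x) = fderiv ℝ u (t, x) (1, 0) * ψ x +
      1 / 2 * (LinearMap.trace ℝ (E n)
        (C * fderiv ℝ (gradient fun x => u (t, x)) x : E n →L[ℝ] E n).toLinearMap * ψ x +
      fderiv ℝ ψ x (C (gradient (fun x => u (t, x)) x))) := fun x => by
    rw [timeFlux, kolmogorov_eq, (hasDerivAt_time hu.1 t x).deriv, diffusion, hCC]
    ring
  have i1 : Integrable fun x => fderiv ℝ u (t, x) (1, 0) * ψ x :=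
    (hdc.mul hψc).integrable_of_hasCompactSupport hs.mul_left
  have i2 : Integrable fun x => LinearMap.trace ℝ (E n)
      (C * fderiv ℝ (gradient fun x => u (t, x)) x : E n →L[ℝ] E n).toLinearMap * ψ x :=
    ((hC C).mul hψc).integrable_of_hasCompactSupport hs.mul_left
  have i3 : Integrable fun x => fderiv ℝ ψ x (C (gradient (fun x => u (t, x)) x)) := by
    refine Continuous.integrable_of_hasCompactSupport
      (hψd.clm_apply (C.continuous.comp hg)) ?_
    refine (hs.fderiv ℝ).mono fun x hx => ?_
    contrapose! hx
    rw [Function.notMem_support] at hx ⊢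
    rw [hx]
    rfl
  have i4 : Integrable fun x => 1 / 2 * (LinearMap.trace ℝ (E n)
      (C * fderiv ℝ (gradient fun x => u (t, x)) x : E n →L[ℝ] E n).toLinearMap * ψ x +
      fderiv ℝ ψ x (C (gradient (fun x => u (t, x)) x))) := (i2.add i3).const_mul _
  simp only [hk]
  rw [integral_add i1 i4, integral_const_mul, integral_add i2 i3,
    integral_trace_mul_eq C (hu.2 t) hψ hs, neg_add_cancel, mul_zero, add_zero]

/-- On the support of `ψ` the drift `A x + f` is bounded, so `timeFlux` is controlled by `𝒢u` and
`Dₓu`. -/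
lemma Setting.exists_abs_timeFlux_le (H : Setting A B f T) (L : ℝ) : ∃ K : ℝ≥0,
    ∀ ψ : E n → ℝ, (∀ x, L < ‖x‖ → ψ x = 0) → (∀ x, |ψ x| ≤ L) → (∀ x, ‖fderiv ℝ ψ x‖ ≤ L) →
      ∀ (u : ℝ × E n → ℝ) (z : ℝ × E n), |timeFlux A B f ψ u z| ≤
        K * (|kolmogorov A B f u z| + ‖dx u z‖) ∧ (L < ‖z.2‖ → timeFlux A B f ψ u z = 0) := by
  obtain ⟨CA, hA0, hA⟩ := exists_norm_le_of_periodic H.pos H.contA H.perA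
  obtain ⟨CB, hB0, hB⟩ := exists_norm_le_of_periodic H.pos H.contB H.perB
  obtain ⟨Cf, hf0, hf⟩ := exists_norm_le_of_periodic H.pos H.contf H.perf
  refine ⟨(L * (1 + (CA * L + Cf)) + L * CB ^ 2).toNNReal, fun ψ h0 h1 h2 u z => ?_⟩
  have hL : 0 ≤ L := (abs_nonneg _).trans (h1 0)
  have hz0 : L < ‖z.2‖ → timeFlux A B f ψ u z = 0 := fun hz => by
    have hd : fderiv ℝ ψ z.2 = 0 := by
      have h3 : ψ =ᶠ[𝓝 z.2] fun _ => 0 := by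
        filter_upwards [(isOpen_lt continuous_const continuous_norm).mem_nhds hz] with x hx
        exact h0 x hx
      rw [h3.fderiv_eq]
      simp
    rw [timeFlux, h0 _ hz, hd]
    simp
  refine ⟨?_, hz0⟩
  rw [Real.coe_toNNReal _ (by positivity)]
  by_cases hz : L < ‖z.2‖
  · rw [hz0 hz, abs_zero]
    positivity
  · rw [not_lt] at hz
    have hg : ‖gradient (fun x => u (z.1, x)) z.2‖ = ‖dx u z‖ := norm_gradient _ _
    rw [timeFlux]
    generalize hgg : gradient (fun x => u (z.1, x)) z.2 = g at hg ⊢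
    generalize kolmogorov A B f u z = k
    rw [← hg]
    have b1 : ‖A z.1 z.2 + f z.1‖ ≤ CA * L + Cf := by
      refine (norm_add_le _ _).trans (add_le_add ?_ (hf _))
      exact ((A z.1).le_opNorm _).trans (mul_le_mul (hA _) hz (norm_nonneg _) hA0.le)
    have b2 : |⟪A z.1 z.2 + f z.1, g⟫_ℝ| ≤ (CA * L + Cf) * ‖g‖ :=
      (abs_real_inner_le_norm _ _).trans (by gcongr)
    have b3 : ‖(B z.1 * ContinuousLinearMap.adjoint (B z.1)) g‖ ≤ CB ^ 2 * ‖g‖ := by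
      rw [mul_apply_eq_comp, sq, mul_assoc]
      refine ((B z.1).le_opNorm _).trans (mul_le_mul (hB _) ?_ (norm_nonneg _) hB0.le)
      refine ((ContinuousLinearMap.adjoint (B z.1)).le_opNorm _).trans ?_
      rw [LinearIsometryEquiv.norm_map]
      gcongr
      exact hB _
    have b4 : |fderiv ℝ ψ z.2 ((B z.1 * ContinuousLinearMap.adjoint (B z.1)) g)| ≤
        L * (CB ^ 2 * ‖g‖) :=
      ((fderiv ℝ ψ z.2).le_opNorm _).trans (mul_le_mul (h2 _) b3 (norm_nonneg _) hL)
    have b5 : |(k - ⟪A z.1 z.2 + f z.1, g⟫_ℝ) * ψ z.2| ≤ (|k| + (CA * L + Cf) * ‖g‖) * L := by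
      rw [abs_mul]
      exact mul_le_mul ((abs_sub _ _).trans (add_le_add le_rfl b2)) (h1 _) (abs_nonneg _)
        (by positivity)
    have b6 : |1 / 2 * fderiv ℝ ψ z.2 ((B z.1 * ContinuousLinearMap.adjoint (B z.1)) g)| ≤
        1 / 2 * (L * (CB ^ 2 * ‖g‖)) := by
      rw [abs_mul, abs_of_pos (by norm_num : (0 : ℝ) < 1 / 2)]
      gcongr
    refine (abs_add_le _ _).trans ((add_le_add b5 b6).trans ?_)
    have hk := abs_nonneg k
    have p1 : 0 ≤ L * (CA * L + Cf) * |k| := by positivity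
    have p2 : 0 ≤ L * ‖g‖ := by positivity
    have p3 : 0 ≤ L * CB ^ 2 * |k| := by positivity
    have p4 : 0 ≤ L * CB ^ 2 * ‖g‖ := by positivity
    linarith

lemma Setting.measurable_timeFlux (H : Setting A B f T) {ψ : E n → ℝ} (hψ : ContDiff ℝ 1 ψ)
    {u : ℝ × E n → ℝ} (hu : IsTame A B f T u) : Measurable (timeFlux A B f ψ u) := by
  have hg := continuous_gradient_slice hu.isC12.contDiff
  have hk := hu.continuous_kolmogorov
  have hA := H.contA
  have hB := H.contB
  have hf := H.contf
  have hB' : Continuous fun t => ContinuousLinearMap.adjoint (B t) :=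
    (ContinuousLinearMap.adjoint (𝕜 := ℝ) (E := E n) (F := E n)).continuous.comp hB
  have hb : Continuous fun z : ℝ × E n => A z.1 z.2 + f z.1 :=
    ((hA.comp continuous_fst).clm_apply continuous_snd).add (hf.comp continuous_fst)
  have hd : Continuous fun z : ℝ × E n => fderiv ℝ ψ z.2 :=
    (hψ.continuous_fderiv one_ne_zero).comp continuous_snd
  have hBg : Continuous fun z : ℝ × E n => (B z.1 * ContinuousLinearMap.adjoint (B z.1))
      (gradient (fun x => u (z.1, x)) z.2) :=
    (hB.comp continuous_fst).clm_apply ((hB'.comp continuous_fst).clm_apply hg)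
  exact (((hk.sub (hb.inner hg)).mul (hψ.continuous.comp continuous_snd)).add
    (continuous_const.mul (hd.clm_apply hBg))).measurable

/-- Functions in the core that are bounded in the graph norm are equicontinuous in time: integrating
by parts in space replaces the time derivative by `timeFlux`, which is of first order. -/
lemma Setting.timeEquicontinuous_core (H : Setting A B f T) {w : ℕ → ℝ × E n → ℝ}
    (hw : ∀ k, w k ∈ coreSharp n T) {M : ℝ≥0}
    (hG : ∀ k, l2Norm T (nu A B f) (kolmogorov A B f (w k)) ≤ M)
    (hd : ∀ k, eLpNorm (dx (w k)) 2 (periodMeasure T (nu A B f)) ≤ M) :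
    TimeEquicontinuous T w := by
  intro L
  obtain ⟨C, hC⟩ := H.exists_eLpNorm_volume_le L
  obtain ⟨K, hK⟩ := H.exists_abs_timeFlux_le L
  refine ⟨(K * (C * M + C * M) : ℝ≥0) * √(volume.real (Metric.closedBall (0 : E n) L)),
    fun ψ h1 h2 h3 h4 k => ?_⟩
  have ht := isTame_of_mem_coreSharp H (hw k)
  have hψ1 : ContDiff ℝ 1 ψ := h1.of_le (by simp)
  have hs : HasCompactSupport ψ :=
    HasCompactSupport.of_support_subset_isCompact (isCompact_closedBall (0 : E n) L) fun y hy => by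
      rw [mem_closedBall_zero_iff]
      by_contra h'
      exact hy (h2 y (not_le.1 h'))
  refine abs_integral_sub_le ht.isC12.contDiff h1.continuous h2
    (H.measurable_timeFlux hψ1 ht) (fun z hz => (hK ψ h2 h3 h4 (w k) z).2 hz)
    (fun t _ => integral_fderiv_time_mul_eq hψ1 hs ht.isC12 t) ?_
  refine (eLpNorm_le_nnreal_smul_eLpNorm_of_ae_le_mul (c := K)
    (g := fun z => |kolmogorov A B f (w k) z| + ‖dx (w k) z‖)
    (Eventually.of_forall fun z => ?_) 2).trans ?_
  · rw [← NNReal.coe_le_coe]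
    push_cast
    refine (hK ψ h2 h3 h4 (w k) z).1.trans ?_
    rw [Real.norm_eq_abs]
    gcongr
    exact le_abs_self _
  · rw [ENNReal.smul_def, smul_eq_mul]
    push_cast
    gcongr
    have m1 : Continuous fun z => |kolmogorov A B f (w k) z| := ht.continuous_kolmogorov.abs
    have m2 : Continuous fun z => ‖dx (w k) z‖ := (continuous_dx ht.isC12.contDiff).norm
    refine (eLpNorm_add_le m1.aestronglyMeasurable m2.aestronglyMeasurable one_le_two).trans
      (add_le_add ?_ ?_)
    · refine (eLpNorm_norm (kolmogorov A B f (w k))).le.trans ((hC _).trans ?_)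
      gcongr
      exact hG k
    · refine (eLpNorm_norm (dx (w k))).le.trans ((hC _).trans ?_)
      gcongr
      exact hd k

lemma l2Norm_le_of_sub {ν : Measure (ℝ × E n)} {u v : ℝ × E n → ℝ}
    (hu : AEStronglyMeasurable u (periodMeasure T ν))
    (hv : AEStronglyMeasurable v (periodMeasure T ν)) {a b : ℝ≥0∞} (h : l2Norm T ν (u - v) ≤ a)
    (hb : l2Norm T ν v ≤ b) : l2Norm T ν u ≤ a + b := by
  calc l2Norm T ν u = l2Norm T ν ((u - v) + v) := by rw [sub_add_cancel]
    _ ≤ a + b := (eLpNorm_add_le (hu.sub hv) hv one_le_two).trans (add_le_add h hb)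

theorem Setting.compactlyEmbedded_domGSharp (H : Setting A B f T) :
    CompactlyEmbedded T (nu A B f) (domGSharp A B f T) (graphNorm A B f T) := by
  refine ⟨fun u ⟨w, hw⟩ => hw.1, ⟨1, fun u _ => ?_⟩, fun u hu ⟨N, hN⟩ => ?_⟩
  · rw [ENNReal.coe_one, one_mul, graphNorm]
    exact le_self_add
  · have hgr : ∀ k, InGraphGSharp A B f T (u k) (gSharp A B f T (u k)) := fun k => by
      have h : ∃ w, InGraphGSharp A B f T (u k) w := hu k
      rw [gSharp, dif_pos h]
      exact h.choose_spec
    -- for the images under `𝒢` only boundedness is needed, hence the distance `1`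
    have hex : ∀ k : ℕ, ∃ w ∈ coreSharp n T, l2Norm T (nu A B f) (w - u k) ≤ ((k : ℝ≥0∞) + 1)⁻¹ ∧
        l2Norm T (nu A B f) (kolmogorov A B f w - gSharp A B f T (u k)) ≤ 1 := fun k => by
      obtain ⟨-, -, v, hv, hv1, hv2⟩ := hgr k
      obtain ⟨j, hj1, hj2⟩ := ((ENNReal.tendsto_nhds_zero.1 hv1 ((k : ℝ≥0∞) + 1)⁻¹ (by simp)).and
        (ENNReal.tendsto_nhds_zero.1 hv2 1 one_pos)).exists
      exact ⟨v j, hv j, hj1, hj2⟩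
    choose w hw hw1 hw2 using hex
    have ht := fun k => isTame_of_mem_coreSharp H (hw k)
    have hn1 : ∀ k, l2Norm T (nu A B f) (w k) ≤ 1 + N := fun k =>
      l2Norm_le_of_sub (ht k).isC12.contDiff.continuous.aestronglyMeasurable
        (hgr k).1.2.2.aestronglyMeasurable ((hw1 k).trans (ENNReal.inv_le_one.2 le_add_self))
        (le_self_add.trans (hN k))
    have hn2 : ∀ k, l2Norm T (nu A B f) (kolmogorov A B f (w k)) ≤ 1 + N := fun k =>
      l2Norm_le_of_sub (ht k).continuous_kolmogorov.aestronglyMeasurable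
        (hgr k).2.1.2.2.aestronglyMeasurable (hw2 k) (le_add_self.trans (hN k))
    obtain ⟨K, hK⟩ := H.exists_eLpNorm_dx_le
    have hn3 : ∀ k, eLpNorm (dx (w k)) 2 (periodMeasure T (nu A B f)) ≤
        K * ((1 + N) + (1 + N)) := fun k =>
      (hK _ (hw k)).trans (mul_le_mul_right (add_le_add (hn1 k) (hn2 k)) _)
    have hM1 : (1 + N : ℝ≥0∞) ≤ ((1 + N + K * ((1 + N) + (1 + N)) : ℝ≥0) : ℝ≥0∞) := by
      push_cast; exact le_self_add
    have hM2 : (K * ((1 + N) + (1 + N)) : ℝ≥0∞) ≤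
        ((1 + N + K * ((1 + N) + (1 + N)) : ℝ≥0) : ℝ≥0∞) := by
      push_cast; exact le_add_self
    refine H.exists_subseq_tendsto (fun k => (ht k).isC12.contDiff)
      (fun k => (hn1 k).trans hM1) (fun k => (hn3 k).trans hM2)
      (H.timeEquicontinuous_core hw (fun k => (hn2 k).trans hM1) (fun k => (hn3 k).trans hM2))
      (fun k => (hgr k).1) ?_
    refine tendsto_of_tendsto_of_tendsto_of_le_of_le tendsto_const_nhds ?_ (fun _ => bot_le) hw1
    have h := (tendsto_add_atTop_iff_nat (f := fun k : ℕ => (k : ℝ≥0∞)⁻¹) 1).2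
      ENNReal.tendsto_inv_nat_nhds_zero
    simpa using h

end Domain

end

end OU

theorem proposition5p2 (n : ℕ) (T : ℝ) (hT : 0 < T)
    (A B : ℝ → OU.E n →L[ℝ] OU.E n) (f : ℝ → OU.E n)
    (hA : Continuous A) (hB : Continuous B) (hf : Continuous f)
    (hAT : Function.Periodic A T) (hBT : Function.Periodic B T) (hfT : Function.Periodic f T)
    (hB0 : ∃ μ₀ : ℝ, 0 < μ₀ ∧ ∀ (t : ℝ) (x : OU.E n), μ₀ * ‖x‖ ≤ ‖B t x‖)
    (hU : OU.growthBound A < 0) :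
    OU.CompactlyEmbedded T (OU.nu A B f) {u | OU.MemH12Sharp T (OU.nu A B f) u}
        (OU.h12Norm T (OU.nu A B f)) ∧
      OU.CompactlyEmbedded T (OU.nu A B f) (OU.domGSharp A B f T) (OU.graphNorm A B f T) := by
  have H : OU.Setting A B f T := ⟨hT, hA, hB, hf, hAT, hBT, hfT, hB0, hU⟩
  exact ⟨H.compactlyEmbedded_h12, H.compactlyEmbedded_domGSharp⟩
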